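/- Let $(M,ds_M^2)$ be a non-empty closed (compact, boundaryless) smooth Riemannian manifold of dimension $m$, and let $\xi$ be a smooth Riemannian vector bundle of rank $n\ge 1$ over $M$ with fibre metric $\langle\cdot,\cdot\rangle$, total space $E$ and projection $\pi:E\to M$. Let $D$ be a smooth connection on $\xi$ compatible with $\langle\cdot,\cdot\rangle$, let $K_{(p,v)}:T_{(p,v)}E\to\xi_p$ be its connector (in a local frame $(e_\alpha)$ of $\xi$ with fibre coordinates $v_\alpha$ and $De_\alpha=\sum_\beta\omega_{\alpha\beta}e_\beta$, $K=\sum_\alpha\bigl(dv_\alpha+\sum_\beta v_\beta\,\pi^*\omega_{\beta\alpha}\bigr)\otimes e_\alpha$), and let $$ds_\xi^2(u,w)=ds_M^2(d\pi\,u,d\pi\,w)+\langle Ku,Kw\rangle$$ be the connection metric on $E$. For $r>0$ put $S_r(\xi)=\{(p,v)\in E:\langle v,v\rangle=r^2\}$. Then: (0) $ds_\xi^2$ is a smooth complete Riemannian metric on $E$, and $E$ is connected if $M$ is. (1) For every $r>0$, $S_r(\xi)$ is a smooth embedded hypersurface of $E$ (of dimension $m+n-1$), and it is an isoparametric hypersurface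 of $(E,ds_\xi^2)$: it is a non-empty regular level set of an isoparametric function, that is, of a non-constant smooth function $f:E\to\mathbb R$ such that $|\nabla f|^2=b(f)$ and $\Delta f=a(f)$ for some smooth $b:\mathbb R\to\mathbb R$ and continuous $a:\mathbb R\to\mathbb R$. With respect to the outward unit normal field $\eta$ (shape operator $u\mapsto-\nabla_u\eta$), its principal curvatures at every point are $0$ with multiplicity $m$ and $-1/r$ with multiplicity $n-1$. (2) If in addition $(M,ds_M^2)$ has positive Ricci curvature and $n\ge 3$, then there is $r_0>0$ such that for all $0<r<r_0$ the metric induced by $ds_\xi^2$ on $S_r(\xi)$ has positive Ricci curvature. -/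

import Mathlib

noncomputable section

/-! ### Local Riemannian geometry: metrics on (open subsets of) a vector space -/

section LocalGeometry

variable {W : Type*} [NormedAddCommGroup W] [NormedSpace ℝ W]

/-- The functional `w ↦ (∂_u g)(v, w) + (∂_v g)(u, w) - (∂_w g)(u, v)` at `y`, for a field `g` of
bilinear forms on `W`. -/
def koszulForm (g : W → W →L[ℝ] W →L[ℝ] ℝ) (y u v : W) : W →L[ℝ] ℝ :=
  fderiv ℝ g y u v + fderiv ℝ g y v u - ((fderiv ℝ g y).flip u).flip v

theorem koszulForm_apply (g : W → W →L[ℝ] W →L[ℝ] ℝ) (y u v w : W) :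
    koszulForm g y u v w =
      fderiv ℝ g y u v w + fderiv ℝ g y v u w - fderiv ℝ g y w u v := rfl

/-- The Christoffel symbols of the metric `g`, as a bilinear map `Γ_y : W × W → W`, determined by
`2 g(Γ(u, v), w) = (∂_u g)(v, w) + (∂_v g)(u, w) - (∂_w g)(u, v)` (see `christoffel_apply`). -/
def christoffel (g : W → W →L[ℝ] W →L[ℝ] ℝ) (y : W) : W →L[ℝ] W →L[ℝ] W :=
  letI sharp : (W →L[ℝ] W →L[ℝ] ℝ) →L[ℝ] (W →L[ℝ] W) :=
    ContinuousLinearMap.compL ℝ W (W →L[ℝ] ℝ) W (g y).inverse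
  letI flipMap : (W →L[ℝ] W →L[ℝ] ℝ) →L[ℝ] (W →L[ℝ] W →L[ℝ] ℝ) :=
    (ContinuousLinearMap.flipₗᵢ ℝ W W ℝ).toContinuousLinearEquiv.toContinuousLinearMap
  (2⁻¹ : ℝ) • (sharp ∘L fderiv ℝ g y + sharp ∘L (fderiv ℝ g y).flip
    - sharp ∘L (flipMap ∘L (fderiv ℝ g y).flip))

theorem christoffel_apply (g : W → W →L[ℝ] W →L[ℝ] ℝ) (y u v : W) :
    christoffel g y u v = (2⁻¹ : ℝ) • (g y).inverse (koszulForm g y u v) := by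
  rw [koszulForm, map_sub, map_add]
  rfl

/-- The map `u ↦ R(u, v) w` at `y`, where `R` is the Riemann curvature tensor of `g`:
`R(u, v) w = (∂_u Γ)(v, w) - (∂_v Γ)(u, w) + Γ(u, Γ(v, w)) - Γ(v, Γ(u, w))`. -/
def curvatureEndo (g : W → W →L[ℝ] W →L[ℝ] ℝ) (y v w : W) : W →L[ℝ] W :=
  ((fderiv ℝ (christoffel g) y).flip v).flip w
    - (fderiv ℝ (christoffel g) y v).flip w
    + (christoffel g y).flip (christoffel g y v w)
    - (christoffel g y v) ∘L ((christoffel g y).flip w)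

theorem curvatureEndo_apply (g : W → W →L[ℝ] W →L[ℝ] ℝ) (y u v w : W) :
    curvatureEndo g y v w u =
      fderiv ℝ (christoffel g) y u v w - fderiv ℝ (christoffel g) y v u w
        + christoffel g y u (christoffel g y v w)
        - christoffel g y v (christoffel g y u w) := rfl

/-- The Ricci tensor `Ric(v, w) = tr (u ↦ R(u, v) w)` of the metric `g` at `y`. -/
def ricci (g : W → W →L[ℝ] W →L[ℝ] ℝ) (y v w : W) : ℝ :=
  LinearMap.trace ℝ W (curvatureEndo g y v w : W →ₗ[ℝ] W)

end LocalGeometry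

end

open Bundle Set Filter Topology Manifold
open scoped ContDiff ENNReal

noncomputable section

/-! ### Riemannian geometry on a manifold (without boundary) -/

section ManifoldGeometry

variable {E : Type*} [NormedAddCommGroup E] [NormedSpace ℝ E]
  {H : Type*} [TopologicalSpace H] {I : ModelWithCorners ℝ E H}
  {N : Type*} [TopologicalSpace N] [ChartedSpace H N]

variable (I N) in
/-- A field of (continuous) bilinear forms on the tangent spaces of `N`. -/
abbrev BilinearField := ∀ x : N, TangentSpace I x →L[ℝ] TangentSpace I x →L[ℝ] ℝ

/-- `G` is a smooth Riemannian metric on `N`. -/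
def IsRiemannianMetric [IsManifold I 1 N] (G : BilinearField I N) : Prop :=
  ∃ g : ContMDiffRiemannianMetric I ∞ E (fun x : N ↦ TangentSpace I x), ∀ x, g.inner x = G x

/-- The Riemannian distance of `G`: the infimum of the `G`-lengths of `C¹` paths. -/
def metricEDist (G : BilinearField I N) (x y : N) : ℝ≥0∞ :=
  letI : ∀ z : N, ENorm (TangentSpace I z) :=
    fun z ↦ ⟨fun v ↦ ENNReal.ofReal (Real.sqrt (G z v v))⟩
  riemannianEDist I x y

/-- Completeness of `N` with respect to the Riemannian distance of `G`. -/
def IsCompleteMetric (G : BilinearField I N) : Prop :=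
  ∀ x : ℕ → N,
    (∀ ε : ℝ≥0∞, 0 < ε → ∃ k₀, ∀ k ≥ k₀, ∀ l ≥ k₀, metricEDist G (x k) (x l) < ε) →
    ∃ z : N, Tendsto (fun k ↦ metricEDist G (x k) z) atTop (𝓝 0)

variable {W : Type*} [NormedAddCommGroup W] [NormedSpace ℝ W]

variable (I) in
/-- The differential at `y` of a map `φ` from a vector space to `N`. -/
def paramDeriv (φ : W → N) (y : W) : W →L[ℝ] TangentSpace I (φ y) :=
  mfderiv 𝓘(ℝ, W) I φ y

/-- The pull-back `φ^* G` under a map `φ` from a vector space to `N`. -/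
def pullbackMetric (G : BilinearField I N) (φ : W → N) (y : W) : W →L[ℝ] W →L[ℝ] ℝ :=
  (paramDeriv I φ y).precomp ℝ ∘L (G (φ y) ∘L paramDeriv I φ y)

theorem pullbackMetric_apply (G : BilinearField I N) (φ : W → N) (y u v : W) :
    pullbackMetric G φ y u v = G (φ y) (paramDeriv I φ y u) (paramDeriv I φ y v) := rfl

/-- The gradient of `f`: `G(grad f, ·) = df`. -/
def riemGradient (G : BilinearField I N) (f : N → ℝ) (x : N) : TangentSpace I x :=
  (G x).inverse (mvfderiv I f x)

/-- A vector field `X` on `N` read in the coordinates given by `φ`. -/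
def readVectorField (φ : W → N) (X : ∀ x : N, TangentSpace I x) (y : W) : W :=
  (paramDeriv I φ y).inverse (X (φ y))

/-- The Levi-Civita covariant derivative `u ↦ ∇_u X` of a vector field `X` at `x`, computed in the
chart at `x`: if `Y` is `X` in coordinates, `∇_u X` is `∂_u Y + Γ(u, Y)` in coordinates. -/
def covDeriv (G : BilinearField I N) (X : ∀ x : N, TangentSpace I x) (x : N) :
    TangentSpace I x →L[ℝ] TangentSpace I x :=
  letI φ : E → N := (extChartAt I x).symm
  letI y : E := extChartAt I x x
  letI Y : E → E := readVectorField φ X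
  letI A : E →L[ℝ] TangentSpace I x := (mfderiv I 𝓘(ℝ, E) (extChartAt I x) x).inverse
  letI B : TangentSpace I x →L[ℝ] E := mfderiv I 𝓘(ℝ, E) (extChartAt I x) x
  A ∘L (fderiv ℝ Y y + (christoffel (pullbackMetric G φ) y).flip (Y y)) ∘L B

/-- The Laplace-Beltrami operator `Δ f = tr (u ↦ ∇_u grad f)`. -/
def laplaceBeltrami (G : BilinearField I N) (f : N → ℝ) (x : N) : ℝ :=
  LinearMap.trace ℝ (TangentSpace I x)
    (covDeriv G (riemGradient G f) x : TangentSpace I x →ₗ[ℝ] TangentSpace I x)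

/-- `f` is an isoparametric function: smooth, non-constant, `|grad f|² = b(f)` with `b` smooth,
and `Δ f = a(f)` with `a` continuous. -/
structure IsIsoparametricFunction (G : BilinearField I N) (f : N → ℝ) : Prop where
  smooth : ContMDiff I 𝓘(ℝ, ℝ) ∞ f
  nonconstant : ∃ x y, f x ≠ f y
  transnormal : ∃ b : ℝ → ℝ, ContDiff ℝ ∞ b ∧
    ∀ x, G x (riemGradient G f x) (riemGradient G f x) = b (f x)
  laplacian : ∃ a : ℝ → ℝ, Continuous a ∧ ∀ x, laplaceBeltrami G f x = a (f x)

/-- `S` is an isoparametric hypersurface: a (non-empty) regular level set of an isoparametric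
function. -/
def IsIsoparametricHypersurface (G : BilinearField I N) (S : Set N) : Prop :=
  ∃ (f : N → ℝ) (c : ℝ), IsIsoparametricFunction G f ∧ S = f ⁻¹' {c} ∧ S.Nonempty ∧
    ∀ x ∈ S, mvfderiv I f x ≠ 0

/-- The unit normal field `grad f / |grad f|` of the regular level hypersurfaces of `f`. -/
def levelUnitNormal (G : BilinearField I N) (f : N → ℝ) (x : N) : TangentSpace I x :=
  (Real.sqrt (G x (riemGradient G f x) (riemGradient G f x)))⁻¹ • riemGradient G f x

/-- The space of principal vectors at `x`, for the principal curvature `κ`, of the level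
hypersurface of `f` through the regular point `x`, with respect to `η = grad f / |grad f|`:
the vectors `u` tangent to the hypersurface (`df(u) = 0`) such that `-∇_u η = κ u`. -/
def principalSpace (G : BilinearField I N) (f : N → ℝ) (x : N) (κ : ℝ) :
    Submodule ℝ (TangentSpace I x) :=
  LinearMap.ker (mvfderiv I f x : TangentSpace I x →ₗ[ℝ] ℝ) ⊓
    Module.End.eigenspace
      (-(covDeriv G (levelUnitNormal G f) x : TangentSpace I x →ₗ[ℝ] TangentSpace I x)) κ

variable (I) in
/-- `φ : U → N` is a local parametrization of the `d`-dimensional embedded submanifold `S`: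
a smooth immersion of the open set `U ⊆ ℝ^d` which is a homeomorphism onto a relatively open
subset of `S`. -/
structure IsLocalParametrization (d : ℕ) (S : Set N) (U : Set (EuclideanSpace ℝ (Fin d)))
    (φ : EuclideanSpace ℝ (Fin d) → N) : Prop where
  isOpen : IsOpen U
  smooth : ContMDiffOn 𝓘(ℝ, EuclideanSpace ℝ (Fin d)) I ∞ φ U
  immersion : ∀ y ∈ U, Function.Injective (paramDeriv I φ y)
  embedding : IsEmbedding (U.domRestrict φ)
  image_open : ∃ O : Set N, IsOpen O ∧ φ '' U = O ∩ S

variable (I) in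
/-- `S` is a smooth embedded submanifold of dimension `d` of `N`. -/
def IsEmbeddedSubmanifold (d : ℕ) (S : Set N) : Prop :=
  ∀ x ∈ S, ∃ U φ, IsLocalParametrization I d S U φ ∧ x ∈ φ '' U

/-- The metric induced by `G` on the `d`-dimensional embedded submanifold `S` has positive Ricci
curvature: its Ricci tensor, in any local coordinates, is positive definite.
For `S = univ` this is positivity of the Ricci curvature of `N` itself. -/
def HasPositiveRicci (G : BilinearField I N) (d : ℕ) (S : Set N) : Prop :=
  ∀ U φ, IsLocalParametrization I d S U φ → ∀ y ∈ U, ∀ u : EuclideanSpace ℝ (Fin d), u ≠ 0 →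
    0 < ricci (pullbackMetric G φ) y u u

end ManifoldGeometry

/-! ### The connection metric on the total space of a Riemannian vector bundle -/

section ConnectionMetric

variable {EM : Type*} [NormedAddCommGroup EM] [NormedSpace ℝ EM]
  {H : Type*} [TopologicalSpace H] {I : ModelWithCorners ℝ EM H}
  {M : Type*} [TopologicalSpace M] [ChartedSpace H M]
  {F : Type*} [NormedAddCommGroup F] [NormedSpace ℝ F]
  {ξ : M → Type*} [TopologicalSpace (TotalSpace F ξ)]
  [∀ p, NormedAddCommGroup (ξ p)] [∀ p, InnerProductSpace ℝ (ξ p)]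
  [FiberBundle F ξ] [VectorBundle ℝ F ξ]

/-- The differential of the bundle projection `π` at `x`. -/
def projDeriv (x : TotalSpace F ξ) :
    TangentSpace (I.prod 𝓘(ℝ, F)) x →L[ℝ] TangentSpace I x.proj :=
  mfderiv (I.prod 𝓘(ℝ, F)) I (TotalSpace.proj : TotalSpace F ξ → M) x

/-- The connector `K` of the connection `D`, at the point `x = (p, v)` of the total space.
In the preferred local trivialization, with local frame `(e_α)` and fibre coordinates `v_α`, it is
`∑_α dv_α ⊗ e_α + ∑_α v_α D e_α = ∑_α (dv_α + ∑_β v_β ω_{βα}) ⊗ e_α`;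
`FiberBundle.extend F v` is the local section with constant coordinates through `v`. -/
def connector (D : CovariantDerivative I F ξ) (x : TotalSpace F ξ) :
    TangentSpace (I.prod 𝓘(ℝ, F)) x →L[ℝ] ξ x.proj :=
  (trivializationAt F ξ x.proj).symmL ℝ x.proj ∘L
      mvfderiv (I.prod 𝓘(ℝ, F)) (fun z : TotalSpace F ξ ↦ (trivializationAt F ξ x.proj z).2) x
    + D (FiberBundle.extend F x.snd) x.proj ∘L projDeriv x

/-- The connection metric on the total space:
`ds²(u, w) = g(dπ u, dπ w) + ⟨K u, K w⟩`. -/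
def connectionMetric (g : BilinearField I M) (D : CovariantDerivative I F ξ) :
    BilinearField (I.prod 𝓘(ℝ, F)) (TotalSpace F ξ) := fun x ↦
  (projDeriv x).precomp ℝ ∘L (g x.proj ∘L projDeriv x)
    + (connector D x).precomp ℝ ∘L (innerSL ℝ ∘L connector D x)

theorem connectionMetric_apply (g : BilinearField I M) (D : CovariantDerivative I F ξ)
    (x : TotalSpace F ξ) (u w : TangentSpace (I.prod 𝓘(ℝ, F)) x) :
    connectionMetric g D x u w =
      g x.proj (projDeriv x u) (projDeriv x w)
        + inner ℝ (connector D x u) (connector D x w) := rfl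

variable (F ξ) in
/-- The function `(p, v) ↦ ⟨v, v⟩` on the total space. -/
def fiberNormSq (x : TotalSpace F ξ) : ℝ := inner ℝ x.snd x.snd

variable (F ξ) in
/-- The sphere bundle `S_r(ξ)`. -/
def sphereBundle (r : ℝ) : Set (TotalSpace F ξ) := {x | inner ℝ x.snd x.snd = r ^ 2}

end ConnectionMetric

end

/-! Everything rests on the position field P, the vertical field with value v at (p, v). In a bundle
chart with base metric g, fibre metric k and connection form A, the connector is K(a, b) = b + A(a)v
and the connection metric is g(a, a') + k(K, K'). The Koszul formula gives ∇_u P = (0, Ku), the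
vertical projection of u (`christoffel_position`). The one term that could spoil this is the
curvature of D paired as ⟨R(·, ·)v, v⟩, which vanishes because D is metric
(`curvature_skew_of_compatible`).

Put f(p, v) = ⟨v, v⟩. Then grad f = 2P, so |grad f|² = 4f, and Δf is twice the trace of the vertical
projection, that is 2n; hence f is isoparametric. The unit normal of S_r is P/|v|, and on vectors
tangent to S_r its covariant derivative is (0, Ku)/r. So -∇η is 0 on the m-dimensional horizontal
space and -1/r on the (n-1)-dimensional space of vertical tangent vectors
(`covDeriv_connectionMetric`, `mem_principalSpace_fiberNormSq`). Completeness holds because √(1 + f)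
is proper, M being compact, and its differential has norm at most one
(`isCompleteMetric_of_proper`).

For Ricci curvature, differentiating the formula for ∇P gives R(·, P)P = 0
(`curvatureEndo_position`). Relative to the normal P, the second fundamental form of S_r is -k(Ku,
Kw)/r². The trace of the Gauss equation then gives the exact formula Ric_S(u, u) = Ric_E(u, u) + (n
- 2)|Ku|²/r² (`ricci_inducedMetric`). On the zero section, which is totally geodesic and isometric
to M, Ric_E(a, a) = Ric_M(a, a) for horizontal a (`ricci_zero_horizontal`). So close to the zero
section Ric_E is positive in nearly horizontal directions, while in the others the factor (n - 2)/r²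
makes the second term dominate. Compactness of the unit sphere, then of M, produces r₀
(`eventually_ricci_add_pos`, `exists_forall_sphereBundle_pos`).

All curvature computations take place on open subsets of a vector space. They reach the manifold
through `pullbackMetric_connectionMetric` and `isConnectionData_coord`, which say that a bundle
chart turns the connection metric into the local model. -/

noncomputable section

set_option maxSynthPendingDepth 3

/-! ### Calculus of bilinear expressions -/

section Calculus

variable {W E₁ E₂ E₃ : Type*} [NormedAddCommGroup W] [NormedSpace ℝ W]
  [NormedAddCommGroup E₁] [NormedSpace ℝ E₁] [NormedAddCommGroup E₂] [NormedSpace ℝ E₂]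
  [NormedAddCommGroup E₃] [NormedSpace ℝ E₃]

theorem fderiv_bilin_apply {B : W → E₁ →L[ℝ] E₂ →L[ℝ] E₃} {a : W → E₁} {b : W → E₂} {y : W}
    (hB : DifferentiableAt ℝ B y) (ha : DifferentiableAt ℝ a y) (hb : DifferentiableAt ℝ b y)
    (w : W) :
    fderiv ℝ (fun z ↦ B z (a z) (b z)) y w =
      fderiv ℝ B y w (a y) (b y) + B y (fderiv ℝ a y w) (b y) + B y (a y) (fderiv ℝ b y w) := by
  have h := (hB.hasFDerivAt.clm_apply ha.hasFDerivAt).clm_apply hb.hasFDerivAt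
  rw [h.fderiv]
  simp
  abel

theorem fderiv_clm_apply_const {L : W → E₁ →L[ℝ] E₂} {y : W} (hL : DifferentiableAt ℝ L y)
    (a : E₁) (w : W) : fderiv ℝ (fun z ↦ L z a) y w = fderiv ℝ L y w a := by
  have h := hL.hasFDerivAt.clm_apply (hasFDerivAt_const a y)
  rw [h.fderiv]
  simp

theorem fderiv_bilin_apply_const {B : W → E₁ →L[ℝ] E₂ →L[ℝ] E₃} {y : W}
    (hB : DifferentiableAt ℝ B y) (a : E₁) (b : E₂) (w : W) :
    fderiv ℝ (fun z ↦ B z a b) y w = fderiv ℝ B y w a b := by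
  rw [fderiv_bilin_apply hB (differentiableAt_const a) (differentiableAt_const b)]
  simp

theorem fderiv_fderiv_symm {f : W → E₁} {y : W} (hf : ContDiffAt ℝ ∞ f y) (u v : W) :
    fderiv ℝ (fderiv ℝ f) y u v = fderiv ℝ (fderiv ℝ f) y v u := by
  have : minSmoothness ℝ 2 ≤ (∞ : WithTop ℕ∞) := by
    simp only [minSmoothness_of_isRCLikeNormedField]
    exact WithTop.coe_le_coe.2 le_top
  exact hf.isSymmSndFDerivAt this u v

theorem contDiffAt_fderiv_infty {f : W → E₁} {y : W} (hf : ContDiffAt ℝ ∞ f y) :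
    ContDiffAt ℝ ∞ (fderiv ℝ f) y :=
  hf.fderiv_right (m := ∞) (by simp)

theorem differentiableAt_of_infty {f : W → E₁} {y : W} (hf : ContDiffAt ℝ ∞ f y) :
    DifferentiableAt ℝ f y := hf.differentiableAt (by simp)

/-- The curvature of a linear connection compatible with a family of bilinear forms is
skew-symmetric. -/
theorem curvature_skew_of_compatible {k : W → E₁ →L[ℝ] E₁ →L[ℝ] ℝ} {A : W → W →L[ℝ] E₁ →L[ℝ] E₁}
    {x : W} (hk : ContDiffAt ℝ ∞ k x) (hA : DifferentiableAt ℝ A x)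
    (hsymm : ∀ b b', k x b b' = k x b' b)
    (hcompat : ∀ᶠ z in 𝓝 x, ∀ a b b',
      fderiv ℝ k z a b b' = k z (A z a b) b' + k z b (A z a b')) (a α : W) (v : E₁) :
    k x (fderiv ℝ A x a α v - fderiv ℝ A x α a v + A x a (A x α v) - A x α (A x a v)) v = 0 := by
  have hk1 := differentiableAt_of_infty hk
  have hk2 := differentiableAt_of_infty (contDiffAt_fderiv_infty hk)
  -- Differentiate the compatibility identity once more. Antisymmetrizing in `a` and `α` removes the
  -- second derivative of `k` and the mixed terms k(A(a)v, A(α)v), leaving only the curvature.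
  have key : ∀ a α : W, fderiv ℝ (fderiv ℝ k) x a α v v =
      fderiv ℝ k x a (A x α v) v + k x (fderiv ℝ A x a α v) v
      + (fderiv ℝ k x a v (A x α v) + k x v (fderiv ℝ A x a α v)) := by
    intro a α
    have h1 : (fun z ↦ fderiv ℝ k z α v v) =ᶠ[𝓝 x]
        (fun z ↦ k z (A z α v) v + k z v (A z α v)) := by
      filter_upwards [hcompat] with z hz using hz α v v
    have h2 := DFunLike.congr_fun (h1.fderiv_eq (𝕜 := ℝ)) a
    have hAv : DifferentiableAt ℝ (fun z ↦ A z α v) x := by fun_prop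
    have h3 : fderiv ℝ (fun z ↦ fderiv ℝ k z α v v) x a = fderiv ℝ (fderiv ℝ k) x a α v v := by
      have : DifferentiableAt ℝ (fun z ↦ fderiv ℝ k z α) x := by fun_prop
      rw [fderiv_bilin_apply_const this, fderiv_clm_apply_const hk2]
    rw [h3] at h2
    rw [h2, fderiv_fun_add (by fun_prop) (by fun_prop)]
    simp only [add_apply]
    rw [fderiv_bilin_apply hk1 hAv (differentiableAt_const v),
      fderiv_bilin_apply hk1 (differentiableAt_const v) hAv, fderiv_bilin_apply_const hA]
    simp
  have h1 := key a α
  have h2 := key α a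
  rw [fderiv_fderiv_symm hk a α] at h1
  have hx := hcompat.self_of_nhds
  rw [hx, hx] at h1 h2
  simp only [map_sub, map_add, sub_apply, add_apply]
  have s1 := hsymm v (fderiv ℝ A x a α v)
  have s2 := hsymm v (fderiv ℝ A x α a v)
  have s3 := hsymm v (A x a (A x α v))
  have s4 := hsymm v (A x α (A x a v))
  linarith

end Calculus

/-! ### Metrics on open subsets of a vector space -/

section Metric

variable {W : Type*} [NormedAddCommGroup W] [NormedSpace ℝ W]

/-- `G` is a smooth Riemannian metric on the open set `O`. -/
structure IsMetricOn (G : W → W →L[ℝ] W →L[ℝ] ℝ) (O : Set W) : Prop where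
  isOpen : IsOpen O
  contDiffOn : ContDiffOn ℝ ∞ G O
  symm : ∀ y ∈ O, ∀ u v, G y u v = G y v u
  pos : ∀ y ∈ O, ∀ u, u ≠ 0 → 0 < G y u u

theorem isInvertible_of_pos [FiniteDimensional ℝ W] {b : W →L[ℝ] W →L[ℝ] ℝ}
    (hb : ∀ u, u ≠ 0 → 0 < b u u) : b.IsInvertible := by
  have hinj : Function.Injective b := by
    rw [injective_iff_map_eq_zero]
    intro u hu
    by_contra h
    have := hb u h
    simp [hu] at this
  have hfr : Module.finrank ℝ W = Module.finrank ℝ (W →L[ℝ] ℝ) := by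
    have e : (W →L[ℝ] ℝ) ≃ₗ[ℝ] Module.Dual ℝ W := LinearMap.toContinuousLinearMap.symm
    rw [e.finrank_eq, Subspace.dual_finrank_eq]
  refine ⟨(LinearEquiv.ofInjectiveOfFinrankEq (b : W →ₗ[ℝ] (W →L[ℝ] ℝ)) hinj hfr).toContinuousLinearEquiv, ?_⟩
  ext u v
  rfl

theorem eq_of_forall_bilin_eq {b : W →L[ℝ] W →L[ℝ] ℝ} (hb : ∀ u, u ≠ 0 → 0 < b u u) {u v : W}
    (h : ∀ w, b u w = b v w) : u = v := by
  by_contra hne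
  have := hb _ (sub_ne_zero.2 hne)
  simp [h] at this

namespace IsMetricOn

variable {G : W → W →L[ℝ] W →L[ℝ] ℝ} {O : Set W} {y : W}

theorem contDiffAt (hG : IsMetricOn G O) (hy : y ∈ O) : ContDiffAt ℝ ∞ G y :=
  hG.contDiffOn.contDiffAt (hG.isOpen.mem_nhds hy)

theorem fderiv_symm (hG : IsMetricOn G O) (hy : y ∈ O) (w u v : W) :
    fderiv ℝ G y w u v = fderiv ℝ G y w v u := by
  have hd := differentiableAt_of_infty (hG.contDiffAt hy)
  rw [← fderiv_bilin_apply_const hd, ← fderiv_bilin_apply_const hd]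
  have : (fun z ↦ G z u v) =ᶠ[𝓝 y] (fun z ↦ G z v u) := by
    filter_upwards [hG.isOpen.mem_nhds hy] with z hz using hG.symm z hz u v
  rw [this.fderiv_eq]

variable [FiniteDimensional ℝ W]

theorem isInvertible (hG : IsMetricOn G O) (hy : y ∈ O) : (G y).IsInvertible :=
  isInvertible_of_pos (hG.pos y hy)

theorem two_mul_apply_christoffel (hG : IsMetricOn G O) (hy : y ∈ O) (u v w : W) :
    2 * G y (christoffel G y u v) w =
      fderiv ℝ G y u v w + fderiv ℝ G y v u w - fderiv ℝ G y w u v := by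
  rw [christoffel_apply, map_smul, (hG.isInvertible hy).self_apply_inverse,
    smul_apply, koszulForm_apply]
  simp

/-- Since the metric is nondegenerate, Christoffel symbols can be identified by pairing with test
vectors, without ever computing the inverse of the metric. -/
theorem christoffel_eq (hG : IsMetricOn G O) (hy : y ∈ O) {u v z : W}
    (h : ∀ w, 2 * G y z w = fderiv ℝ G y u v w + fderiv ℝ G y v u w - fderiv ℝ G y w u v) :
    christoffel G y u v = z := by
  refine eq_of_forall_bilin_eq (hG.pos y hy) fun w ↦ ?_
  linarith [h w, hG.two_mul_apply_christoffel hy u v w]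

theorem christoffel_symm (hG : IsMetricOn G O) (hy : y ∈ O) (u v : W) :
    christoffel G y u v = christoffel G y v u := by
  refine hG.christoffel_eq hy fun w ↦ ?_
  rw [hG.two_mul_apply_christoffel hy, hG.fderiv_symm hy w u v]
  ring

theorem compatible (hG : IsMetricOn G O) (hy : y ∈ O) (a b b' : W) :
    fderiv ℝ G y a b b' = G y (christoffel G y a b) b' + G y b (christoffel G y a b') := by
  rw [hG.symm y hy b]
  have h1 := hG.two_mul_apply_christoffel hy a b b'
  have h2 := hG.two_mul_apply_christoffel hy a b' b
  rw [hG.fderiv_symm hy a b' b] at h2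
  linarith [hG.fderiv_symm hy b' a b, hG.fderiv_symm hy b a b']

theorem contDiffAt_christoffel (hG : IsMetricOn G O) (hy : y ∈ O) :
    ContDiffAt ℝ ∞ (christoffel G) y := by
  have h0 := hG.contDiffAt hy
  have h1 := contDiffAt_fderiv_infty h0
  have hinv : ContDiffAt ℝ ∞ (fun z ↦ (G z).inverse) y :=
    (hG.isInvertible hy).contDiffAt_map_inverse.comp y h0
  have hsharp : ContDiffAt ℝ ∞ (fun z ↦ ContinuousLinearMap.compL ℝ W (W →L[ℝ] ℝ) W (G z).inverse) y :=
    (ContinuousLinearMap.compL ℝ W (W →L[ℝ] ℝ) W).contDiff.contDiffAt.comp y hinv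
  have hflip : ContDiffAt ℝ ∞ (fun z ↦ (fderiv ℝ G z).flip) y :=
    (ContinuousLinearMap.flipₗᵢ ℝ W W (W →L[ℝ] ℝ)).contDiff.contDiffAt.comp y h1
  unfold christoffel
  exact ContDiffAt.const_smul (2⁻¹ : ℝ) (((hsharp.clm_comp h1).add (hsharp.clm_comp hflip)).sub
    (hsharp.clm_comp (contDiffAt_const.clm_comp hflip)))

theorem curvature_skew_self (hG : IsMetricOn G O) (hy : y ∈ O) (u v w : W) :
    G y (curvatureEndo G y v w u) w = 0 := by
  rw [curvatureEndo_apply]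
  refine curvature_skew_of_compatible (hG.contDiffAt hy)
    (differentiableAt_of_infty (hG.contDiffAt_christoffel hy)) (hG.symm y hy) ?_ u v w
  filter_upwards [hG.isOpen.mem_nhds hy] with z hz using hG.compatible hz

theorem curvature_skew (hG : IsMetricOn G O) (hy : y ∈ O) (u v w z : W) :
    G y (curvatureEndo G y v w u) z = - G y (curvatureEndo G y v z u) w := by
  have h := hG.curvature_skew_self hy u v (w + z)
  have h1 := hG.curvature_skew_self hy u v w
  have h2 := hG.curvature_skew_self hy u v z
  simp only [curvatureEndo_apply, map_add, map_sub, add_apply,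
    sub_apply] at *
  linarith

/-- Needed to carry a curvature identity known off the zero section to the zero section by a limit.
-/
theorem continuousAt_curvatureEndo (hG : IsMetricOn G O) (hy : y ∈ O) (v w : W) :
    ContinuousAt (fun z ↦ curvatureEndo G z v w) y := by
  have h1 := (hG.contDiffAt_christoffel hy).continuousAt
  have h2 := (contDiffAt_fderiv_infty (hG.contDiffAt_christoffel hy)).continuousAt
  have hflip := (ContinuousLinearMap.flipₗᵢ ℝ W W W).continuous.continuousAt.comp h1
  have hflip2 := (ContinuousLinearMap.flipₗᵢ ℝ W W (W →L[ℝ] W)).continuous.continuousAt.comp h2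
  have a1 : ContinuousAt (fun z ↦ ((fderiv ℝ (christoffel G) z).flip v).flip w) y :=
    ((ContinuousLinearMap.flipₗᵢ ℝ W W W).continuous.continuousAt.comp
      (hflip2.clm_apply continuousAt_const)).clm_apply continuousAt_const
  have a2 : ContinuousAt (fun z ↦ (fderiv ℝ (christoffel G) z v).flip w) y :=
    ((ContinuousLinearMap.flipₗᵢ ℝ W W W).continuous.continuousAt.comp
      (h2.clm_apply continuousAt_const)).clm_apply continuousAt_const
  have a3 : ContinuousAt (fun z ↦ (christoffel G z).flip (christoffel G z v w)) y :=
    hflip.clm_apply ((h1.clm_apply continuousAt_const).clm_apply continuousAt_const)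
  have a4 : ContinuousAt (fun z ↦ (christoffel G z v) ∘L ((christoffel G z).flip w)) y :=
    (h1.clm_apply continuousAt_const).clm_comp (hflip.clm_apply continuousAt_const)
  exact ((a1.sub a2).add a3).sub a4

end IsMetricOn

theorem christoffel_congr {G G' : W → W →L[ℝ] W →L[ℝ] ℝ} {y : W} (h : G =ᶠ[𝓝 y] G') :
    christoffel G =ᶠ[𝓝 y] christoffel G' := by
  filter_upwards [h.eventuallyEq_nhds] with z hz
  unfold christoffel
  rw [hz.fderiv_eq, hz.self_of_nhds]

theorem ricci_congr {G G' : W → W →L[ℝ] W →L[ℝ] ℝ} {y : W} (h : G =ᶠ[𝓝 y] G') (v w : W) :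
    ricci G y v w = ricci G' y v w := by
  unfold ricci curvatureEndo
  rw [(christoffel_congr h).fderiv_eq, (christoffel_congr h).self_of_nhds]

end Metric

/-! ### The Gauss equation -/

section Gauss

variable {W V : Type*} [NormedAddCommGroup W] [NormedSpace ℝ W]
  [NormedAddCommGroup V] [NormedSpace ℝ V]

/-- If the second fundamental form of `φ` is `q ⊗ N`, the curvature of the ambient space is
determined modulo `N` by that of the source and by the covariant derivative of `N`. -/
theorem gauss_equation {G : V → V →L[ℝ] V →L[ℝ] ℝ} {h : W → W →L[ℝ] W →L[ℝ] ℝ} {φ : W → V}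
    {q : W → W →L[ℝ] W →L[ℝ] ℝ} {N : W → V} {y : W} (hφ : ContDiffAt ℝ ∞ φ y)
    (hG : DifferentiableAt ℝ (christoffel G) (φ y)) (hh : DifferentiableAt ℝ (christoffel h) y)
    (hq : DifferentiableAt ℝ q y) (hN : DifferentiableAt ℝ N y)
    (hformula : ∀ᶠ z in 𝓝 y, ∀ u w,
      fderiv ℝ (fderiv ℝ φ) z u w + christoffel G (φ z) (fderiv ℝ φ z u) (fderiv ℝ φ z w) =
        fderiv ℝ φ z (christoffel h z u w) + q z u w • N z) (u v w : W) :
    ∃ c : ℝ, curvatureEndo G (φ y) (fderiv ℝ φ y v) (fderiv ℝ φ y w) (fderiv ℝ φ y u) =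
      fderiv ℝ φ y (curvatureEndo h y v w u)
      + q y v w • (fderiv ℝ N y u + christoffel G (φ y) (fderiv ℝ φ y u) (N y))
      - q y u w • (fderiv ℝ N y v + christoffel G (φ y) (fderiv ℝ φ y v) (N y)) + c • N y := by
  have hφ0 := differentiableAt_of_infty hφ
  have hφ1 := contDiffAt_fderiv_infty hφ
  have hφ1d := differentiableAt_of_infty hφ1
  have hφ2d := differentiableAt_of_infty (contDiffAt_fderiv_infty hφ1)
  have hGφ : DifferentiableAt ℝ (fun z ↦ christoffel G (φ z)) y :=
    DifferentiableAt.comp (g := christoffel G) y hG hφ0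
  have hGφ' : fderiv ℝ (fun z ↦ christoffel G (φ z)) y =
      fderiv ℝ (christoffel G) (φ y) ∘L fderiv ℝ φ y :=
    fderiv_comp (g := christoffel G) y hG hφ0
  -- This is the Gauss formula differentiated in the direction `u`. Subtracting the version with `u`
  -- and `v` exchanged cancels the third derivative of φ; the Gauss formula itself then eliminates
  -- the remaining second derivatives.
  have key : ∀ u v w : W,
      fderiv ℝ (fderiv ℝ (fderiv ℝ φ)) y u v w
        + (fderiv ℝ (christoffel G) (φ y) (fderiv ℝ φ y u) (fderiv ℝ φ y v) (fderiv ℝ φ y w)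
          + christoffel G (φ y) (fderiv ℝ (fderiv ℝ φ) y u v) (fderiv ℝ φ y w)
          + christoffel G (φ y) (fderiv ℝ φ y v) (fderiv ℝ (fderiv ℝ φ) y u w))
      = fderiv ℝ (fderiv ℝ φ) y u (christoffel h y v w)
        + fderiv ℝ φ y (fderiv ℝ (christoffel h) y u v w)
        + (fderiv ℝ q y u v w • N y + q y v w • fderiv ℝ N y u) := by
    intro u v w
    have h1 : (fun z ↦ fderiv ℝ (fderiv ℝ φ) z v w
        + christoffel G (φ z) (fderiv ℝ φ z v) (fderiv ℝ φ z w)) =ᶠ[𝓝 y]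
        (fun z ↦ fderiv ℝ φ z (christoffel h z v w) + q z v w • N z) := by
      filter_upwards [hformula] with z hz using hz v w
    have h2 := DFunLike.congr_fun (h1.fderiv_eq (𝕜 := ℝ)) u
    have d1 : DifferentiableAt ℝ (fun z ↦ fderiv ℝ (fderiv ℝ φ) z v w) y := by fun_prop
    have dv : DifferentiableAt ℝ (fun z ↦ fderiv ℝ φ z v) y := by fun_prop
    have dw : DifferentiableAt ℝ (fun z ↦ fderiv ℝ φ z w) y := by fun_prop
    have dh : DifferentiableAt ℝ (fun z ↦ christoffel h z v w) y := by fun_prop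
    have dq : DifferentiableAt ℝ (fun z ↦ q z v w) y := by fun_prop
    rw [fderiv_fun_add d1 (by fun_prop), fderiv_fun_add (by fun_prop) (by fun_prop)] at h2
    simp only [add_apply] at h2
    rw [fderiv_bilin_apply hGφ dv dw, fderiv_bilin_apply_const hφ2d,
      fderiv_clm_apply_const hφ1d, fderiv_clm_apply_const hφ1d, hGφ',
      (hφ1d.hasFDerivAt.clm_apply dh.hasFDerivAt).fderiv,
      fderiv_fun_smul dq hN] at h2
    simp only [add_apply, ContinuousLinearMap.comp_apply,
      ContinuousLinearMap.flip_apply, smul_apply,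
      ContinuousLinearMap.smulRight_apply, fderiv_bilin_apply_const hh,
      fderiv_bilin_apply_const hq] at h2
    rw [h2]
    abel
  have f := hformula.self_of_nhds
  have k1 := key u v w
  have k2 := key v u w
  rw [fderiv_fderiv_symm hφ1 v u, fderiv_fderiv_symm hφ v u] at k2
  have f1 := f u (christoffel h y v w)
  have f2 := f v (christoffel h y u w)
  have f3 := congrArg (christoffel G (φ y) (fderiv ℝ φ y u)) (f v w)
  have f4 := congrArg (christoffel G (φ y) (fderiv ℝ φ y v)) (f u w)
  -- The coefficient of `N` is the Codazzi expression, the antisymmetrized derivative of `q`. Its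
  -- value is irrelevant later, because the result is projected along `N`.
  refine ⟨fderiv ℝ q y u v w - fderiv ℝ q y v u w + q y u (christoffel h y v w)
    - q y v (christoffel h y u w), ?_⟩
  simp only [curvatureEndo_apply, map_add, map_sub, map_smul] at *
  linear_combination (norm := module) k1 - k2 + f1 - f2 + f3 - f4

end Gauss

end

noncomputable section

set_option maxSynthPendingDepth 3

/-! ### The connection metric in a local trivialization -/

section BundleMetric

variable {X F : Type*} [NormedAddCommGroup X] [NormedSpace ℝ X]
  [NormedAddCommGroup F] [NormedSpace ℝ F]

/-- The connector `(a, b) ↦ b + A(a) v` at `(x, v)`, for the connection form `A`. -/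
def localConnector (A : X → X →L[ℝ] F →L[ℝ] F) (y : X × F) : X × F →L[ℝ] F :=
  ContinuousLinearMap.snd ℝ X F + (A y.1).flip y.2 ∘L ContinuousLinearMap.fst ℝ X F

@[simp]
theorem localConnector_apply (A : X → X →L[ℝ] F →L[ℝ] F) (y u : X × F) :
    localConnector A y u = u.2 + A y.1 u.1 y.2 := rfl

/-- The connection metric in a local trivialization, for the metric `g` of the base, the fibre
metric `k` and the connection form `A`. -/
def localMetric (g : X → X →L[ℝ] X →L[ℝ] ℝ) (k : X → F →L[ℝ] F →L[ℝ] ℝ)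
    (A : X → X →L[ℝ] F →L[ℝ] F) (y : X × F) : X × F →L[ℝ] X × F →L[ℝ] ℝ :=
  (ContinuousLinearMap.fst ℝ X F).precomp ℝ ∘L (g y.1 ∘L ContinuousLinearMap.fst ℝ X F)
    + (localConnector A y).precomp ℝ ∘L (k y.1 ∘L localConnector A y)

theorem localMetric_apply (g : X → X →L[ℝ] X →L[ℝ] ℝ) (k : X → F →L[ℝ] F →L[ℝ] ℝ)
    (A : X → X →L[ℝ] F →L[ℝ] F) (y u w : X × F) :
    localMetric g k A y u w =
      g y.1 u.1 w.1 + k y.1 (localConnector A y u) (localConnector A y w) := rfl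

/-- A smooth base metric `g`, a smooth fibre metric `k`, and the connection form `A` of a connection
compatible with `k`, on the open set `Ω`. -/
structure IsConnectionData (g : X → X →L[ℝ] X →L[ℝ] ℝ) (k : X → F →L[ℝ] F →L[ℝ] ℝ)
    (A : X → X →L[ℝ] F →L[ℝ] F) (Ω : Set X) : Prop where
  base : IsMetricOn g Ω
  contDiffOn_fiber : ContDiffOn ℝ ∞ k Ω
  fiber_symm : ∀ x ∈ Ω, ∀ b b', k x b b' = k x b' b
  fiber_pos : ∀ x ∈ Ω, ∀ b, b ≠ 0 → 0 < k x b b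
  contDiffOn_form : ContDiffOn ℝ ∞ A Ω
  compatible : ∀ x ∈ Ω, ∀ a b b', fderiv ℝ k x a b b' = k x (A x a b) b' + k x b (A x a b')

namespace IsConnectionData

variable {g : X → X →L[ℝ] X →L[ℝ] ℝ} {k : X → F →L[ℝ] F →L[ℝ] ℝ}
  {A : X → X →L[ℝ] F →L[ℝ] F} {Ω : Set X} {y : X × F} {x : X}

theorem isOpen (h : IsConnectionData g k A Ω) : IsOpen Ω := h.base.isOpen

theorem contDiffAt_fiber (h : IsConnectionData g k A Ω) (hx : x ∈ Ω) : ContDiffAt ℝ ∞ k x :=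
  h.contDiffOn_fiber.contDiffAt (h.isOpen.mem_nhds hx)

theorem contDiffAt_form (h : IsConnectionData g k A Ω) (hx : x ∈ Ω) : ContDiffAt ℝ ∞ A x :=
  h.contDiffOn_form.contDiffAt (h.isOpen.mem_nhds hx)

theorem contDiffAt_localConnector (h : IsConnectionData g k A Ω) (hy : y.1 ∈ Ω) :
    ContDiffAt ℝ ∞ (localConnector A) y := by
  have hA : ContDiffAt ℝ ∞ (fun z : X × F ↦ A z.1) y :=
    (h.contDiffAt_form hy).comp y contDiffAt_fst
  have hflip : ContDiffAt ℝ ∞ (fun z : X × F ↦ (A z.1).flip) y :=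
    (ContinuousLinearMap.flipₗᵢ ℝ X F F).contDiff.contDiffAt.comp y hA
  exact contDiffAt_const.add ((hflip.clm_apply contDiffAt_snd).clm_comp contDiffAt_const)

theorem contDiffAt_localMetric (h : IsConnectionData g k A Ω) (hy : y.1 ∈ Ω) :
    ContDiffAt ℝ ∞ (localMetric g k A) y := by
  have hg : ContDiffAt ℝ ∞ (fun z : X × F ↦ g z.1) y :=
    (h.base.contDiffAt hy).comp y contDiffAt_fst
  have hk : ContDiffAt ℝ ∞ (fun z : X × F ↦ k z.1) y :=
    (h.contDiffAt_fiber hy).comp y contDiffAt_fst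
  have hK := h.contDiffAt_localConnector hy
  have hpre : ContDiffAt ℝ ∞ (fun z ↦ (localConnector A z).precomp ℝ) y :=
    ((ContinuousLinearMap.compL ℝ (X × F) F ℝ).flip.contDiff).contDiffAt.comp y hK
  exact (contDiffAt_const.clm_comp (hg.clm_comp contDiffAt_const)).add
    (hpre.clm_comp (hk.clm_comp hK))

theorem isMetricOn (h : IsConnectionData g k A Ω) :
    IsMetricOn (localMetric g k A) (Ω ×ˢ univ) where
  isOpen := h.isOpen.prod isOpen_univ
  contDiffOn := fun _ hy ↦ (h.contDiffAt_localMetric hy.1).contDiffWithinAt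
  symm := fun y hy u w ↦ by
    rw [localMetric_apply, localMetric_apply, h.base.symm _ hy.1, h.fiber_symm _ hy.1]
  pos := fun y hy u hu ↦ by
    rw [localMetric_apply]
    by_cases h1 : u.1 = 0
    · have h2 : u.2 ≠ 0 := fun h2 ↦ hu (Prod.ext h1 h2)
      simpa [h1] using h.fiber_pos _ hy.1 _ h2
    · have := h.base.pos _ hy.1 _ h1
      have h3 : 0 ≤ k y.1 (localConnector A y u) (localConnector A y u) := by
        by_cases h4 : localConnector A y u = 0
        · rw [h4]; simp
        · exact (h.fiber_pos _ hy.1 _ h4).le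
      linarith

theorem fderiv_localConnector_apply (h : IsConnectionData g k A Ω) (hy : y.1 ∈ Ω) (u w : X × F) :
    fderiv ℝ (fun z ↦ localConnector A z u) y w =
      fderiv ℝ A y.1 w.1 u.1 y.2 + A y.1 u.1 w.2 := by
  have hA := differentiableAt_of_infty (h.contDiffAt_form hy)
  have hA' : DifferentiableAt ℝ (fun z : X × F ↦ A z.1) y := hA.comp y differentiableAt_fst
  have hA'' : fderiv ℝ (fun z : X × F ↦ A z.1) y =
      fderiv ℝ A y.1 ∘L ContinuousLinearMap.fst ℝ X F := by
    have := fderiv_comp (g := A) (f := Prod.fst) y hA differentiableAt_fst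
    rw [fderiv_fst] at this
    exact this
  simp only [localConnector_apply]
  rw [fderiv_fun_add (by fun_prop) (by fun_prop),
    add_apply, fderiv_bilin_apply hA' (differentiableAt_const _)
      differentiableAt_snd, hA'', fderiv_snd]
  simp

/-- Compatibility trades the derivative of `k` for `A`, so that the only derivatives left are those
of `g` and `A`. -/
theorem fderiv_localMetric_apply (h : IsConnectionData g k A Ω) (hy : y.1 ∈ Ω) (w u u' : X × F) :
    fderiv ℝ (localMetric g k A) y w u u' = fderiv ℝ g y.1 w.1 u.1 u'.1
      + (k y.1 (A y.1 w.1 (localConnector A y u)) (localConnector A y u')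
        + k y.1 (localConnector A y u) (A y.1 w.1 (localConnector A y u')))
      + k y.1 (fderiv ℝ A y.1 w.1 u.1 y.2 + A y.1 u.1 w.2) (localConnector A y u')
      + k y.1 (localConnector A y u) (fderiv ℝ A y.1 w.1 u'.1 y.2 + A y.1 u'.1 w.2) := by
  have hg := differentiableAt_of_infty (h.base.contDiffAt hy)
  have hk := differentiableAt_of_infty (h.contDiffAt_fiber hy)
  have hK := differentiableAt_of_infty (h.contDiffAt_localConnector hy)
  have hg' : DifferentiableAt ℝ (fun z : X × F ↦ g z.1) y := hg.comp y differentiableAt_fst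
  have hg'' : fderiv ℝ (fun z : X × F ↦ g z.1) y =
      fderiv ℝ g y.1 ∘L ContinuousLinearMap.fst ℝ X F := by
    have := fderiv_comp (g := g) (f := Prod.fst) y hg differentiableAt_fst
    rw [fderiv_fst] at this
    exact this
  have hk' : DifferentiableAt ℝ (fun z : X × F ↦ k z.1) y := hk.comp y differentiableAt_fst
  have hk'' : fderiv ℝ (fun z : X × F ↦ k z.1) y =
      fderiv ℝ k y.1 ∘L ContinuousLinearMap.fst ℝ X F := by
    have := fderiv_comp (g := k) (f := Prod.fst) y hk differentiableAt_fst
    rw [fderiv_fst] at this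
    exact this
  rw [← fderiv_bilin_apply_const (differentiableAt_of_infty (h.contDiffAt_localMetric hy))]
  have hKu : DifferentiableAt ℝ (fun z ↦ localConnector A z u) y := by fun_prop
  have hKu' : DifferentiableAt ℝ (fun z ↦ localConnector A z u') y := by fun_prop
  simp only [localMetric_apply]
  rw [fderiv_fun_add (by fun_prop) (by fun_prop), add_apply, fderiv_bilin_apply_const hg', hg'',
    fderiv_bilin_apply hk' hKu hKu', hk'', h.fderiv_localConnector_apply hy,
    h.fderiv_localConnector_apply hy]
  simp only [ContinuousLinearMap.comp_apply, ContinuousLinearMap.coe_fst']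
  rw [h.compatible _ hy]
  ring

variable [FiniteDimensional ℝ X] [FiniteDimensional ℝ F]

/-- The covariant derivative of the position field `(x, v) ↦ (0, v)` is the vertical projection. -/
theorem christoffel_position (h : IsConnectionData g k A Ω) (hy : y.1 ∈ Ω) (u : X × F) :
    christoffel (localMetric g k A) y u (0, y.2) = (0, A y.1 u.1 y.2) := by
  refine h.isMetricOn.christoffel_eq (y := y) ⟨hy, mem_univ _⟩ fun w ↦ ?_
  -- After compatibility is used, the Koszul formula for the position field leaves exactly the
  -- pairing of the fibre curvature applied to `v` with `v` itself; this identity disposes of it.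
  have hs := curvature_skew_of_compatible (h.contDiffAt_fiber hy)
    (differentiableAt_of_infty (h.contDiffAt_form hy)) (h.fiber_symm _ hy)
    (by filter_upwards [h.isOpen.mem_nhds hy] with z hz using h.compatible z hz) u.1 w.1 y.2
  simp only [h.fderiv_localMetric_apply hy, localMetric_apply, localConnector_apply, map_add,
    map_sub, map_zero, add_apply, sub_apply, zero_apply, zero_add, add_zero] at hs ⊢
  have s := h.fiber_symm _ hy
  linarith [s y.2 (fderiv ℝ A y.1 u.1 w.1 y.2), s y.2 (fderiv ℝ A y.1 w.1 u.1 y.2),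
    s y.2 (A y.1 u.1 (A y.1 w.1 y.2)), s y.2 (A y.1 w.1 (A y.1 u.1 y.2)),
    s y.2 (A y.1 u.1 w.2), s y.2 (A y.1 w.1 u.2), s (A y.1 w.1 y.2) (A y.1 u.1 y.2)]

/-- Differentiating the identity `christoffel_position` along `w` controls the derivative of Γ in
the slot (0, v). Each of the four terms of R(u, P)P then vanishes separately, because A(0) = 0. -/
theorem curvatureEndo_position (h : IsConnectionData g k A Ω) (hy : y.1 ∈ Ω) (u : X × F) :
    curvatureEndo (localMetric g k A) y (0, y.2) (0, y.2) u = 0 := by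
  have hm := h.isMetricOn
  have hyO : y ∈ Ω ×ˢ (univ : Set F) := ⟨hy, mem_univ _⟩
  have hΓ := differentiableAt_of_infty (hm.contDiffAt_christoffel hyO)
  have key : ∀ u w : X × F, fderiv ℝ (christoffel (localMetric g k A)) y w u (0, y.2)
      + christoffel (localMetric g k A) y u (0, w.2)
      = (0, fderiv ℝ A y.1 w.1 u.1 y.2 + A y.1 u.1 w.2) := by
    intro u w
    have h1 : (fun z : X × F ↦ christoffel (localMetric g k A) z u ((0 : X), z.2)) =ᶠ[𝓝 y]
        (fun z ↦ ContinuousLinearMap.inr ℝ X F (localConnector A z u - u.2)) := by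
      filter_upwards [hm.isOpen.mem_nhds hyO] with z hz
      rw [h.christoffel_position hz.1]
      simp
    have h2 := DFunLike.congr_fun (h1.fderiv_eq (𝕜 := ℝ)) w
    have hpos : (fun z : X × F ↦ ((0 : X), z.2)) =
        (ContinuousLinearMap.inr ℝ X F ∘L ContinuousLinearMap.snd ℝ X F) := by ext <;> simp
    have hp' : fderiv ℝ (fun z : X × F ↦ ((0 : X), z.2)) y =
        ContinuousLinearMap.inr ℝ X F ∘L ContinuousLinearMap.snd ℝ X F := by
      rw [hpos]; exact ContinuousLinearMap.fderiv _
    have hpd : DifferentiableAt ℝ (fun z : X × F ↦ ((0 : X), z.2)) y := by fun_prop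
    have hKd : DifferentiableAt ℝ (fun z ↦ localConnector A z u) y :=
      (differentiableAt_of_infty (h.contDiffAt_localConnector hy)).clm_apply
        (differentiableAt_const _)
    rw [fderiv_bilin_apply hΓ (differentiableAt_const u) hpd, hp'] at h2
    have h3 : fderiv ℝ (fun z ↦ ContinuousLinearMap.inr ℝ X F (localConnector A z u - u.2)) y w
        = (0, fderiv ℝ A y.1 w.1 u.1 y.2 + A y.1 u.1 w.2) := by
      have := ((ContinuousLinearMap.inr ℝ X F).hasFDerivAt.comp y
        (hKd.hasFDerivAt.sub_const u.2)).fderiv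
      have h4 := DFunLike.congr_fun this w
      simp only [ContinuousLinearMap.comp_apply, h.fderiv_localConnector_apply hy] at h4
      exact h4
    rw [h3] at h2
    simpa using h2
  have hs := hm.christoffel_symm hyO
  have p := h.christoffel_position hy
  -- The first instance gives (∂_u Γ)(P, P) = 0 and the second (∂_P Γ)(u, P) = 0.
  have k1 := key (0, y.2) u
  rw [hs, show ((0 : X), u.2) = (0, u.2) from rfl, p] at k1
  have k2 := key u (0, y.2)
  rw [p] at k2
  rw [curvatureEndo_apply, p, p, hs (0, y.2), p]
  simp at k1 k2
  simp only [k1, k2, map_zero, zero_apply, show ((0 : X), (0 : F)) = 0 from rfl, sub_zero, add_zero]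

end IsConnectionData

end BundleMetric

end

/-! ### Curvature of the connection metric on the zero section -/

noncomputable section

set_option maxSynthPendingDepth 3

section LinearAlgebra

variable {X F : Type*} [NormedAddCommGroup X] [NormedSpace ℝ X]
  [NormedAddCommGroup F] [NormedSpace ℝ F] [FiniteDimensional ℝ X] [FiniteDimensional ℝ F]

/-- The form `k` identifies `F` with its dual and conjugates `B` to minus its transpose, so the
trace equals its own negative. -/
theorem trace_eq_zero_of_skew {k : F →L[ℝ] F →L[ℝ] ℝ} (hk : ∀ b, b ≠ 0 → 0 < k b b)
    (hs : ∀ b b', k b b' = k b' b) {B : F →ₗ[ℝ] F} (hB : ∀ b b', k (B b) b' = - k (B b') b) :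
    LinearMap.trace ℝ F B = 0 := by
  have hinj : Function.Injective (k.toLinearMap₁₂ : F →ₗ[ℝ] Module.Dual ℝ F) := by
    rw [injective_iff_map_eq_zero]
    intro u hu
    by_contra h
    have h1 := hk u h
    have h2 : k u u = 0 := DFunLike.congr_fun hu u
    linarith
  let e : F ≃ₗ[ℝ] Module.Dual ℝ F :=
    LinearEquiv.ofInjectiveOfFinrankEq k.toLinearMap₁₂ hinj Subspace.dual_finrank_eq.symm
  have he : ∀ u v, e u v = k u v := fun u v ↦ rfl
  have h1 : e.conj B = - Module.Dual.transpose (R := ℝ) B := by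
    ext f v
    obtain ⟨u, rfl⟩ := e.surjective f
    simp only [LinearEquiv.conj_apply, LinearMap.comp_apply, LinearEquiv.coe_coe,
      LinearEquiv.symm_apply_apply, LinearMap.neg_apply, Module.Dual.transpose_apply, he]
    rw [hB, hs]
  have h2 := LinearMap.trace_conj' B e
  rw [h1, map_neg, LinearMap.trace_transpose'] at h2
  linarith

theorem trace_prod_eq (T : X × F →ₗ[ℝ] X × F) :
    LinearMap.trace ℝ (X × F) T =
      LinearMap.trace ℝ X (LinearMap.fst ℝ X F ∘ₗ T ∘ₗ LinearMap.inl ℝ X F)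
      + LinearMap.trace ℝ F (LinearMap.snd ℝ X F ∘ₗ T ∘ₗ LinearMap.inr ℝ X F) := by
  have h : T = (T ∘ₗ LinearMap.inl ℝ X F) ∘ₗ LinearMap.fst ℝ X F
      + (T ∘ₗ LinearMap.inr ℝ X F) ∘ₗ LinearMap.snd ℝ X F := by
    refine LinearMap.ext fun z ↦ ?_
    simp [← map_add]
  conv_lhs => rw [h]
  rw [map_add, LinearMap.trace_comp_comm' (LinearMap.fst ℝ X F),
    LinearMap.trace_comp_comm' (LinearMap.snd ℝ X F)]

end LinearAlgebra

namespace IsConnectionData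

variable {X F : Type*} [NormedAddCommGroup X] [NormedSpace ℝ X]
  [NormedAddCommGroup F] [NormedSpace ℝ F] [FiniteDimensional ℝ X] [FiniteDimensional ℝ F]
  {g : X → X →L[ℝ] X →L[ℝ] ℝ} {k : X → F →L[ℝ] F →L[ℝ] ℝ}
  {A : X → X →L[ℝ] F →L[ℝ] F} {Ω : Set X} {x : X}

/-- At (x, tb) the position vector is t(0, b), so R(·, P)P = 0 is divisible by t². Let t tend to 0:
continuity of the curvature gives the identity on the zero section, where P itself carries no
information. -/
theorem curvatureEndo_zero_vertical_self (h : IsConnectionData g k A Ω) (hx : x ∈ Ω) (b : F)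
    (u : X × F) : curvatureEndo (localMetric g k A) (x, 0) (0, b) (0, b) u = 0 := by
  have hm := h.isMetricOn
  have hc : ContinuousAt (fun z ↦ curvatureEndo (localMetric g k A) z (0, b) (0, b) u) (x, 0) :=
    (hm.continuousAt_curvatureEndo (y := (x, 0)) ⟨hx, mem_univ _⟩ _ _).clm_apply continuousAt_const
  have hpath : Tendsto (fun t : ℝ ↦ (x, t • b)) (𝓝[≠] 0) (𝓝 (x, 0)) := by
    have : Continuous (fun t : ℝ ↦ (x, t • b)) := by fun_prop
    have h0 := this.tendsto 0
    simp only [zero_smul] at h0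
    exact h0.mono_left nhdsWithin_le_nhds
  have hlim := hc.tendsto.comp hpath
  have hz : (fun z ↦ curvatureEndo (localMetric g k A) z (0, b) (0, b) u) ∘
      (fun t : ℝ ↦ (x, t • b)) =ᶠ[𝓝[≠] 0] fun _ ↦ 0 := by
    filter_upwards [self_mem_nhdsWithin] with t ht
    have h1 := h.curvatureEndo_position (y := (x, t • b)) hx u
    have h2 : ((0 : X), t • b) = t • ((0 : X), b) := by simp
    simp only [h2, curvatureEndo_apply, map_smul, smul_apply, ← smul_add, ← smul_sub,
      smul_smul] at h1
    have h3 := (smul_eq_zero.1 h1).resolve_left (mul_ne_zero ht ht)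
    simpa [curvatureEndo_apply] using h3
  exact tendsto_nhds_unique (hlim.congr' hz) tendsto_const_nhds |>.symm ▸ rfl

theorem curvatureEndo_zero_vertical (h : IsConnectionData g k A Ω) (hx : x ∈ Ω) (b b' : F)
    (u : X × F) : curvatureEndo (localMetric g k A) (x, 0) (0, b) (0, b') u =
      - curvatureEndo (localMetric g k A) (x, 0) (0, b') (0, b) u := by
  have h1 := h.curvatureEndo_zero_vertical_self hx (b + b') u
  have h2 := h.curvatureEndo_zero_vertical_self hx b u
  have h3 := h.curvatureEndo_zero_vertical_self hx b' u
  have h4 : ((0 : X), b + b') = (0, b) + (0, b') := by simp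
  simp only [h4, curvatureEndo_apply, map_add, add_apply] at h1 h2 h3 ⊢
  linear_combination (norm := module) h1 - h2 - h3

/-- The zero section is totally geodesic: at v = 0 horizontal vectors have zero connector, so every
fibre term in the Koszul formula drops out. -/
theorem christoffel_zero_horizontal (h : IsConnectionData g k A Ω) (hx : x ∈ Ω) (a a' : X) :
    christoffel (localMetric g k A) (x, 0) (a, 0) (a', 0) = (christoffel g x a a', 0) := by
  refine h.isMetricOn.christoffel_eq (y := (x, 0)) ⟨hx, mem_univ _⟩ fun w ↦ ?_
  have := h.base.two_mul_apply_christoffel hx a a' w.1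
  simp only [h.fderiv_localMetric_apply (y := (x, 0)) hx, localMetric_apply, localConnector_apply,
    map_zero, zero_apply, zero_add, add_zero]
  linarith

/-- The Gauss equation for the inclusion of the zero section, whose second fundamental form
vanishes. -/
theorem curvatureEndo_zero_horizontal (h : IsConnectionData g k A Ω) (hx : x ∈ Ω) (a a' α : X) :
    curvatureEndo (localMetric g k A) (x, 0) (a, 0) (a', 0) (α, 0) =
      (curvatureEndo g x a a' α, 0) := by
  have hd : fderiv ℝ (ContinuousLinearMap.inl ℝ X F) = fun _ ↦ ContinuousLinearMap.inl ℝ X F := by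
    ext1 z
    exact ContinuousLinearMap.fderiv _
  obtain ⟨c, hc⟩ := gauss_equation (G := localMetric g k A) (h := g)
    (φ := ContinuousLinearMap.inl ℝ X F) (q := fun _ ↦ 0) (N := fun _ ↦ 0) (y := x)
    (ContinuousLinearMap.contDiff _).contDiffAt
    (differentiableAt_of_infty (h.isMetricOn.contDiffAt_christoffel (y := (x, 0)) ⟨hx, mem_univ _⟩))
    (differentiableAt_of_infty (h.base.contDiffAt_christoffel hx)) (differentiableAt_const _)
    (differentiableAt_const _)
    (by
      filter_upwards [h.isOpen.mem_nhds hx] with z hz u w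
      have := h.christoffel_zero_horizontal hz u w
      simp [hd, this]) α a a'
  simpa [hd] using hc

/-- On the zero section, the Ricci curvature of the connection metric in horizontal directions is
that of the base. -/
theorem ricci_zero_horizontal (h : IsConnectionData g k A Ω) (hx : x ∈ Ω) (a : X) :
    ricci (localMetric g k A) (x, 0) (a, 0) (a, 0) = ricci g x a a := by
  have hm := h.isMetricOn
  have hxO : ((x, 0) : X × F) ∈ Ω ×ˢ (univ : Set F) := ⟨hx, mem_univ _⟩
  unfold ricci
  rw [trace_prod_eq]
  have h1 : LinearMap.fst ℝ X F ∘ₗ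
      (curvatureEndo (localMetric g k A) (x, 0) (a, 0) (a, 0) : X × F →ₗ[ℝ] X × F) ∘ₗ
      LinearMap.inl ℝ X F = (curvatureEndo g x a a : X →ₗ[ℝ] X) := by
    ext α
    simp [h.curvatureEndo_zero_horizontal hx]
  rw [h1, add_eq_left]
  -- The vertical block is b ↦ the vertical part of R(b, a)a. The skew symmetries turn its pairing
  -- with b' into ⟨R(a, b)b', a⟩, which is antisymmetric in b and b' by polarization. Only the trace
  -- is wanted, so pair symmetry of the curvature is not required.
  refine trace_eq_zero_of_skew (h.fiber_pos x hx) (h.fiber_symm x hx) fun b b' ↦ ?_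
  have key : ∀ b b' : F, k x ((LinearMap.snd ℝ X F ∘ₗ
      (curvatureEndo (localMetric g k A) (x, 0) (a, 0) (a, 0) : X × F →ₗ[ℝ] X × F) ∘ₗ
      LinearMap.inr ℝ X F) b) b' =
      localMetric g k A (x, 0) (curvatureEndo (localMetric g k A) (x, 0) (0, b) (0, b') (a, 0))
        (a, 0) := by
    intro b b'
    have h2 := hm.curvature_skew hxO (0, b) (a, 0) (a, 0) (0, b')
    have h3 : curvatureEndo (localMetric g k A) (x, 0) (a, 0) (0, b') (0, b) =
        - curvatureEndo (localMetric g k A) (x, 0) (0, b) (0, b') (a, 0) := by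
      simp only [curvatureEndo_apply]
      abel
    rw [h3, map_neg, neg_apply, neg_neg] at h2
    rw [← h2]
    simp [localMetric_apply]
  rw [key, key, h.curvatureEndo_zero_vertical hx b b']
  simp

end IsConnectionData

end

/-! ### Immersions, and the Ricci curvature of sphere bundles in the local model -/

noncomputable section

set_option maxSynthPendingDepth 3

section Immersion

variable {W V : Type*} [NormedAddCommGroup W] [NormedSpace ℝ W]
  [NormedAddCommGroup V] [NormedSpace ℝ V]

/-- The metric induced on `W` by the map `φ : W → V` and the metric `G` on `V`. -/
def inducedMetric (G : V → V →L[ℝ] V →L[ℝ] ℝ) (φ : W → V) (z : W) : W →L[ℝ] W →L[ℝ] ℝ :=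
  (fderiv ℝ φ z).precomp ℝ ∘L (G (φ z) ∘L fderiv ℝ φ z)

theorem inducedMetric_apply (G : V → V →L[ℝ] V →L[ℝ] ℝ) (φ : W → V) (z u w : W) :
    inducedMetric G φ z u w = G (φ z) (fderiv ℝ φ z u) (fderiv ℝ φ z w) := rfl

variable {G : V → V →L[ℝ] V →L[ℝ] ℝ} {O : Set V} {φ : W → V} {U : Set W} {z : W}

theorem IsMetricOn.inducedMetric (hG : IsMetricOn G O) (hU : IsOpen U)
    (hφ : ContDiffOn ℝ ∞ φ U) (hmaps : MapsTo φ U O)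
    (hinj : ∀ z ∈ U, Function.Injective (fderiv ℝ φ z)) : IsMetricOn (inducedMetric G φ) U where
  isOpen := hU
  contDiffOn := fun z hz ↦ by
    have h0 := hφ.contDiffAt (hU.mem_nhds hz)
    have h1 := contDiffAt_fderiv_infty h0
    have hGφ : ContDiffAt ℝ ∞ (fun z ↦ G (φ z)) z := (hG.contDiffAt (hmaps hz)).comp z h0
    have hpre : ContDiffAt ℝ ∞ (fun z ↦ (fderiv ℝ φ z).precomp ℝ) z :=
      ((ContinuousLinearMap.compL ℝ W V ℝ).flip.contDiff).contDiffAt.comp z h1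
    exact (hpre.clm_comp (hGφ.clm_comp h1)).contDiffWithinAt
  symm := fun z hz u w ↦ by
    rw [inducedMetric_apply, inducedMetric_apply, hG.symm _ (hmaps hz)]
  pos := fun z hz u hu ↦ by
    rw [inducedMetric_apply]
    exact hG.pos _ (hmaps hz) _ fun h ↦ hu (hinj z hz (by simpa using h))

theorem IsMetricOn.fderiv_inducedMetric_apply (hG : IsMetricOn G O) (hφ : ContDiffAt ℝ ∞ φ z)
    (hz : φ z ∈ O) (w u v : W) : fderiv ℝ (_root_.inducedMetric G φ) z w u v =
      fderiv ℝ G (φ z) (fderiv ℝ φ z w) (fderiv ℝ φ z u) (fderiv ℝ φ z v)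
      + G (φ z) (fderiv ℝ (fderiv ℝ φ) z w u) (fderiv ℝ φ z v)
      + G (φ z) (fderiv ℝ φ z u) (fderiv ℝ (fderiv ℝ φ) z w v) := by
  have h1 := contDiffAt_fderiv_infty hφ
  have h1d := differentiableAt_of_infty h1
  have h0d := differentiableAt_of_infty hφ
  have hGφ : ContDiffAt ℝ ∞ (fun z ↦ G (φ z)) z := (hG.contDiffAt hz).comp z hφ
  have hGd := differentiableAt_of_infty hGφ
  have hpre : ContDiffAt ℝ ∞ (fun z ↦ (fderiv ℝ φ z).precomp ℝ) z :=
    ((ContinuousLinearMap.compL ℝ W V ℝ).flip.contDiff).contDiffAt.comp z h1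
  have hd : DifferentiableAt ℝ (_root_.inducedMetric G φ) z :=
    differentiableAt_of_infty (hpre.clm_comp (hGφ.clm_comp h1))
  have hG' : fderiv ℝ (fun z ↦ G (φ z)) z = fderiv ℝ G (φ z) ∘L fderiv ℝ φ z :=
    fderiv_comp (g := G) z (differentiableAt_of_infty (hG.contDiffAt hz)) h0d
  rw [← fderiv_bilin_apply_const hd]
  simp only [inducedMetric_apply]
  rw [fderiv_bilin_apply hGd (by fun_prop) (by fun_prop), hG', fderiv_clm_apply_const h1d,
    fderiv_clm_apply_const h1d]
  rfl

variable [FiniteDimensional ℝ W] [FiniteDimensional ℝ V]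

/-- The Gauss formula: the tangential part of the second derivative of an immersion. -/
theorem IsMetricOn.gauss_formula (hG : IsMetricOn G O) (hU : IsOpen U)
    (hφ : ContDiffOn ℝ ∞ φ U) (hmaps : MapsTo φ U O)
    (hinj : ∀ z ∈ U, Function.Injective (fderiv ℝ φ z)) (hz : z ∈ U) (u v w : W) :
    G (φ z) (fderiv ℝ (fderiv ℝ φ) z u v
      + christoffel G (φ z) (fderiv ℝ φ z u) (fderiv ℝ φ z v)) (fderiv ℝ φ z w) =
    G (φ z) (fderiv ℝ φ z (christoffel (_root_.inducedMetric G φ) z u v)) (fderiv ℝ φ z w) := by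
  have hφz := hφ.contDiffAt (hU.mem_nhds hz)
  have h1 := (hG.inducedMetric hU hφ hmaps hinj).two_mul_apply_christoffel hz u v w
  simp only [hG.fderiv_inducedMetric_apply hφz (hmaps hz)] at h1
  rw [inducedMetric_apply] at h1
  have h2 := hG.two_mul_apply_christoffel (hmaps hz) (fderiv ℝ φ z u) (fderiv ℝ φ z v)
    (fderiv ℝ φ z w)
  rw [fderiv_fderiv_symm hφz v u, fderiv_fderiv_symm hφz w u, fderiv_fderiv_symm hφz w v] at h1
  rw [map_add, add_apply]
  linarith [hG.symm _ (hmaps hz) (fderiv ℝ φ z v) (fderiv ℝ (fderiv ℝ φ) z u w),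
    hG.symm _ (hmaps hz) (fderiv ℝ φ z u) (fderiv ℝ (fderiv ℝ φ) z v w)]

end Immersion

section Splitting

variable {W V : Type*} [AddCommGroup W] [Module ℝ W] [AddCommGroup V] [Module ℝ V]
  [FiniteDimensional ℝ V]

/-- A hyperplane, parametrized by `L`, and a transverse vector `N` split the space. -/
theorem exists_splitting {L : W →ₗ[ℝ] V} (hL : Function.Injective L) {ν : V →ₗ[ℝ] ℝ} {N : V}
    (hνL : ∀ u, ν (L u) = 0) (hνN : ν N = 1)
    (hdim : Module.finrank ℝ W + 1 = Module.finrank ℝ V) :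
    ∃ ρ : V →ₗ[ℝ] W, (∀ u, ρ (L u) = u) ∧ ∀ Y, L (ρ Y) + ν Y • N = Y := by
  have hker : LinearMap.range L = LinearMap.ker ν := by
    refine Submodule.eq_of_le_of_finrank_eq ?_ ?_
    · rintro _ ⟨u, rfl⟩
      exact hνL u
    · have h1 := Module.Dual.finrank_ker_add_one_of_ne_zero (f := ν)
        (fun h ↦ by simp [h] at hνN)
      rw [LinearMap.finrank_range_of_inj hL]
      omega
  obtain ⟨ρ₀, hρ₀⟩ := LinearMap.exists_leftInverse_of_injective L (LinearMap.ker_eq_bot.2 hL)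
  have hρ₀' : ∀ u, ρ₀ (L u) = u := fun u ↦ LinearMap.congr_fun hρ₀ u
  refine ⟨ρ₀ ∘ₗ (LinearMap.id - ν.smulRight N), fun u ↦ by simp [hνL, hρ₀'], fun Y ↦ ?_⟩
  have hY : Y - ν Y • N ∈ LinearMap.range L := by
    rw [hker, LinearMap.mem_ker, map_sub, map_smul, hνN]
    simp
  obtain ⟨u, hu⟩ := hY
  simp only [LinearMap.comp_apply, LinearMap.sub_apply, LinearMap.id_apply,
    LinearMap.smulRight_apply]
  rw [← hu, hρ₀', hu]
  abel

/-- Decompose the trace into the part along the hyperplane and the part along `N`. In the Gauss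
equation this isolates the Ricci contribution of the normal direction. -/
theorem trace_eq_of_splitting [FiniteDimensional ℝ W] {L : W →ₗ[ℝ] V} {ν : V →ₗ[ℝ] ℝ} {N : V} {ρ : V →ₗ[ℝ] W}
    (h : ∀ Y, L (ρ Y) + ν Y • N = Y) (T : V →ₗ[ℝ] V) :
    LinearMap.trace ℝ V T = LinearMap.trace ℝ W (ρ ∘ₗ T ∘ₗ L) + ν (T N) := by
  have hT : T = (T ∘ₗ L) ∘ₗ ρ + ν.smulRight (T N) := by
    refine LinearMap.ext fun Y ↦ ?_
    conv_lhs => rw [← h Y]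
    simp
  conv_lhs => rw [hT]
  rw [map_add, LinearMap.trace_comp_comm' ρ, LinearMap.trace_smulRight]

end Splitting

namespace IsConnectionData

variable {X F : Type*} [NormedAddCommGroup X] [NormedSpace ℝ X]
  [NormedAddCommGroup F] [NormedSpace ℝ F]
  {g : X → X →L[ℝ] X →L[ℝ] ℝ} {k : X → F →L[ℝ] F →L[ℝ] ℝ}
  {A : X → X →L[ℝ] F →L[ℝ] F} {Ω : Set X} {y : X × F}

/-- Compatibility absorbs the derivative of `k` into the connector: horizontal motion preserves the
fibre norm, and only the vertical part of a vector changes it. -/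
theorem hasFDerivAt_fiberNorm (h : IsConnectionData g k A Ω) (hy : y.1 ∈ Ω) :
    HasFDerivAt (fun z : X × F ↦ k z.1 z.2 z.2)
      ((2 : ℝ) • (k y.1 y.2 ∘L localConnector A y)) y := by
  have hk := differentiableAt_of_infty (h.contDiffAt_fiber hy)
  have hk' : DifferentiableAt ℝ (fun z : X × F ↦ k z.1) y := hk.comp y differentiableAt_fst
  have hk'' : fderiv ℝ (fun z : X × F ↦ k z.1) y =
      fderiv ℝ k y.1 ∘L ContinuousLinearMap.fst ℝ X F := by
    have := fderiv_comp (g := k) (f := Prod.fst) y hk differentiableAt_fst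
    rw [fderiv_fst] at this
    exact this
  have hd : DifferentiableAt ℝ (fun z : X × F ↦ k z.1 z.2 z.2) y := by fun_prop
  convert! hd.hasFDerivAt using 1
  refine ContinuousLinearMap.ext fun u ↦ ?_
  rw [fderiv_bilin_apply hk' differentiableAt_snd differentiableAt_snd, hk'', fderiv_snd]
  have := h.compatible _ hy u.1 y.2 y.2
  simp only [ContinuousLinearMap.comp_apply, ContinuousLinearMap.coe_fst',
    ContinuousLinearMap.coe_snd', smul_apply, localConnector_apply, map_add, this, smul_eq_mul]
  linarith [h.fiber_symm _ hy y.2 u.2, h.fiber_symm _ hy y.2 (A y.1 u.1 y.2)]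

theorem localMetric_position_apply (y u : X × F) :
    localMetric g k A y (0, y.2) u = k y.1 y.2 (localConnector A y u) := by
  simp [localMetric_apply]

variable [FiniteDimensional ℝ X] [FiniteDimensional ℝ F]
  {W : Type*} [NormedAddCommGroup W] [NormedSpace ℝ W] [FiniteDimensional ℝ W]
  {φ : W → X × F} {U : Set W} {r : ℝ}

/-- The Ricci curvature of the sphere bundle of radius `r`, in terms of that of the total space. -/
theorem ricci_inducedMetric (h : IsConnectionData g k A Ω) (hU : IsOpen U)
    (hφ : ContDiffOn ℝ ∞ φ U) (hmaps : ∀ z ∈ U, (φ z).1 ∈ Ω)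
    (hinj : ∀ z ∈ U, Function.Injective (fderiv ℝ φ z)) (hr : 0 < r)
    (hsphere : ∀ z ∈ U, k (φ z).1 (φ z).2 (φ z).2 = r ^ 2)
    (hdim : Module.finrank ℝ W + 1 = Module.finrank ℝ (X × F)) {z : W} (hz : z ∈ U) (u : W) :
    ricci (inducedMetric (localMetric g k A) φ) z u u =
      ricci (localMetric g k A) (φ z) (fderiv ℝ φ z u) (fderiv ℝ φ z u)
      + ((Module.finrank ℝ F : ℝ) - 2) / r ^ 2 *
        k (φ z).1 (localConnector A (φ z) (fderiv ℝ φ z u))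
          (localConnector A (φ z) (fderiv ℝ φ z u)) := by
  have hG := h.isMetricOn
  have hmaps' : MapsTo φ U (Ω ×ˢ univ) := fun z hz ↦ ⟨hmaps z hz, mem_univ _⟩
  have hI := hG.inducedMetric hU hφ hmaps' hinj
  set G := localMetric g k A with hGdef
  set N : W → X × F := fun z ↦ (0, (φ z).2) with hN
  have hr2 : r ^ 2 ≠ 0 := by positivity
  have hGN : ∀ z v, G (φ z) (N z) v = k (φ z).1 (φ z).2 (localConnector A (φ z) v) :=
    fun z v ↦ localMetric_position_apply (φ z) v
  have hφd : ∀ z ∈ U, ContDiffAt ℝ ∞ φ z := fun z hz ↦ hφ.contDiffAt (hU.mem_nhds hz)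
  -- the position field is normal
  have htan : ∀ z ∈ U, ∀ u, k (φ z).1 (φ z).2 (localConnector A (φ z) (fderiv ℝ φ z u)) = 0 := by
    intro z hz u
    have h1 := (h.hasFDerivAt_fiberNorm (hmaps z hz)).comp z
      (differentiableAt_of_infty (hφd z hz)).hasFDerivAt
    have h2 : (fun y : X × F ↦ k y.1 y.2 y.2) ∘ φ =ᶠ[𝓝 z] fun _ ↦ r ^ 2 := by
      filter_upwards [hU.mem_nhds hz] with z hz using hsphere z hz
    have h3 := DFunLike.congr_fun
      (h1.unique ((hasFDerivAt_const (r ^ 2) z).congr_of_eventuallyEq h2)) u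
    simpa using h3
  have hNN : ∀ z ∈ U, G (φ z) (N z) (N z) = r ^ 2 := by
    intro z hz
    rw [hGN, ← hsphere z hz]
    simp [hN]
  have hNd : ∀ z ∈ U, DifferentiableAt ℝ N z := fun z hz ↦ by
    have := differentiableAt_of_infty (hφd z hz)
    simp only [hN]
    fun_prop
  have hN' : ∀ z ∈ U, ∀ u, fderiv ℝ N z u = (0, (fderiv ℝ φ z u).2) := by
    intro z hz u
    have h1 : HasFDerivAt N ((ContinuousLinearMap.inr ℝ X F ∘L ContinuousLinearMap.snd ℝ X F) ∘L
        fderiv ℝ φ z) z :=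
      (ContinuousLinearMap.inr ℝ X F ∘L ContinuousLinearMap.snd ℝ X F).hasFDerivAt.comp z
        (differentiableAt_of_infty (hφd z hz)).hasFDerivAt
    rw [h1.fderiv]
    rfl
  have hnabla : ∀ z ∈ U, ∀ u, fderiv ℝ N z u + christoffel G (φ z) (fderiv ℝ φ z u) (N z) =
      (0, localConnector A (φ z) (fderiv ℝ φ z u)) := by
    intro z hz u
    rw [hN' z hz, hN, h.christoffel_position (hmaps z hz)]
    simp
  -- the second fundamental form
  obtain ⟨q, hq, hqd⟩ : ∃ q : W → W →L[ℝ] W →L[ℝ] ℝ,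
      (∀ z u w, q z u w = -(r ^ 2)⁻¹ * k (φ z).1 (localConnector A (φ z) (fderiv ℝ φ z u))
        (localConnector A (φ z) (fderiv ℝ φ z w))) ∧ DifferentiableAt ℝ q z := by
    let K : W → W →L[ℝ] F := fun z ↦ localConnector A (φ z) ∘L fderiv ℝ φ z
    refine ⟨fun z ↦ (-(r ^ 2)⁻¹) • ((K z).precomp ℝ ∘L (k (φ z).1 ∘L K z)), fun _ _ _ ↦ rfl, ?_⟩
    have h0 := hφd z hz
    have h1 := contDiffAt_fderiv_infty h0
    have hk : ContDiffAt ℝ ∞ (fun z ↦ k (φ z).1) z :=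
      (h.contDiffAt_fiber (hmaps z hz)).comp z h0.fst
    have hKc : ContDiffAt ℝ ∞ (fun z ↦ localConnector A (φ z)) z :=
      (h.contDiffAt_localConnector (hmaps z hz)).comp z h0
    have hK : ContDiffAt ℝ ∞ K z := hKc.clm_comp h1
    have hpre : ContDiffAt ℝ ∞ (fun z ↦ (K z).precomp ℝ) z :=
      ((ContinuousLinearMap.compL ℝ W F ℝ).flip.contDiff).contDiffAt.comp z hK
    exact differentiableAt_of_infty (ContDiffAt.const_smul (-(r ^ 2)⁻¹)
      (hpre.clm_comp (hk.clm_comp hK)))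
  -- Differentiate the orthogonality of φ'(w) and N. This moves the derivative onto N, where ∇N is
  -- the vertical projection; r² is the squared length of N, which is not normalized.
  have hnormal : ∀ z ∈ U, ∀ u w, G (φ z) (fderiv ℝ (fderiv ℝ φ) z u w
      + christoffel G (φ z) (fderiv ℝ φ z u) (fderiv ℝ φ z w)) (N z) = q z u w * r ^ 2 := by
    intro z hz u w
    have h0 := hφd z hz
    have h1d := differentiableAt_of_infty (contDiffAt_fderiv_infty h0)
    have hGφ : DifferentiableAt ℝ (fun z ↦ G (φ z)) z :=
      differentiableAt_of_infty ((hG.contDiffAt (hmaps' hz)).comp z h0)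
    have hG' : fderiv ℝ (fun z ↦ G (φ z)) z = fderiv ℝ G (φ z) ∘L fderiv ℝ φ z :=
      fderiv_comp (g := G) z (differentiableAt_of_infty (hG.contDiffAt (hmaps' hz)))
        (differentiableAt_of_infty h0)
    have h2 : (fun z ↦ G (φ z) (fderiv ℝ φ z w) (N z)) =ᶠ[𝓝 z] fun _ ↦ 0 := by
      filter_upwards [hU.mem_nhds hz] with z hz
      rw [hG.symm _ (hmaps' hz), hGN, htan z hz]
    have h3 := DFunLike.congr_fun (h2.fderiv_eq (𝕜 := ℝ)) u
    rw [fderiv_bilin_apply hGφ (by fun_prop) (hNd z hz), hG', fderiv_clm_apply_const h1d] at h3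
    simp only [ContinuousLinearMap.comp_apply, fderiv_fun_const, Pi.zero_apply, zero_apply] at h3
    rw [hG.compatible (hmaps' hz)] at h3
    have h4 : G (φ z) (fderiv ℝ φ z w) (fderiv ℝ N z u
        + christoffel G (φ z) (fderiv ℝ φ z u) (N z)) =
        k (φ z).1 (localConnector A (φ z) (fderiv ℝ φ z u))
          (localConnector A (φ z) (fderiv ℝ φ z w)) := by
      rw [hnabla z hz, h.fiber_symm _ (hmaps z hz)]
      simp [hGdef, localMetric_apply]
    rw [map_add] at h4
    rw [hq, map_add, add_apply]
    field_simp
    linarith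
  -- Split the ambient space orthogonally into the tangent space of the sphere bundle and the line
  -- of N; the functional r⁻²G(N, ·) takes the value 1 at N.
  have hL : ∀ z ∈ U, ∃ ρ : X × F →ₗ[ℝ] W, (∀ u, ρ (fderiv ℝ φ z u) = u) ∧
      ∀ Y, fderiv ℝ φ z (ρ Y) + ((r ^ 2)⁻¹ * G (φ z) (N z) Y) • N z = Y := by
    intro z hz
    exact exists_splitting (L := (fderiv ℝ φ z : W →ₗ[ℝ] X × F))
      (ν := ((r ^ 2)⁻¹ • G (φ z) (N z) : X × F →L[ℝ] ℝ)) (N := N z) (hinj z hz)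
      (fun u ↦ show (r ^ 2)⁻¹ * G (φ z) (N z) (fderiv ℝ φ z u) = 0 by
        rw [hGN, htan z hz, mul_zero])
      (show (r ^ 2)⁻¹ * G (φ z) (N z) (N z) = 1 by rw [hNN z hz, inv_mul_cancel₀ hr2]) hdim
  have hformula : ∀ z ∈ U, ∀ u w,
      fderiv ℝ (fderiv ℝ φ) z u w + christoffel G (φ z) (fderiv ℝ φ z u) (fderiv ℝ φ z w) =
        fderiv ℝ φ z (christoffel (inducedMetric G φ) z u w) + q z u w • N z := by
    intro z hz u w
    obtain ⟨ρ, -, hρ⟩ := hL z hz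
    refine eq_of_forall_bilin_eq (hG.pos _ (hmaps' hz)) fun Y ↦ ?_
    have a1 := hG.gauss_formula hU hφ hmaps' hinj hz u w (ρ Y)
    have a2 := hnormal z hz u w
    have b1 := (hGN z (fderiv ℝ φ z (ρ Y))).trans (htan z hz _)
    have b2 := hNN z hz
    have b3 := (hGN z (fderiv ℝ φ z (christoffel (inducedMetric G φ) z u w))).trans (htan z hz _)
    rw [hG.symm _ (hmaps' hz)] at b3
    rw [← hρ Y]
    generalize (r ^ 2)⁻¹ * G (φ z) (N z) Y = c
    simp only [map_add, map_smul, add_apply, smul_apply, smul_eq_mul] at a1 a2 ⊢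
    linear_combination a1 + c * a2 - q z u w * b1 - c * b3 - c * q z u w * b2
  -- the trace of the Gauss equation
  obtain ⟨ρ, hρL, hρ⟩ := hL z hz
  set ν : X × F →ₗ[ℝ] ℝ :=
    (((r ^ 2)⁻¹ • G (φ z) (N z) : X × F →L[ℝ] ℝ) : X × F →ₗ[ℝ] ℝ) with hν
  have hρ' : ∀ Y, (fderiv ℝ φ z : W →ₗ[ℝ] X × F) (ρ Y) + ν Y • N z = Y := hρ
  set Y := fderiv ℝ φ z u with hY
  -- The vertical projection, which equals u ↦ ∇_u N on tangent vectors. It fixes N and preserves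
  -- tangency to the sphere bundle.
  set P : X × F →ₗ[ℝ] X × F := LinearMap.inr ℝ X F ∘ₗ (localConnector A (φ z) : X × F →ₗ[ℝ] F)
    with hP
  have hPN : P (N z) = N z := by simp [hP, hN]
  have hνP : ∀ w, ν (P (fderiv ℝ φ z w)) = 0 := by
    intro w
    have : ν (P (fderiv ℝ φ z w)) = (r ^ 2)⁻¹ * G (φ z) (N z) (P (fderiv ℝ φ z w)) := rfl
    rw [this, hGN, ← mul_zero (r ^ 2)⁻¹, ← htan z hz w]
    simp [hP]
  have hνN : ν (N z) = 1 := by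
    have : ν (N z) = (r ^ 2)⁻¹ * G (φ z) (N z) (N z) := rfl
    rw [this, hNN z hz, inv_mul_cancel₀ hr2]
  have hρN : ρ (N z) = 0 := by
    have := hρ (N z)
    rw [hNN z hz, inv_mul_cancel₀ hr2, one_smul, add_eq_right] at this
    exact hinj z hz (by rw [this, map_zero])
  -- The full trace of the vertical projection is n, and the normal direction N accounts for 1 of
  -- it.
  have trP : LinearMap.trace ℝ W (ρ ∘ₗ P ∘ₗ (fderiv ℝ φ z : W →ₗ[ℝ] X × F)) =
      (Module.finrank ℝ F : ℝ) - 1 := by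
    have h1 := trace_eq_of_splitting hρ' P
    have h2 : LinearMap.trace ℝ (X × F) P = Module.finrank ℝ F := by
      rw [hP, LinearMap.trace_comp_comm']
      rw [← LinearMap.trace_id ℝ F]
      congr 1
      ext b
      simp
    rw [hPN, hνN, h2] at h1
    linarith
  have trT := trace_eq_of_splitting hρ' (curvatureEndo G (φ z) Y Y : X × F →ₗ[ℝ] X × F)
  -- The normal direction contributes ⟨R(N, Y)Y, N⟩, which is zero because R(Y, N)N = 0. So the
  -- ambient Ricci curvature is the trace over tangent directions alone.
  have hTN : ν (curvatureEndo G (φ z) Y Y (N z)) = 0 := by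
    have h1 : ν (curvatureEndo G (φ z) Y Y (N z)) =
      (r ^ 2)⁻¹ * G (φ z) (N z) (curvatureEndo G (φ z) Y Y (N z)) := rfl
    have h2 : curvatureEndo G (φ z) Y (N z) (N z) = - curvatureEndo G (φ z) (N z) (N z) Y := by
      simp only [curvatureEndo_apply]
      abel
    rw [h1, hG.symm _ (hmaps' hz), hG.curvature_skew (hmaps' hz), h2, hN,
      h.curvatureEndo_position (hmaps z hz)]
    simp
  -- Project the Gauss equation along N. The two correction terms have traces (n - 1)q(u, u) and
  -- q(u, u), whence the factor n - 2.
  have hblock : ρ ∘ₗ (curvatureEndo G (φ z) Y Y : X × F →ₗ[ℝ] X × F) ∘ₗ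
      (fderiv ℝ φ z : W →ₗ[ℝ] X × F) =
      (curvatureEndo (inducedMetric G φ) z u u : W →ₗ[ℝ] W)
      + q z u u • (ρ ∘ₗ P ∘ₗ (fderiv ℝ φ z : W →ₗ[ℝ] X × F))
      - ((q z).flip u : W →ₗ[ℝ] ℝ).smulRight (ρ (P Y)) := by
    refine LinearMap.ext fun w ↦ ?_
    obtain ⟨c, hc⟩ := gauss_equation (hφd z hz)
      (differentiableAt_of_infty (hG.contDiffAt_christoffel (hmaps' hz)))
      (differentiableAt_of_infty (hI.contDiffAt_christoffel hz)) hqd (hNd z hz)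
      (by filter_upwards [hU.mem_nhds hz] with z hz using hformula z hz) w u u
    rw [hnabla z hz, hnabla z hz] at hc
    have h1 := congrArg ρ hc
    simp only [map_add, map_sub, map_smul, hρL, hρN, smul_zero, add_zero] at h1
    exact h1
  have hqP : q z (ρ (P Y)) u = q z u u := by
    rw [hq, hq]
    have h1 := hρ (P Y)
    have h2 : (r ^ 2)⁻¹ * G (φ z) (N z) (P Y) = 0 := hνP u
    rw [h2, zero_smul, add_zero] at h1
    rw [h1]
    simp [hP, hY]
  have htr : LinearMap.trace ℝ W (((q z).flip u : W →ₗ[ℝ] ℝ).smulRight (ρ (P Y))) = q z u u := by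
    rw [LinearMap.trace_smulRight]
    exact hqP
  rw [hblock, map_sub, map_add, map_smul, trP, htr] at trT
  have hTN' : ν ((curvatureEndo G (φ z) Y Y : X × F →ₗ[ℝ] X × F) (N z)) = 0 := hTN
  rw [hTN', smul_eq_mul, hq] at trT
  unfold ricci
  rw [trT]
  field_simp
  ring

end IsConnectionData

end

/-! ### Positivity near the zero section -/

noncomputable section

set_option maxSynthPendingDepth 3

theorem IsMetricOn.continuousAt_ricci {W : Type*} [NormedAddCommGroup W] [NormedSpace ℝ W]
    [FiniteDimensional ℝ W] {G : W → W →L[ℝ] W →L[ℝ] ℝ} {O : Set W} {y : W}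
    (hG : IsMetricOn G O) (hy : y ∈ O) (v : W) :
    ContinuousAt (fun p : W × W ↦ ricci G p.1 p.2 p.2) (y, v) := by
  have hcont : ∀ (L : (W →L[ℝ] W) →ₗ[ℝ] ℝ), Continuous L := fun L ↦
    L.continuous_of_finiteDimensional
  have hquad : ∀ p : W × W, ricci G p.1 p.2 p.2 =
      LinearMap.trace ℝ W (curvatureEndo G p.1 p.2 p.2 : W →ₗ[ℝ] W) := fun p ↦ rfl
  have htr : Continuous (fun T : W →L[ℝ] W ↦ LinearMap.trace ℝ W (T : W →ₗ[ℝ] W)) :=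
    hcont (LinearMap.trace ℝ W ∘ₗ ContinuousLinearMap.coeLM ℝ)
  refine htr.continuousAt.comp (f := fun p : W × W ↦ curvatureEndo G p.1 p.2 p.2) ?_
  have hp1 : ContinuousAt (Prod.fst : W × W → W) (y, v) := continuousAt_fst
  have hp2 : ContinuousAt (Prod.snd : W × W → W) (y, v) := continuousAt_snd
  have h1 : ContinuousAt (fun p : W × W ↦ christoffel G p.1) (y, v) :=
    ContinuousAt.comp (g := christoffel G) (hG.contDiffAt_christoffel hy).continuousAt hp1
  have h2 : ContinuousAt (fun p : W × W ↦ fderiv ℝ (christoffel G) p.1) (y, v) :=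
    ContinuousAt.comp (g := fderiv ℝ (christoffel G))
      (contDiffAt_fderiv_infty (hG.contDiffAt_christoffel hy)).continuousAt hp1
  have hflip := (ContinuousLinearMap.flipₗᵢ ℝ W W W).continuous.continuousAt.comp h1
  have hflip2 := (ContinuousLinearMap.flipₗᵢ ℝ W W (W →L[ℝ] W)).continuous.continuousAt.comp h2
  have a1 : ContinuousAt
      (fun p : W × W ↦ ((fderiv ℝ (christoffel G) p.1).flip p.2).flip p.2) (y, v) :=
    ((ContinuousLinearMap.flipₗᵢ ℝ W W W).continuous.continuousAt.comp
      (hflip2.clm_apply hp2)).clm_apply hp2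
  have a2 : ContinuousAt (fun p : W × W ↦ (fderiv ℝ (christoffel G) p.1 p.2).flip p.2) (y, v) :=
    ((ContinuousLinearMap.flipₗᵢ ℝ W W W).continuous.continuousAt.comp
      (h2.clm_apply hp2)).clm_apply hp2
  have a3 : ContinuousAt
      (fun p : W × W ↦ (christoffel G p.1).flip (christoffel G p.1 p.2 p.2)) (y, v) :=
    hflip.clm_apply ((h1.clm_apply hp2).clm_apply hp2)
  have a4 : ContinuousAt
      (fun p : W × W ↦ (christoffel G p.1 p.2) ∘L ((christoffel G p.1).flip p.2)) (y, v) :=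
    (h1.clm_apply hp2).clm_comp (hflip.clm_apply hp2)
  exact ((a1.sub a2).add a3).sub a4

theorem ricci_smul {W : Type*} [NormedAddCommGroup W] [NormedSpace ℝ W]
    (G : W → W →L[ℝ] W →L[ℝ] ℝ) (y : W) (c : ℝ) (v : W) :
    ricci G y (c • v) (c • v) = c ^ 2 * ricci G y v v := by
  have : (curvatureEndo G y (c • v) (c • v) : W →ₗ[ℝ] W) =
      (c ^ 2) • (curvatureEndo G y v v : W →ₗ[ℝ] W) := by
    refine LinearMap.ext fun u ↦ ?_
    simp only [ContinuousLinearMap.coe_coe, LinearMap.smul_apply, curvatureEndo_apply, map_smul,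
      smul_apply]
    module
  unfold ricci
  rw [this, map_smul, smul_eq_mul]

namespace IsConnectionData

variable {X F : Type*} [NormedAddCommGroup X] [NormedSpace ℝ X]
  [NormedAddCommGroup F] [NormedSpace ℝ F] [FiniteDimensional ℝ X] [FiniteDimensional ℝ F]
  {g : X → X →L[ℝ] X →L[ℝ] ℝ} {k : X → F →L[ℝ] F →L[ℝ] ℝ}
  {A : X → X →L[ℝ] F →L[ℝ] F} {Ω : Set X} {x : X}

/-- Near a point of the zero section above which the base has positive Ricci curvature, the Ricci
form of the connection metric becomes positive after adding a large multiple of the vertical part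
of the metric. -/
theorem eventually_ricci_add_pos (h : IsConnectionData g k A Ω) (hx : x ∈ Ω)
    (hpos : ∀ a, a ≠ 0 → 0 < ricci g x a a) :
    ∀ᶠ p : (X × F) × ℝ in 𝓝 (x, 0) ×ˢ atTop, ∀ u : X × F, u ≠ 0 →
      0 < ricci (localMetric g k A) p.1 u u
        + p.2 * k p.1.1 (localConnector A p.1 u) (localConnector A p.1 u) := by
  have hm := h.isMetricOn
  have hxO : ((x, 0) : X × F) ∈ Ω ×ˢ (univ : Set F) := ⟨hx, mem_univ _⟩
  have hnn : ∀ y : X × F, y.1 ∈ Ω → ∀ u, 0 ≤ k y.1 (localConnector A y u) (localConnector A y u) := by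
    intro y hy u
    by_cases h4 : localConnector A y u = 0
    · rw [h4]; simp
    · exact (h.fiber_pos _ hy _ h4).le
  -- Positivity is proved locally around each unit direction, jointly in the base point, the large
  -- factor and the direction; compactness of the unit sphere then makes it uniform.
  have hloc : ∀ u ∈ Metric.sphere (0 : X × F) 1,
      {q : ((X × F) × ℝ) × (X × F) | 0 < ricci (localMetric g k A) q.1.1 q.2 q.2 + q.1.2 *
        k q.1.1.1 (localConnector A q.1.1 q.2) (localConnector A q.1.1 q.2)} ∈
      (𝓝 (x, 0) ×ˢ atTop) ×ˢ 𝓝 u := by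
    intro u hu
    have hu0 : u ≠ 0 := fun h0 ↦ by simp [h0] at hu
    have t1 : Tendsto (fun q : ((X × F) × ℝ) × (X × F) ↦ (q.1.1, q.2))
        ((𝓝 (x, 0) ×ˢ atTop) ×ˢ 𝓝 u) (𝓝 ((x, 0), u)) := by
      rw [nhds_prod_eq (y := u)]
      exact (tendsto_fst.comp tendsto_fst).prodMk tendsto_snd
    have t2 : Tendsto (fun q : ((X × F) × ℝ) × (X × F) ↦ q.1.2)
        ((𝓝 (x, 0) ×ˢ atTop) ×ˢ 𝓝 u) atTop := tendsto_snd.comp tendsto_fst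
    have cR := (hm.continuousAt_ricci hxO u).tendsto.comp t1
    have cK : ContinuousAt (fun p : (X × F) × (X × F) ↦
        k p.1.1 (localConnector A p.1 p.2) (localConnector A p.1 p.2)) ((x, 0), u) := by
      have c1 : ContinuousAt (fun p : (X × F) × (X × F) ↦ localConnector A p.1) ((x, 0), u) :=
        ContinuousAt.comp (g := localConnector A) (f := Prod.fst)
          (h.contDiffAt_localConnector (y := (x, 0)) hx).continuousAt continuousAt_fst
      have c2 : ContinuousAt (fun p : (X × F) × (X × F) ↦ k p.1.1) ((x, 0), u) :=
        ContinuousAt.comp (g := k) (f := fun p : (X × F) × (X × F) ↦ p.1.1)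
          (h.contDiffAt_fiber hx).continuousAt (by fun_prop)
      have c3 := c1.clm_apply (continuousAt_snd (p := ((x, (0 : F)), u)))
      exact (c2.clm_apply c3).clm_apply c3
    have cK' := cK.tendsto.comp t1
    have hΩ : ∀ᶠ q : ((X × F) × ℝ) × (X × F) in (𝓝 (x, 0) ×ˢ atTop) ×ˢ 𝓝 u, q.1.1.1 ∈ Ω := by
      have t3 : Tendsto (fun q : ((X × F) × ℝ) × (X × F) ↦ q.1.1.1)
          ((𝓝 (x, 0) ×ˢ atTop) ×ˢ 𝓝 u) (𝓝 x) :=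
        (continuousAt_fst (p := (x, (0 : F)))).tendsto.comp (tendsto_fst.comp tendsto_fst)
      exact t3.eventually (h.isOpen.mem_nhds hx)
    -- A horizontal direction has positive Ricci curvature at (x, 0), and the extra term is
    -- nonnegative. In any other direction the extra term tends to infinity while the Ricci term
    -- stays bounded.
    by_cases hQ : localConnector A (x, 0) u = 0
    · have hu2 : u.2 = 0 := by simpa using hQ
      have hu1 : u.1 ≠ 0 := fun h1 ↦ hu0 (Prod.ext h1 hu2)
      have hR : 0 < ricci (localMetric g k A) (x, 0) u u := by
        have hu' : u = (u.1, 0) := Prod.ext rfl hu2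
        rw [hu', h.ricci_zero_horizontal hx]
        exact hpos _ hu1
      filter_upwards [cR.eventually_const_lt hR, t2.eventually_ge_atTop 0, hΩ] with q h1 h2 h3
      have := mul_nonneg h2 (hnn q.1.1 h3 q.2)
      simp only [Function.comp_apply] at h1
      show 0 < _
      linarith
    · have hQ' := h.fiber_pos x hx _ hQ
      have t4 : Tendsto (fun q : ((X × F) × ℝ) × (X × F) ↦
          ricci (localMetric g k A) q.1.1 q.2 q.2 + q.1.2 *
          k q.1.1.1 (localConnector A q.1.1 q.2) (localConnector A q.1.1 q.2))
          ((𝓝 (x, 0) ×ˢ atTop) ×ˢ 𝓝 u) atTop :=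
        cR.add_atTop (t2.atTop_mul_pos hQ' cK')
      exact t4.eventually_gt_atTop 0
  have hcomp := (isCompact_sphere (0 : X × F) 1).mem_prod_nhdsSet_of_forall hloc
  have hev : ∀ᶠ p : (X × F) × ℝ in 𝓝 (x, 0) ×ˢ atTop, ∀ u ∈ Metric.sphere (0 : X × F) 1,
      0 < ricci (localMetric g k A) p.1 u u
        + p.2 * k p.1.1 (localConnector A p.1 u) (localConnector A p.1 u) := by
    obtain ⟨s, hs, t, ht, hst⟩ := mem_prod_iff.1 hcomp
    filter_upwards [hs] with p hp u hu
    have hq : (p, u) ∈ s ×ˢ t := mk_mem_prod hp (subset_of_mem_nhdsSet ht hu)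
    have := hst hq
    rwa [mem_ofPred_eq] at this
  filter_upwards [hev] with p hp u hu
  have hn : 0 < ‖u‖ := norm_pos_iff.2 hu
  -- Both terms are quadratic in `u`, so it suffices to treat unit vectors.
  have h1 := hp (‖u‖⁻¹ • u) (by simp [norm_smul, hn.ne'])
  rw [ricci_smul] at h1
  simp only [map_smul, smul_apply, smul_eq_mul] at h1
  have h2 : 0 < ‖u‖⁻¹ ^ 2 * (ricci (localMetric g k A) p.1 u u
        + p.2 * k p.1.1 (localConnector A p.1 u) (localConnector A p.1 u)) := by
    convert h1 using 1
    ring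
  exact pos_of_mul_pos_right h2 (by positivity)

end IsConnectionData

end

/-! ### Reading pulled-back metrics in charts -/

noncomputable section

set_option maxSynthPendingDepth 3

section Param

variable {E : Type*} [NormedAddCommGroup E] [NormedSpace ℝ E]
  {H : Type*} [TopologicalSpace H] {I : ModelWithCorners ℝ E H}
  {N : Type*} [TopologicalSpace N] [ChartedSpace H N]
  {W : Type*} [NormedAddCommGroup W] [NormedSpace ℝ W]
  {W' : Type*} [NormedAddCommGroup W'] [NormedSpace ℝ W']

theorem paramDeriv_comp {φ : W' → N} {f : W → W'} {y : W}
    (hφ : MDifferentiableAt 𝓘(ℝ, W') I φ (f y)) (hf : DifferentiableAt ℝ f y) :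
    paramDeriv I (φ ∘ f) y = paramDeriv I φ (f y) ∘L fderiv ℝ f y := by
  unfold paramDeriv
  rw [mfderiv_comp y hφ hf.mdifferentiableAt, mfderiv_eq_fderiv]
  rfl

theorem mvfderiv_paramDeriv {h : N → W'} {φ : W → N} {y : W}
    (hh : MDifferentiableAt I 𝓘(ℝ, W') h (φ y)) (hφ : MDifferentiableAt 𝓘(ℝ, W) I φ y) (u : W) :
    mvfderiv I h (φ y) (paramDeriv I φ y u) = fderiv ℝ (h ∘ φ) y u := by
  rw [← mfderiv_eq_fderiv, mfderiv_comp y hh hφ]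
  rfl

theorem mfderiv_paramDeriv {E' : Type*} [NormedAddCommGroup E'] [NormedSpace ℝ E']
    {H' : Type*} [TopologicalSpace H'] {I' : ModelWithCorners ℝ E' H'}
    {N' : Type*} [TopologicalSpace N'] [ChartedSpace H' N']
    {h : N → N'} {φ : W → N} {y : W}
    (hh : MDifferentiableAt I I' h (φ y)) (hφ : MDifferentiableAt 𝓘(ℝ, W) I φ y) (u : W) :
    mfderiv I I' h (φ y) (paramDeriv I φ y u) = paramDeriv I' (h ∘ φ) y u := by
  unfold paramDeriv
  rw [mfderiv_comp y hh hφ]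
  rfl

theorem pullbackMetric_comp (G : BilinearField I N) {φ : W' → N} {f : W → W'} {y : W}
    (hφ : MDifferentiableAt 𝓘(ℝ, W') I φ (f y)) (hf : DifferentiableAt ℝ f y) :
    pullbackMetric G (φ ∘ f) y = inducedMetric (pullbackMetric G φ) f y := by
  ext u v
  rw [pullbackMetric_apply, inducedMetric_apply, pullbackMetric_apply, paramDeriv_comp hφ hf]
  rfl

theorem paramDeriv_congr {φ φ' : W → N} {y : W} (h : φ =ᶠ[𝓝 y] φ') (u : W) :
    (paramDeriv I φ y u : E) = paramDeriv I φ' y u := by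
  unfold paramDeriv
  rw [h.mfderiv_eq]
  rfl

variable [I.Boundaryless] [IsManifold I 1 N]

theorem mdifferentiableAt_extChartAt_symm {x : N} {z : E} (hz : z ∈ (extChartAt I x).target) :
    MDifferentiableAt 𝓘(ℝ, E) I (extChartAt I x).symm z := by
  have := mdifferentiableWithinAt_extChartAt_symm hz
  rwa [I.range_eq_univ, mdifferentiableWithinAt_univ] at this

theorem isInvertible_paramDeriv_extChartAt_symm {x : N} {z : E}
    (hz : z ∈ (extChartAt I x).target) :
    (paramDeriv I (extChartAt I x).symm z).IsInvertible := by
  have := isInvertible_mfderivWithin_extChartAt_symm hz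
  rwa [I.range_eq_univ, mfderivWithin_univ] at this

/-- Reduces an arbitrary parametrization of a submanifold to an immersion into a vector space. The
equality holds near the point, not merely at it, because the curvature involves derivatives of the
metric. -/
theorem pullbackMetric_eventuallyEq_inducedMetric (G : BilinearField I N) {x : N} {φ : W → N}
    {U : Set W} (hU : IsOpen U) (hφ : ContMDiffOn 𝓘(ℝ, W) I 1 φ U)
    {y : W} (hy : y ∈ U) (hyx : φ y ∈ (extChartAt I x).source) :
    pullbackMetric G φ =ᶠ[𝓝 y]
      inducedMetric (pullbackMetric G (extChartAt I x).symm) (extChartAt I x ∘ φ) := by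
  have hc : ContinuousAt φ y := (hφ.contMDiffAt (hU.mem_nhds hy)).continuousAt
  have hO : ∀ᶠ z in 𝓝 y, z ∈ U ∧ φ z ∈ (extChartAt I x).source :=
    (hU.eventually_mem hy).and (hc.eventually ((isOpen_extChartAt_source x).mem_nhds hyx))
  filter_upwards [hO.eventually_nhds] with z hz
  obtain ⟨hzU, hzx⟩ := hz.self_of_nhds
  have hd : DifferentiableAt ℝ (extChartAt I x ∘ φ) z := by
    rw [← mdifferentiableAt_iff_differentiableAt]
    exact (mdifferentiableAt_extChartAt (by simpa using hzx)).comp z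
      ((hφ.contMDiffAt (hU.mem_nhds hzU)).mdifferentiableAt one_ne_zero)
  rw [← pullbackMetric_comp (f := extChartAt I x ∘ φ) G (mdifferentiableAt_extChartAt_symm
    ((extChartAt I x).map_source hzx)) hd]
  have he : φ =ᶠ[𝓝 z] (extChartAt I x).symm ∘ (extChartAt I x ∘ φ) := by
    filter_upwards [hz] with w hw using ((extChartAt I x).left_inv hw.2).symm
  have h1 : pullbackMetric G φ z =
      pullbackMetric G ((extChartAt I x).symm ∘ (extChartAt I x ∘ φ)) z := by
    ext u v
    rw [pullbackMetric_apply, pullbackMetric_apply]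
    have := he.self_of_nhds
    have e1 := paramDeriv_congr (I := I) he u
    have e2 := paramDeriv_congr (I := I) he v
    -- The two base points are equal but not definitionally so; the vectors are generalized so that
    -- the base point can be substituted in the dependent types.
    generalize paramDeriv I φ z u = a at *
    generalize paramDeriv I φ z v = b at *
    generalize paramDeriv I ((extChartAt I x).symm ∘ (extChartAt I x ∘ φ)) z u = a' at *
    generalize paramDeriv I ((extChartAt I x).symm ∘ (extChartAt I x ∘ φ)) z v = b' at *
    generalize ((extChartAt I x).symm ∘ (extChartAt I x ∘ φ)) z = q at *
    subst this
    rw [show a = a' from e1, show b = b' from e2]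
  exact h1

end Param

end

/-! ### The connection form in a trivialization -/

noncomputable section

set_option maxSynthPendingDepth 3
set_option linter.unusedSectionVars false

section LocalForm

variable {EM : Type*} [NormedAddCommGroup EM] [NormedSpace ℝ EM]
  {H : Type*} [TopologicalSpace H] {I : ModelWithCorners ℝ EM H}
  {M : Type*} [TopologicalSpace M] [ChartedSpace H M]
  {F : Type*} [NormedAddCommGroup F] [NormedSpace ℝ F]

theorem Filter.EventuallyEq.mvfderiv_eq {f f' : M → F} {q : M} (h : f =ᶠ[𝓝 q] f') :
    mvfderiv I f q = mvfderiv I f' q := by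
  ext u
  have := h.mfderiv_eq (I := I) (I' := 𝓘(ℝ, F))
  simp only [mvfderiv]
  rw [this]
  rfl

variable {ξ : M → Type*} [TopologicalSpace (TotalSpace F ξ)]
  [∀ p, NormedAddCommGroup (ξ p)] [∀ p, InnerProductSpace ℝ (ξ p)]
  [FiberBundle F ξ] [VectorBundle ℝ F ξ]

variable (I) in
/-- The flat connection of a local trivialization `e`. -/
def flatCovDeriv (e : Trivialization F (TotalSpace.proj : TotalSpace F ξ → M))
    [MemTrivializationAtlas e] (σ : ∀ q, ξ q) (q : M) : TangentSpace I q →L[ℝ] ξ q :=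
  e.symmL ℝ q ∘L mvfderiv I (fun q' ↦ (e ⟨q', σ q'⟩).2) q

theorem isCovariantDerivativeOn_flatCovDeriv [ContMDiffVectorBundle 1 F ξ I]
    (e : Trivialization F (TotalSpace.proj : TotalSpace F ξ → M)) [MemTrivializationAtlas e] :
    IsCovariantDerivativeOn F (flatCovDeriv I e) e.baseSet where
  add {σ σ' q} hσ hσ' hq := by
    rw [e.mdifferentiableAt_section_iff _ _ hq] at hσ hσ'
    have h : (fun q' ↦ (e ⟨q', (σ + σ') q'⟩).2) =ᶠ[𝓝 q]
        fun q' ↦ (e ⟨q', σ q'⟩).2 + (e ⟨q', σ' q'⟩).2 := by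
      filter_upwards [e.open_baseSet.mem_nhds hq] with q' hq'
      exact (e.linear ℝ hq').map_add (σ q') (σ' q')
    simp only [flatCovDeriv]
    rw [h.mvfderiv_eq, mvfderiv_fun_add hσ hσ', ContinuousLinearMap.comp_add]
  leibniz {σ f q} hσ hf hq := by
    rw [e.mdifferentiableAt_section_iff _ _ hq] at hσ
    have h : (fun q' ↦ (e ⟨q', (f • σ) q'⟩).2) =ᶠ[𝓝 q]
        f • fun q' ↦ (e ⟨q', σ q'⟩).2 := by
      filter_upwards [e.open_baseSet.mem_nhds hq] with q' hq'
      exact (e.linear ℝ hq').map_smul (f q') (σ q')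
    simp only [flatCovDeriv]
    rw [h.mvfderiv_eq, mvfderiv_smul hf hσ]
    ext u
    have : e.symmL ℝ q (e ⟨q, σ q⟩).2 = σ q := by
      rw [e.symmL_apply hq, e.symm_apply_apply_mk hq]
    simp [this]

variable [FiniteDimensional ℝ F] [ContMDiffVectorBundle 1 F ξ I]

/-- The connection form of `D` in the local trivialization `e`. -/
def connectionForm (D : CovariantDerivative I F ξ)
    (e : Trivialization F (TotalSpace.proj : TotalSpace F ξ → M)) [MemTrivializationAtlas e]
    (q : M) : ξ q →L[ℝ] TangentSpace I q →L[ℝ] ξ q :=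
  (D.isCovariantDerivativeOn (s := e.baseSet)).difference
    (isCovariantDerivativeOn_flatCovDeriv e) q

/-- Two covariant derivatives differ by a tensor. Comparison with the flat connection of `e`
therefore writes `D` as the coordinate derivative plus a term depending only on the value of σ. -/
theorem covariantDerivative_eq_add_connectionForm (D : CovariantDerivative I F ξ)
    (e : Trivialization F (TotalSpace.proj : TotalSpace F ξ → M)) [MemTrivializationAtlas e]
    {q : M} (hq : q ∈ e.baseSet) {σ : ∀ q, ξ q}
    (hσ : MDifferentiableAt I (I.prod 𝓘(ℝ, F)) (fun q ↦ TotalSpace.mk' F q (σ q)) q) :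
    D σ q = e.symmL ℝ q ∘L mvfderiv I (fun q' ↦ (e ⟨q', σ q'⟩).2) q
      + connectionForm D e q (σ q) := by
  rw [connectionForm, IsCovariantDerivativeOn.difference_apply _ _ hq hσ]
  simp [flatCovDeriv]

theorem contMDiffOn_symm_const {n : ℕ∞ω} [ContMDiffVectorBundle n F ξ I]
    (e : Trivialization F (TotalSpace.proj : TotalSpace F ξ → M)) [MemTrivializationAtlas e]
    (v : F) :
    ContMDiffOn I (I.prod 𝓘(ℝ, F)) n (fun q ↦ TotalSpace.mk' F q (e.symm q v)) e.baseSet := by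
  rw [e.contMDiffOn_section_baseSet_iff]
  refine (contMDiffOn_const (c := v)).congr fun q hq ↦ ?_
  rw [e.apply_mk_symm hq]

/-- Sections with constant coordinates are parallel for the flat connection, so only the connection
form survives. This is the relation between De_α and ω. -/
theorem covariantDerivative_symm_const (D : CovariantDerivative I F ξ)
    (e : Trivialization F (TotalSpace.proj : TotalSpace F ξ → M)) [MemTrivializationAtlas e]
    {q : M} (hq : q ∈ e.baseSet) (v : F) :
    D (fun q ↦ e.symm q v) q = connectionForm D e q (e.symm q v) := by
  have h1 := ((contMDiffOn_symm_const (I := I) (n := 1) e v).contMDiffAt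
    (e.open_baseSet.mem_nhds hq)).mdifferentiableAt one_ne_zero
  rw [covariantDerivative_eq_add_connectionForm D e hq h1]
  have h : (fun q' ↦ (e ⟨q', e.symm q' v⟩).2) =ᶠ[𝓝 q] fun _ ↦ v := by
    filter_upwards [e.open_baseSet.mem_nhds hq] with q' hq'
    rw [e.apply_mk_symm hq']
  rw [h.mvfderiv_eq, mvfderiv_const]
  simp

end LocalForm

section Coordinates

variable {EM : Type*} [NormedAddCommGroup EM] [NormedSpace ℝ EM]
  {H : Type*} [TopologicalSpace H] {I : ModelWithCorners ℝ EM H}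
  {M : Type*} [TopologicalSpace M] [ChartedSpace H M]
  {F : Type*} [NormedAddCommGroup F] [NormedSpace ℝ F]
  {ξ : M → Type*} [TopologicalSpace (TotalSpace F ξ)]
  [∀ p, NormedAddCommGroup (ξ p)] [∀ p, InnerProductSpace ℝ (ξ p)]
  [FiberBundle F ξ] [VectorBundle ℝ F ξ]

variable (I F ξ) in
/-- The domain of the coordinates on the base given by the chart at `p`, restricted to the
trivialization at `p`. -/
def coordDomain (p : M) : Set EM :=
  (extChartAt I p).target ∩ (extChartAt I p).symm ⁻¹' (trivializationAt F ξ p).baseSet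

variable (I F ξ) in
/-- The fibre metric in coordinates. -/
def fiberMetricCoord (p : M) (x : EM) : F →L[ℝ] F →L[ℝ] ℝ :=
  letI q := (extChartAt I p).symm x
  letI s := (trivializationAt F ξ p).symmL ℝ q
  s.precomp ℝ ∘L (innerSL ℝ ∘L s)

/-- The connection form in coordinates. -/
def connectionFormCoord [FiniteDimensional ℝ F] [ContMDiffVectorBundle 1 F ξ I]
    (D : CovariantDerivative I F ξ) (p : M) (x : EM) : EM →L[ℝ] F →L[ℝ] F :=
  letI q := (extChartAt I p).symm x
  letI e := trivializationAt F ξ p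
  letI B : F →L[ℝ] EM →L[ℝ] F :=
    ((e.continuousLinearMapAt ℝ q).postcomp EM ∘L
      (paramDeriv I (extChartAt I p).symm x).precomp (ξ q)) ∘L
        connectionForm D e q ∘L e.symmL ℝ q
  -- The connection form takes the fibre vector first, whereas the local model takes the tangent
  -- direction first.
  B.flip

theorem fiberMetricCoord_apply (p : M) (x : EM) (b b' : F) :
    fiberMetricCoord I F ξ p x b b' =
      inner ℝ ((trivializationAt F ξ p).symmL ℝ ((extChartAt I p).symm x) b)
        ((trivializationAt F ξ p).symmL ℝ ((extChartAt I p).symm x) b') := rfl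

theorem connectionFormCoord_apply [FiniteDimensional ℝ F] [ContMDiffVectorBundle 1 F ξ I]
    (D : CovariantDerivative I F ξ) (p : M) (x a : EM) (b : F) :
    connectionFormCoord D p x a b =
      (trivializationAt F ξ p).continuousLinearMapAt ℝ ((extChartAt I p).symm x)
        (connectionForm D (trivializationAt F ξ p) ((extChartAt I p).symm x)
          ((trivializationAt F ξ p).symmL ℝ ((extChartAt I p).symm x) b)
          (paramDeriv I (extChartAt I p).symm x a)) := rfl

end Coordinates

end

/-! ### Bundle charts and independence of the connector from the trivialization -/

noncomputable section

set_option maxSynthPendingDepth 3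
set_option linter.unusedSectionVars false

section

variable {E : Type*} [NormedAddCommGroup E] [NormedSpace ℝ E]
  {H : Type*} [TopologicalSpace H] {I : ModelWithCorners ℝ E H}
  {N : Type*} [TopologicalSpace N] [ChartedSpace H N]
  {W : Type*} [NormedAddCommGroup W] [NormedSpace ℝ W] [I.Boundaryless] [IsManifold I 1 N]

theorem mvfderiv_eq_fderiv_extChartAt {h : N → W} {z : N} {h' : E → W}
    (hh' : DifferentiableAt ℝ h' (extChartAt I z z))
    (hh : h ∘ (extChartAt I z).symm =ᶠ[𝓝 (extChartAt I z z)] h')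
    (U : TangentSpace I z) :
    mvfderiv I h z U = fderiv ℝ h' (extChartAt I z z)
      (mfderiv I 𝓘(ℝ, E) (extChartAt I z) z U) := by
  have he : h =ᶠ[𝓝 z] h' ∘ extChartAt I z := by
    have h1 := (continuousAt_extChartAt (I := I) z).eventually hh
    filter_upwards [h1, extChartAt_source_mem_nhds (I := I) z] with w hw hw'
    rw [Function.comp_apply, ← hw, Function.comp_apply, (extChartAt I z).left_inv hw']
  rw [he.mvfderiv_eq, ← mfderiv_eq_fderiv]
  unfold mvfderiv
  rw [mfderiv_comp z hh'.mdifferentiableAt (mdifferentiableAt_extChartAt (by simp))]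
  rfl

end

section

variable {EM : Type*} [NormedAddCommGroup EM] [NormedSpace ℝ EM]
  {H : Type*} [TopologicalSpace H] {I : ModelWithCorners ℝ EM H}
  {M : Type*} [TopologicalSpace M] [ChartedSpace H M]
  {F : Type*} [NormedAddCommGroup F] [NormedSpace ℝ F]
  {ξ : M → Type*} [TopologicalSpace (TotalSpace F ξ)]
  [∀ p, NormedAddCommGroup (ξ p)] [∀ p, InnerProductSpace ℝ (ξ p)]
  [FiberBundle F ξ] [VectorBundle ℝ F ξ]

theorem extChartAt_totalSpace_symm (x₀ : TotalSpace F ξ) {y : EM × F}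
    (hy : y.1 ∈ coordDomain I F ξ x₀.proj) :
    (extChartAt (I.prod 𝓘(ℝ, F)) x₀).symm y =
      ⟨(extChartAt I x₀.proj).symm y.1,
        (trivializationAt F ξ x₀.proj).symm ((extChartAt I x₀.proj).symm y.1) y.2⟩ := by
  rw [Trivialization.mk_symm _ hy.2, FiberBundle.extChartAt]
  rfl

theorem extChartAt_totalSpace (x₀ x : TotalSpace F ξ)
    (hx : x.proj ∈ (trivializationAt F ξ x₀.proj).baseSet) :
    extChartAt (I.prod 𝓘(ℝ, F)) x₀ x =
      (extChartAt I x₀.proj x.proj, (trivializationAt F ξ x₀.proj x).2) := by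
  rw [FiberBundle.extChartAt]
  simp [Trivialization.coe_fst _ ((Trivialization.mem_source _).2 hx)]

theorem extChartAt_totalSpace_target (x₀ : TotalSpace F ξ) :
    (extChartAt (I.prod 𝓘(ℝ, F)) x₀).target = coordDomain I F ξ x₀.proj ×ˢ univ :=
  FiberBundle.extChartAt_target x₀

variable [I.Boundaryless]

theorem isOpen_coordDomain (p : M) : IsOpen (coordDomain I F ξ p) :=
  (continuousOn_extChartAt_symm p).isOpen_inter_preimage (isOpen_extChartAt_target p)
    (trivializationAt F ξ p).open_baseSet

theorem extChartAt_mem_coordDomain {p q : M} (hq : q ∈ (extChartAt I p).source)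
    (hq' : q ∈ (trivializationAt F ξ p).baseSet) : extChartAt I p q ∈ coordDomain I F ξ p :=
  ⟨(extChartAt I p).map_source hq, by
    rw [mem_preimage, (extChartAt I p).left_inv hq]; exact hq'⟩

variable [FiniteDimensional ℝ F] [IsManifold I 1 M] [ContMDiffVectorBundle 1 F ξ I]

/-- The connector at `z` is defined with the trivialization preferred at that very point, so it must
be rewritten in one fixed `e` before it can be differentiated. If C is the coordinate change, the
derivative of C(x)v has the extra term (∂C)v; it is matched by the derivative of the
constant-coordinate extension read in `e`. -/
theorem connector_apply (D : CovariantDerivative I F ξ)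
    (e : Trivialization F (TotalSpace.proj : TotalSpace F ξ → M)) [MemTrivializationAtlas e]
    (z : TotalSpace F ξ) (hz : z.proj ∈ e.baseSet) (U : TangentSpace (I.prod 𝓘(ℝ, F)) z) :
    connector D z U =
      e.symmL ℝ z.proj (mvfderiv (I.prod 𝓘(ℝ, F)) (fun z' ↦ (e z').2) z U)
        + connectionForm D e z.proj z.snd (projDeriv z U) := by
  have : IsManifold (I.prod 𝓘(ℝ, F)) 1 (TotalSpace F ξ) := inferInstance
  set t := trivializationAt F ξ z.proj with ht
  have hzt : z.proj ∈ t.baseSet := mem_baseSet_trivializationAt F ξ z.proj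
  set c := extChartAt I z.proj with hc
  set χ := extChartAt (I.prod 𝓘(ℝ, F)) z with hχ
  set y := χ z with hy
  have hy' : y = (c z.proj, (t z).2) := extChartAt_totalSpace z z hzt
  set u := mfderiv (I.prod 𝓘(ℝ, F)) 𝓘(ℝ, EM × F) χ z U with hu
  set w := (t z).2 with hw
  let C : EM → F →L[ℝ] F := fun x ↦ (t.coordChangeL ℝ e (c.symm x) : F →L[ℝ] F)
  have hC : DifferentiableAt ℝ C y.1 := by
    rw [← mdifferentiableAt_iff_differentiableAt]
    have h1 : MDifferentiableAt I 𝓘(ℝ, F →L[ℝ] F)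
        (fun q ↦ (t.coordChangeL ℝ e q : F →L[ℝ] F)) (c.symm y.1) := by
      rw [hy', c.left_inv (mem_extChartAt_source z.proj)]
      exact mdifferentiableAt_coordChangeL hzt hz
    exact h1.comp y.1 (mdifferentiableAt_extChartAt_symm (by
      rw [hy']; exact mem_extChartAt_target z.proj))
  have hnear : ∀ᶠ y' in 𝓝 y, y'.1 ∈ coordDomain I F ξ z.proj ∧ c.symm y'.1 ∈ e.baseSet := by
    have h2 : y.1 ∈ c.target ∩ c.symm ⁻¹' e.baseSet := by
      rw [hy']
      refine ⟨mem_extChartAt_target z.proj, ?_⟩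
      rw [mem_preimage, c.left_inv (mem_extChartAt_source z.proj)]
      exact hz
    have h3 : IsOpen (c.target ∩ c.symm ⁻¹' e.baseSet) :=
      (continuousOn_extChartAt_symm z.proj).isOpen_inter_preimage
        (isOpen_extChartAt_target z.proj) e.open_baseSet
    have h4 : y.1 ∈ coordDomain I F ξ z.proj := by
      rw [hy']
      exact extChartAt_mem_coordDomain (mem_extChartAt_source z.proj) hzt
    filter_upwards [continuous_fst.continuousAt.eventually (h3.mem_nhds h2),
      continuous_fst.continuousAt.eventually ((isOpen_coordDomain z.proj).mem_nhds h4)]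
      with y' h5 h6 using ⟨h6, h5.2⟩
  have e1 : mvfderiv (I.prod 𝓘(ℝ, F)) (fun z' ↦ (t z').2) z U = u.2 := by
    rw [mvfderiv_eq_fderiv_extChartAt (h' := Prod.snd) differentiableAt_snd, fderiv_snd]
    · rfl
    · filter_upwards [hnear] with y' hy'
      rw [Function.comp_apply, extChartAt_totalSpace_symm z hy'.1, t.apply_mk_symm hy'.1.2]
  have hdC : HasFDerivAt (fun y' : EM × F ↦ C y'.1 y'.2)
      (C y.1 ∘L ContinuousLinearMap.snd ℝ EM F
        + (fderiv ℝ C y.1 ∘L ContinuousLinearMap.fst ℝ EM F).flip y.2) y :=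
    (hC.hasFDerivAt.comp y hasFDerivAt_fst).clm_apply hasFDerivAt_snd
  have e2 : mvfderiv (I.prod 𝓘(ℝ, F)) (fun z' ↦ (e z').2) z U
      = C y.1 u.2 + fderiv ℝ C y.1 u.1 w := by
    rw [mvfderiv_eq_fderiv_extChartAt hdC.differentiableAt, hdC.fderiv]
    · simp [hy']
      rfl
    · filter_upwards [hnear] with y' hy'
      rw [Function.comp_apply, extChartAt_totalSpace_symm z hy'.1]
      simp only [C]
      rw [ContinuousLinearEquiv.coe_coe, t.coordChangeL_apply e ⟨hy'.1.2, hy'.2⟩]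
  have hdC' : HasFDerivAt (fun y' : EM × F ↦ C y'.1 w)
      ((fderiv ℝ C y.1 ∘L ContinuousLinearMap.fst ℝ EM F).flip w) y := by
    have := (hC.hasFDerivAt.comp y hasFDerivAt_fst).clm_apply (hasFDerivAt_const w y)
    simpa using this
  have hσ : MDifferentiableAt I (I.prod 𝓘(ℝ, F))
      (fun q ↦ TotalSpace.mk' F q (FiberBundle.extend F z.snd q)) z.proj :=
    FiberBundle.mdifferentiableAt_extend I F z.snd
  have e3 : mvfderiv I (fun q' ↦ (e ⟨q', FiberBundle.extend F z.snd q'⟩).2) z.proj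
      (projDeriv z U) = fderiv ℝ C y.1 u.1 w := by
    have h1 : mvfderiv (I.prod 𝓘(ℝ, F))
        ((fun q' ↦ (e ⟨q', FiberBundle.extend F z.snd q'⟩).2) ∘ TotalSpace.proj) z U
        = fderiv ℝ C y.1 u.1 w := by
      rw [mvfderiv_eq_fderiv_extChartAt hdC'.differentiableAt, hdC'.fderiv]
      · rfl
      · filter_upwards [hnear] with y' hy'
        rw [Function.comp_apply, extChartAt_totalSpace_symm z hy'.1]
        simp only [C, Function.comp_apply]
        rw [ContinuousLinearEquiv.coe_coe, t.coordChangeL_apply e ⟨hy'.1.2, hy'.2⟩]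
        rfl
    rw [← h1]
    unfold mvfderiv
    rw [mfderiv_comp z ((e.mdifferentiableAt_section_iff _ _ hz).1 hσ)
      ((contMDiffAt_proj ξ).mdifferentiableAt one_ne_zero)]
    rfl
  have e4 : e.symmL ℝ z.proj (C y.1 u.2) = t.symmL ℝ z.proj u.2 := by
    have : C y.1 u.2 = (e ⟨z.proj, t.symm z.proj u.2⟩).2 := by
      simp only [C]
      rw [ContinuousLinearEquiv.coe_coe, hy', c.left_inv (mem_extChartAt_source z.proj),
        t.coordChangeL_apply e ⟨hzt, hz⟩]
    rw [this, e.symmL_apply hz, e.symm_apply_apply_mk hz, t.symmL_apply hzt]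
  rw [e2, map_add, e4, connector, add_apply, ContinuousLinearMap.comp_apply,
    ContinuousLinearMap.comp_apply, e1, covariantDerivative_eq_add_connectionForm D e hz hσ,
    add_apply, ContinuousLinearMap.comp_apply, e3, FiberBundle.extend_apply_self, ← add_assoc]

end

end

/-! ### The connection metric in a bundle chart is the local model -/

noncomputable section

set_option maxSynthPendingDepth 3
set_option linter.unusedSectionVars false

section

variable {EM : Type*} [NormedAddCommGroup EM] [NormedSpace ℝ EM]
  {H : Type*} [TopologicalSpace H] {I : ModelWithCorners ℝ EM H}
  {M : Type*} [TopologicalSpace M] [ChartedSpace H M]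
  {F : Type*} [NormedAddCommGroup F] [NormedSpace ℝ F]
  {ξ : M → Type*} [TopologicalSpace (TotalSpace F ξ)]
  [∀ p, NormedAddCommGroup (ξ p)] [∀ p, InnerProductSpace ℝ (ξ p)]
  [FiberBundle F ξ] [VectorBundle ℝ F ξ]
  [I.Boundaryless] [FiniteDimensional ℝ F] [IsManifold I 1 M] [ContMDiffVectorBundle 1 F ξ I]

theorem projDeriv_paramDeriv (x₀ : TotalSpace F ξ) {y : EM × F}
    (hy : y.1 ∈ coordDomain I F ξ x₀.proj) (u : EM × F) :
    (projDeriv ((extChartAt (I.prod 𝓘(ℝ, F)) x₀).symm y)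
      (paramDeriv (I.prod 𝓘(ℝ, F)) (extChartAt (I.prod 𝓘(ℝ, F)) x₀).symm y u) : EM) =
    paramDeriv I (extChartAt I x₀.proj).symm y.1 u.1 := by
  have hy' : y ∈ (extChartAt (I.prod 𝓘(ℝ, F)) x₀).target := by
    rw [extChartAt_totalSpace_target]; exact ⟨hy, mem_univ _⟩
  have h1 : (TotalSpace.proj : TotalSpace F ξ → M) ∘ (extChartAt (I.prod 𝓘(ℝ, F)) x₀).symm
      =ᶠ[𝓝 y] (extChartAt I x₀.proj).symm ∘ Prod.fst := by
    filter_upwards [continuous_fst.continuousAt.eventually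
      ((isOpen_coordDomain (I := I) (F := F) (ξ := ξ) x₀.proj).mem_nhds hy)] with y' hy'
    rw [Function.comp_apply, extChartAt_totalSpace_symm x₀ hy']
    rfl
  have h2 := paramDeriv_congr (I := I) h1 u
  rw [paramDeriv_comp (mdifferentiableAt_extChartAt_symm hy.1) differentiableAt_fst,
    fderiv_fst] at h2
  rw [projDeriv, mfderiv_paramDeriv ((contMDiffAt_proj ξ).mdifferentiableAt one_ne_zero)
    (mdifferentiableAt_extChartAt_symm hy')]
  exact h2

theorem connector_paramDeriv (D : CovariantDerivative I F ξ) (x₀ : TotalSpace F ξ) {y : EM × F}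
    (hy : y.1 ∈ coordDomain I F ξ x₀.proj) (u : EM × F) :
    connector D ((extChartAt (I.prod 𝓘(ℝ, F)) x₀).symm y)
      (paramDeriv (I.prod 𝓘(ℝ, F)) (extChartAt (I.prod 𝓘(ℝ, F)) x₀).symm y u) =
    (trivializationAt F ξ x₀.proj).symmL ℝ ((extChartAt (I.prod 𝓘(ℝ, F)) x₀).symm y).proj
      (localConnector (connectionFormCoord D x₀.proj) y u) := by
  set e := trivializationAt F ξ x₀.proj with he
  have hy' : y ∈ (extChartAt (I.prod 𝓘(ℝ, F)) x₀).target := by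
    rw [extChartAt_totalSpace_target]; exact ⟨hy, mem_univ _⟩
  have hz := extChartAt_totalSpace_symm x₀ hy
  have hp : ((extChartAt (I.prod 𝓘(ℝ, F)) x₀).symm y).proj ∈ e.baseSet := by
    rw [hz]; exact hy.2
  have hd := mdifferentiableAt_extChartAt_symm hy'
  have h1 : mvfderiv (I.prod 𝓘(ℝ, F)) (fun z' ↦ (e z').2)
      ((extChartAt (I.prod 𝓘(ℝ, F)) x₀).symm y)
      (paramDeriv (I.prod 𝓘(ℝ, F)) (extChartAt (I.prod 𝓘(ℝ, F)) x₀).symm y u) = u.2 := by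
    have h2 : (fun z' ↦ (e z').2) ∘ (extChartAt (I.prod 𝓘(ℝ, F)) x₀).symm =ᶠ[𝓝 y] Prod.snd := by
      filter_upwards [continuous_fst.continuousAt.eventually
        ((isOpen_coordDomain (I := I) (F := F) (ξ := ξ) x₀.proj).mem_nhds hy)] with y' hy'
      rw [Function.comp_apply, extChartAt_totalSpace_symm x₀ hy', e.apply_mk_symm hy'.2]
    rw [mvfderiv_paramDeriv _ hd, h2.fderiv_eq, fderiv_snd]
    · rfl
    · have h3 : MDifferentiableAt (I.prod 𝓘(ℝ, F)) (I.prod 𝓘(ℝ, F)) e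
          ((extChartAt (I.prod 𝓘(ℝ, F)) x₀).symm y) :=
        ((e.contMDiffOn (IB := I) (n := 1)).contMDiffAt
          (e.open_source.mem_nhds (e.mem_source.2 hp))).mdifferentiableAt one_ne_zero
      exact h3.snd
  rw [connector_apply D e _ hp, h1, localConnector_apply, map_add,
    connectionFormCoord_apply]
  congr 1
  -- Stated for variable points so that the equality of base points can be substituted inside the
  -- dependent fibres.
  have key : ∀ (z : TotalSpace F ξ) (q : M) (v : F) (a a' : EM), q ∈ e.baseSet → a = a' →
      z = ⟨q, e.symm q v⟩ →
      connectionForm D e z.proj z.snd (a : TangentSpace I z.proj) =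
      e.symmL ℝ z.proj (e.continuousLinearMapAt ℝ q (connectionForm D e q (e.symmL ℝ q v)
        (a' : TangentSpace I q))) := by
    rintro z q v a a' hq rfl rfl
    rw [e.symmL_continuousLinearMapAt hq, e.symmL_apply hq]
  exact key _ _ _ _ _ hy.2 (projDeriv_paramDeriv x₀ hy u) hz

theorem pullbackMetric_connectionMetric (g : BilinearField I M) (D : CovariantDerivative I F ξ)
    (x₀ : TotalSpace F ξ) {y : EM × F} (hy : y.1 ∈ coordDomain I F ξ x₀.proj) :
    pullbackMetric (connectionMetric g D) (extChartAt (I.prod 𝓘(ℝ, F)) x₀).symm y =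
      localMetric (pullbackMetric g (extChartAt I x₀.proj).symm)
        (fiberMetricCoord I F ξ x₀.proj) (connectionFormCoord D x₀.proj) y := by
  have hz := extChartAt_totalSpace_symm x₀ hy
  refine ContinuousLinearMap.ext fun u ↦ ContinuousLinearMap.ext fun v ↦ ?_
  rw [pullbackMetric_apply, connectionMetric_apply, localMetric_apply,
    connector_paramDeriv D x₀ hy, connector_paramDeriv D x₀ hy, pullbackMetric_apply,
    fiberMetricCoord_apply]
  have key : ∀ (q q' : M) (a a' b b' : EM), q = q' → a = a' → b = b' →
      g q (a : TangentSpace I q) (b : TangentSpace I q) =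
        g q' (a' : TangentSpace I q') (b' : TangentSpace I q') := by
    rintro _ _ _ _ _ _ rfl rfl rfl; rfl
  have key' : ∀ (q q' : M) (b b' : F), q = q' →
      inner ℝ ((trivializationAt F ξ x₀.proj).symmL ℝ q b)
        ((trivializationAt F ξ x₀.proj).symmL ℝ q b') =
      inner ℝ ((trivializationAt F ξ x₀.proj).symmL ℝ q' b)
        ((trivializationAt F ξ x₀.proj).symmL ℝ q' b') := by
    rintro _ _ _ _ rfl; rfl
  congr 1
  · exact key _ _ _ _ _ _ (by rw [hz]) (projDeriv_paramDeriv x₀ hy u)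
      (projDeriv_paramDeriv x₀ hy v)
  · exact key' _ _ _ _ (by rw [hz])

end

section

variable {EM : Type*} [NormedAddCommGroup EM] [NormedSpace ℝ EM]
  {H : Type*} [TopologicalSpace H] {I : ModelWithCorners ℝ EM H}
  {M : Type*} [TopologicalSpace M] [ChartedSpace H M] [IsManifold I ∞ M] [I.Boundaryless]

/-- The coordinate frame of the chart is the frame of the tangent bundle trivialization, so
smoothness of bundle sections becomes smoothness of coordinate coefficients. -/
theorem paramDeriv_extChartAt_symm_eq {p : M} {x : EM} (hx : x ∈ (extChartAt I p).target) (a : EM) :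
    paramDeriv I (extChartAt I p).symm x a =
      (trivializationAt EM (TangentSpace I) p).symm ((extChartAt I p).symm x) a := by
  have h1 : (extChartAt I p).symm x ∈ (chartAt H p).source := by
    simpa using (extChartAt I p).map_target hx
  rw [← Trivialization.symmL_apply (R := ℝ) _ (by simpa using h1),
    TangentBundle.symmL_trivializationAt h1, (extChartAt I p).right_inv hx, I.range_eq_univ,
    mfderivWithin_univ]
  rfl

theorem contMDiffOn_tangent_symm_const (p : M) (a : EM) :
    ContMDiffOn I (I.prod 𝓘(ℝ, EM)) ∞
      (fun q ↦ TotalSpace.mk' EM (E := TangentSpace I) q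
        ((trivializationAt EM (TangentSpace I) p).symm q a))
      (trivializationAt EM (TangentSpace I) p).baseSet := by
  rw [Trivialization.contMDiffOn_section_baseSet_iff]
  refine (contMDiffOn_const (c := a)).congr fun q hq ↦ ?_
  rw [Trivialization.apply_mk_symm _ hq]

theorem contDiffOn_pullbackMetric_extChartAt_symm [FiniteDimensional ℝ EM]
    (g : ContMDiffRiemannianMetric I ∞ EM (fun p : M ↦ TangentSpace I p)) (p : M) :
    ContDiffOn ℝ ∞ (pullbackMetric g.inner (extChartAt I p).symm) (extChartAt I p).target := by
  rw [contDiffOn_clm_apply]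
  intro a
  rw [contDiffOn_clm_apply]
  intro b
  set e := trivializationAt EM (TangentSpace I) p with he
  have h1 : ContMDiffOn I (I.prod 𝓘(ℝ)) ∞ (fun m ↦ TotalSpace.mk' ℝ (E := Bundle.Trivial M ℝ) m
      (g.inner m (e.symm m a) (e.symm m b))) e.baseSet := by
    apply ContMDiffOn.clm_bundle_apply₂ (F₁ := EM) (F₂ := EM)
    · exact g.contMDiff.contMDiffOn
    · exact contMDiffOn_tangent_symm_const p a
    · exact contMDiffOn_tangent_symm_const p b
  have h2 : ContMDiffOn I 𝓘(ℝ) ∞ (fun m ↦ g.inner m (e.symm m a) (e.symm m b)) e.baseSet := by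
    intro x hx
    have := h1 x hx
    simp only [contMDiffWithinAt_totalSpace] at this
    exact this.2
  rw [← contMDiffOn_iff_contDiffOn]
  refine (h2.comp (contMDiffOn_extChartAt_symm p) ?_).congr ?_
  · intro x hx
    rw [mem_preimage, he, TangentBundle.trivializationAt_baseSet]
    simpa using (extChartAt I p).map_target hx
  · intro x hx
    rw [pullbackMetric_apply, paramDeriv_extChartAt_symm_eq hx, paramDeriv_extChartAt_symm_eq hx]
    rfl

theorem isMetricOn_pullbackMetric_extChartAt_symm [FiniteDimensional ℝ EM]
    (g : ContMDiffRiemannianMetric I ∞ EM (fun p : M ↦ TangentSpace I p)) (p : M) :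
    IsMetricOn (pullbackMetric g.inner (extChartAt I p).symm) (extChartAt I p).target where
  isOpen := isOpen_extChartAt_target p
  contDiffOn := contDiffOn_pullbackMetric_extChartAt_symm g p
  symm y _ u v := g.symm _ _ _
  pos y hy u hu := by
    refine g.pos _ _ fun h ↦ hu ?_
    exact (isInvertible_paramDeriv_extChartAt_symm hy).injective (h.trans (map_zero _).symm)

end

end

/-! ### Smoothness and compatibility of the coordinate data -/

noncomputable section

set_option maxSynthPendingDepth 3
set_option linter.unusedSectionVars false

section

variable {EM : Type*} [NormedAddCommGroup EM] [NormedSpace ℝ EM] [FiniteDimensional ℝ EM]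
  {H : Type*} [TopologicalSpace H] {I : ModelWithCorners ℝ EM H}
  {M : Type*} [TopologicalSpace M] [ChartedSpace H M] [I.Boundaryless] [IsManifold I ∞ M]
  {F : Type*} [NormedAddCommGroup F] [NormedSpace ℝ F] [FiniteDimensional ℝ F]
  {ξ : M → Type*} [TopologicalSpace (TotalSpace F ξ)]
  [∀ p, NormedAddCommGroup (ξ p)] [∀ p, InnerProductSpace ℝ (ξ p)]
  [FiberBundle F ξ] [VectorBundle ℝ F ξ] [ContMDiffVectorBundle ∞ F ξ I]

theorem fiberMetricCoord_eq (p : M) {x : EM} (hx : x ∈ coordDomain I F ξ p) (b b' : F) :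
    fiberMetricCoord I F ξ p x b b' =
      inner ℝ ((trivializationAt F ξ p).symm ((extChartAt I p).symm x) b)
        ((trivializationAt F ξ p).symm ((extChartAt I p).symm x) b') := by
  rw [fiberMetricCoord_apply, Trivialization.symmL_apply _ hx.2, Trivialization.symmL_apply _ hx.2]

theorem contDiffOn_fiberMetricCoord [IsContMDiffRiemannianBundle I ∞ F ξ] (p : M) :
    ContDiffOn ℝ ∞ (fiberMetricCoord I F ξ p) (coordDomain I F ξ p) := by
  rw [contDiffOn_clm_apply]
  intro b
  rw [contDiffOn_clm_apply]
  intro b'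
  set e := trivializationAt F ξ p with he
  have h1 : ContMDiffOn I 𝓘(ℝ) ∞ (fun q ↦ inner ℝ (e.symm q b) (e.symm q b')) e.baseSet :=
    (contMDiffOn_symm_const e b).inner_bundle (contMDiffOn_symm_const e b')
  rw [← contMDiffOn_iff_contDiffOn]
  refine (h1.comp ((contMDiffOn_extChartAt_symm p).mono inter_subset_left) ?_).congr ?_
  · exact fun x hx ↦ hx.2
  · intro x hx
    exact fiberMetricCoord_eq p hx b b'

/-- Smoothness of `D` is applied to a globally smooth section, while a local frame is smooth only
over a trivialization. Multiplication by a bump function gives a global section without changing Dσ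
near `q`. -/
theorem contMDiffAt_covariantDerivative [T2Space M] (D : CovariantDerivative I F ξ)
    (hD : CovariantDerivative.ContMDiffCovariantDerivative D ∞) {σ : ∀ q, ξ q} {U : Set M}
    (hU : IsOpen U)
    (hσ : ContMDiffOn I (I.prod 𝓘(ℝ, F)) ∞ (fun q ↦ TotalSpace.mk' F q (σ q)) U)
    {q : M} (hq : q ∈ U) :
    ContMDiffAt I (I.prod 𝓘(ℝ, EM →L[ℝ] F)) ∞
      (fun q ↦ TotalSpace.mk' (EM →L[ℝ] F) (E := fun q ↦ TangentSpace I q →L[ℝ] ξ q) q (D σ q))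
      q := by
  obtain ⟨f, -, hf⟩ := (SmoothBumpFunction.nhds_basis_tsupport (I := I) q).mem_iff.1
    (hU.mem_nhds hq)
  have h1 : ContMDiff I (I.prod 𝓘(ℝ, F)) ∞
      (fun q ↦ TotalSpace.mk' F q (((f : M → ℝ) • σ) q)) :=
    ContMDiffOn.smul_section_of_tsupport f.contMDiff.contMDiffOn hU hf hσ
  have h2 := hD.contMDiff.contMDiff (σ := (f : M → ℝ) • σ) h1.contMDiffOn
  have h3 := (h2.contMDiffAt univ_mem : ContMDiffAt _ _ _ _ q)
  refine h3.congr_of_eventuallyEq ?_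
  -- The bump function must equal 1 on a neighbourhood of each nearby point, since `D` depends on
  -- the germ of the section.
  have h4 : ∀ᶠ q' in 𝓝 q, ∀ᶠ q'' in 𝓝 q', f q'' = 1 := f.eventuallyEq_one.eventually_nhds
  filter_upwards [h4, hU.mem_nhds hq] with q' hq' hqU
  have h5 : MDifferentiableAt I (I.prod 𝓘(ℝ, F)) (fun q ↦ TotalSpace.mk' F q (σ q)) q' :=
    (hσ.contMDiffAt (hU.mem_nhds hqU)).mdifferentiableAt (by simp)
  congr 1
  refine D.isCovariantDerivativeOnUniv.congr_of_eventuallyEq h5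
    (h1.mdifferentiable (by simp) q') univ_mem ?_
  filter_upwards [hq'] with q'' h6
  simp [h6]

theorem continuousLinearMapAt_eq_of_mem
    (e : Trivialization F (TotalSpace.proj : TotalSpace F ξ → M)) [MemTrivializationAtlas e]
    {q : M} (hq : q ∈ e.baseSet) (v : ξ q) :
    e.continuousLinearMapAt ℝ q v = (e ⟨q, v⟩).2 := by
  rw [Trivialization.continuousLinearMapAt_apply, e.coe_linearMapAt_of_mem hq]

theorem connectionFormCoord_eq (D : CovariantDerivative I F ξ) (p : M) {x : EM}
    (hx : x ∈ coordDomain I F ξ p) (a : EM) (b : F) :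
    connectionFormCoord D p x a b =
      (trivializationAt F ξ p ⟨(extChartAt I p).symm x,
        D (fun q ↦ (trivializationAt F ξ p).symm q b) ((extChartAt I p).symm x)
          (paramDeriv I (extChartAt I p).symm x a)⟩).2 := by
  rw [connectionFormCoord_apply, continuousLinearMapAt_eq_of_mem _ hx.2,
    covariantDerivative_symm_const D _ hx.2, Trivialization.symmL_apply _ hx.2]

theorem contDiffOn_connectionFormCoord [T2Space M] (D : CovariantDerivative I F ξ)
    (hD : CovariantDerivative.ContMDiffCovariantDerivative D ∞) (p : M) :
    ContDiffOn ℝ ∞ (connectionFormCoord D p) (coordDomain I F ξ p) := by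
  rw [contDiffOn_clm_apply]
  intro a
  rw [contDiffOn_clm_apply]
  intro b
  set e := trivializationAt F ξ p with he
  set eT := trivializationAt EM (TangentSpace I) p with heT
  have h1 : ContMDiffOn I 𝓘(ℝ, F) ∞
      (fun q ↦ (e ⟨q, D (fun q ↦ e.symm q b) q (eT.symm q a)⟩).2) (eT.baseSet ∩ e.baseSet) := by
    intro q hq
    have h2 := contMDiffAt_covariantDerivative D hD e.open_baseSet (contMDiffOn_symm_const e b) hq.2
    have h3 := (contMDiffOn_tangent_symm_const p a).contMDiffAt (eT.open_baseSet.mem_nhds hq.1)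
    have h4 : ContMDiffAt I (I.prod 𝓘(ℝ, F)) ∞
        (fun q ↦ TotalSpace.mk' F q (D (fun q ↦ e.symm q b) q (eT.symm q a))) q :=
      ContMDiffAt.clm_bundle_apply (F₁ := EM) (F₂ := F) h2 h3
    exact ((e.contMDiffAt_section_iff hq.2).1 h4).contMDiffWithinAt
  rw [← contMDiffOn_iff_contDiffOn]
  refine (h1.comp ((contMDiffOn_extChartAt_symm p).mono inter_subset_left) ?_).congr ?_
  · intro x hx
    refine ⟨?_, hx.2⟩
    rw [heT, TangentBundle.trivializationAt_baseSet]
    simpa using (extChartAt I p).map_target hx.1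
  · intro x hx
    rw [connectionFormCoord_eq D p hx, paramDeriv_extChartAt_symm_eq hx.1]
    rfl

theorem isConnectionData_coord [T2Space M] [IsContMDiffRiemannianBundle I ∞ F ξ]
    (g : ContMDiffRiemannianMetric I ∞ EM (fun p : M ↦ TangentSpace I p))
    (D : CovariantDerivative I F ξ) (hD : CovariantDerivative.ContMDiffCovariantDerivative D ∞)
    (hDmetric : D.IsMetricCompatible) (p : M) :
    IsConnectionData (pullbackMetric g.inner (extChartAt I p).symm) (fiberMetricCoord I F ξ p)
      (connectionFormCoord D p) (coordDomain I F ξ p) where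
  base :=
    { isOpen := isOpen_coordDomain p
      contDiffOn := (isMetricOn_pullbackMetric_extChartAt_symm g p).contDiffOn.mono
        inter_subset_left
      symm := fun y hy ↦ (isMetricOn_pullbackMetric_extChartAt_symm g p).symm y hy.1
      pos := fun y hy ↦ (isMetricOn_pullbackMetric_extChartAt_symm g p).pos y hy.1 }
  contDiffOn_fiber := contDiffOn_fiberMetricCoord p
  fiber_symm x _ b b' := real_inner_comm _ _
  fiber_pos x hx b hb := by
    rw [fiberMetricCoord_apply]
    refine real_inner_self_pos.2 fun h ↦ hb ?_
    have := Trivialization.continuousLinearMapAt_symmL (R := ℝ) _ hx.2 b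
    rw [h, map_zero] at this
    exact this.symm
  contDiffOn_form := contDiffOn_connectionFormCoord D hD p
  compatible x hx a b b' := by
    set e := trivializationAt F ξ p with he
    set q := (extChartAt I p).symm x with hq
    have hb : ∀ b, MDifferentiableAt I (I.prod 𝓘(ℝ, F))
        (fun q ↦ TotalSpace.mk' F q (e.symm q b)) q := fun b ↦
      ((contMDiffOn_symm_const (I := I) (n := 1) e b).contMDiffAt
        (e.open_baseSet.mem_nhds hx.2)).mdifferentiableAt one_ne_zero
    have hk : DifferentiableAt ℝ (fiberMetricCoord I F ξ p) x :=
      ((contDiffOn_fiberMetricCoord p).contDiffAt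
        ((isOpen_coordDomain p).mem_nhds hx)).differentiableAt (by simp)
    have h1 : fderiv ℝ (fiberMetricCoord I F ξ p) x a b b' =
        fderiv ℝ (fun x' ↦ fiberMetricCoord I F ξ p x' b b') x a := by
      rw [← fderiv_bilin_apply_const hk]
    have h2 : (fun x' ↦ fiberMetricCoord I F ξ p x' b b') =ᶠ[𝓝 x]
        (fun q ↦ inner ℝ (e.symm q b) (e.symm q b')) ∘ (extChartAt I p).symm := by
      filter_upwards [(isOpen_coordDomain p).mem_nhds hx] with x' hx'
      exact fiberMetricCoord_eq p hx' b b'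
    rw [h1, h2.fderiv_eq, ← mvfderiv_paramDeriv (φ := (extChartAt I p).symm) ((hb b).inner_bundle (hb b'))
      (mdifferentiableAt_extChartAt_symm hx.1)]
    -- Metric compatibility of `D` for two frame sections; on these `D` acts through the connection
    -- form alone.
    have h3 := hDmetric.mvfderiv_inner_eq (x := q)
      (fun q ↦ (paramDeriv I (extChartAt I p).symm x a : EM)) (hb b) (hb b')
    refine h3.trans ?_
    have h4 : ∀ b, e.symmL ℝ q (connectionFormCoord D p x a b) =
        D (fun q ↦ e.symm q b) q (paramDeriv I (extChartAt I p).symm x a) := by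
      intro b
      rw [connectionFormCoord_eq D p hx, e.symmL_apply hx.2, e.symm_apply_apply_mk hx.2]
    change _ = inner ℝ (e.symmL ℝ q (connectionFormCoord D p x a b)) (e.symmL ℝ q b')
      + inner ℝ (e.symmL ℝ q b) (e.symmL ℝ q (connectionFormCoord D p x a b'))
    rw [h4, h4, e.symmL_apply hx.2, e.symmL_apply hx.2]

end

end

/-! ### The connection metric is a smooth Riemannian metric -/

noncomputable section

set_option maxSynthPendingDepth 3
set_option linter.unusedSectionVars false

section

variable {E : Type*} [NormedAddCommGroup E] [NormedSpace ℝ E] [FiniteDimensional ℝ E]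

/-- Supplies the von Neumann boundedness of the unit ball of the metric that a Riemannian metric
must satisfy: the form attains a positive minimum on the compact unit sphere. -/
theorem exists_pos_mul_sq_le {b : E →L[ℝ] E →L[ℝ] ℝ} (hb : ∀ u, u ≠ 0 → 0 < b u u) :
    ∃ c > 0, ∀ u, c * ‖u‖ ^ 2 ≤ b u u := by
  rcases subsingleton_or_nontrivial E with hE | hE
  · exact ⟨1, one_pos, fun u ↦ by simp [Subsingleton.elim u 0]⟩
  have hc : Continuous fun u ↦ b u u := by fun_prop
  obtain ⟨u₀, hu₀, hmin⟩ := (isCompact_sphere (0 : E) 1).exists_isMinOn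
    (NormedSpace.sphere_nonempty.2 zero_le_one) hc.continuousOn
  have hu₀' : u₀ ≠ 0 := fun h ↦ by simp [h] at hu₀
  refine ⟨b u₀ u₀, hb u₀ hu₀', fun u ↦ ?_⟩
  rcases eq_or_ne u 0 with rfl | hu
  · simp
  have hn : 0 < ‖u‖ := norm_pos_iff.2 hu
  have h1 : b u₀ u₀ ≤ b (‖u‖⁻¹ • u) (‖u‖⁻¹ • u) :=
    hmin (by simp [norm_smul, hn.ne'])
  simp only [map_smul, smul_apply, smul_eq_mul] at h1
  calc b u₀ u₀ * ‖u‖ ^ 2 ≤ (‖u‖⁻¹ * (‖u‖⁻¹ * b u u)) * ‖u‖ ^ 2 := by gcongr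
    _ = b u u := by field_simp

variable {H : Type*} [TopologicalSpace H] {I : ModelWithCorners ℝ E H}
  {N : Type*} [TopologicalSpace N] [ChartedSpace H N] [IsManifold I ∞ N] [I.Boundaryless]

theorem contMDiffAt_bilinearField (G : BilinearField I N) (p : N)
    (hG : ContDiffAt ℝ ∞ (pullbackMetric G (extChartAt I p).symm) (extChartAt I p p)) :
    ContMDiffAt I (I.prod 𝓘(ℝ, E →L[ℝ] E →L[ℝ] ℝ)) ∞
      (fun q ↦ TotalSpace.mk' (E →L[ℝ] E →L[ℝ] ℝ)
        (E := fun q : N ↦ TangentSpace I q →L[ℝ] TangentSpace I q →L[ℝ] ℝ) q (G q)) p := by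
  rw [contMDiffAt_section]
  have h1 : ContMDiffAt I 𝓘(ℝ, E →L[ℝ] E →L[ℝ] ℝ) ∞
      (pullbackMetric G (extChartAt I p).symm ∘ extChartAt I p) p :=
    hG.contMDiffAt.comp p contMDiffAt_extChartAt
  refine h1.congr_of_eventuallyEq ?_
  filter_upwards [extChartAt_source_mem_nhds (I := I) p] with q hq
  have hq' := (extChartAt I p).map_source hq
  refine ContinuousLinearMap.ext fun a ↦ ContinuousLinearMap.ext fun b ↦ ?_
  rw [Function.comp_apply, pullbackMetric_apply, paramDeriv_extChartAt_symm_eq hq',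
    paramDeriv_extChartAt_symm_eq hq', (extChartAt I p).left_inv hq]
  have hq2 : q ∈ (chartAt H p).source := by simpa using hq
  have hq3 : q ∈ (trivializationAt E (TangentSpace I) p).baseSet := by
    rwa [TangentBundle.trivializationAt_baseSet]
  simp only [hom_trivializationAt_apply, ContinuousLinearMap.inCoordinates,
    ContinuousLinearMap.comp_apply, Trivialization.continuousLinearMapAt_apply]
  rw [Trivialization.coe_linearMapAt_of_mem _ (by
    rw [hom_trivializationAt_baseSet]; exact ⟨hq3, by simp⟩)]
  simp only [hom_trivializationAt_apply, ContinuousLinearMap.inCoordinates,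
    ContinuousLinearMap.comp_apply, Trivialization.symmL_apply _ hq3]
  simp

theorem mfderiv_extChartAt_eq_inverse (p : N) {q : N} (hq : q ∈ (extChartAt I p).source)
    (u : TangentSpace I q) :
    (paramDeriv I (extChartAt I p).symm (extChartAt I p q)
      (mfderiv I 𝓘(ℝ, E) (extChartAt I p) q u) : E) = u := by
  have := mfderivWithin_extChartAt_symm_comp_mfderiv_extChartAt' (I := I) hq
  rw [I.range_eq_univ, mfderivWithin_univ] at this
  exact congrArg (fun L : E →L[ℝ] E ↦ L u) this

theorem bilinearField_eq_pullbackMetric (G : BilinearField I N) (p : N) {q : N}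
    (hq : q ∈ (extChartAt I p).source) (u v : TangentSpace I q) :
    G q u v = pullbackMetric G (extChartAt I p).symm (extChartAt I p q)
      (mfderiv I 𝓘(ℝ, E) (extChartAt I p) q u) (mfderiv I 𝓘(ℝ, E) (extChartAt I p) q v) := by
  have key : ∀ (q q' : N) (a a' b b' : E), q = q' → a = a' → b = b' →
      G q (a : TangentSpace I q) (b : TangentSpace I q) =
        G q' (a' : TangentSpace I q') (b' : TangentSpace I q') := by
    rintro _ _ _ _ _ _ rfl rfl rfl; rfl
  exact key _ _ _ _ _ _ ((extChartAt I p).left_inv hq).symm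
    (mfderiv_extChartAt_eq_inverse p hq u).symm (mfderiv_extChartAt_eq_inverse p hq v).symm

theorem isRiemannianMetric_of_coord (G : BilinearField I N)
    (hsymm : ∀ x u v, G x u v = G x v u) (hpos : ∀ x u, u ≠ 0 → 0 < G x u u)
    (hG : ∀ p : N, ContDiffAt ℝ ∞ (pullbackMetric G (extChartAt I p).symm) (extChartAt I p p)) :
    IsRiemannianMetric G := by
  refine ⟨⟨G, hsymm, hpos, fun x ↦ ?_, fun p ↦ contMDiffAt_bilinearField G p (hG p)⟩,
    fun _ ↦ rfl⟩
  obtain ⟨c, hc, h⟩ := exists_pos_mul_sq_le (E := E) (b := G x) (hpos x)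
  change Bornology.IsVonNBounded ℝ {v : E | (G x : E →L[ℝ] E →L[ℝ] ℝ) v v < 1}
  rw [NormedSpace.isVonNBounded_iff, isBounded_iff_forall_norm_le]
  refine ⟨c⁻¹ + 1, fun v hv ↦ ?_⟩
  have h2 : c * ‖v‖ ^ 2 < 1 := (h v).trans_lt hv
  have h3 : ‖v‖ ^ 2 < c⁻¹ := by rwa [← one_div, lt_div_iff₀' hc]
  nlinarith [sq_nonneg (‖v‖ - 1)]

end

section

variable {EM : Type*} [NormedAddCommGroup EM] [NormedSpace ℝ EM] [FiniteDimensional ℝ EM]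
  {H : Type*} [TopologicalSpace H] {I : ModelWithCorners ℝ EM H}
  {M : Type*} [TopologicalSpace M] [ChartedSpace H M] [I.Boundaryless] [IsManifold I ∞ M]
  [T2Space M]
  {F : Type*} [NormedAddCommGroup F] [NormedSpace ℝ F] [FiniteDimensional ℝ F]
  {ξ : M → Type*} [TopologicalSpace (TotalSpace F ξ)]
  [∀ p, NormedAddCommGroup (ξ p)] [∀ p, InnerProductSpace ℝ (ξ p)]
  [FiberBundle F ξ] [VectorBundle ℝ F ξ] [ContMDiffVectorBundle ∞ F ξ I]
  [IsContMDiffRiemannianBundle I ∞ F ξ]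
  (g : ContMDiffRiemannianMetric I ∞ EM (fun p : M ↦ TangentSpace I p))
  (D : CovariantDerivative I F ξ)

theorem fst_extChartAt_mem_coordDomain (x₀ : TotalSpace F ξ) {x : TotalSpace F ξ}
    (hx : x ∈ (extChartAt (I.prod 𝓘(ℝ, F)) x₀).source) :
    (extChartAt (I.prod 𝓘(ℝ, F)) x₀ x).1 ∈ coordDomain I F ξ x₀.proj := by
  have := (extChartAt (I.prod 𝓘(ℝ, F)) x₀).map_source hx
  rw [extChartAt_totalSpace_target] at this
  exact this.1

theorem isMetricOn_connectionMetric (hD : CovariantDerivative.ContMDiffCovariantDerivative D ∞)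
    (hDmetric : D.IsMetricCompatible) (x₀ : TotalSpace F ξ) :
    IsMetricOn (pullbackMetric (connectionMetric g.inner D)
      (extChartAt (I.prod 𝓘(ℝ, F)) x₀).symm) (coordDomain I F ξ x₀.proj ×ˢ univ) := by
  have h := (isConnectionData_coord g D hD hDmetric x₀.proj).isMetricOn
  have he : ∀ y ∈ coordDomain I F ξ x₀.proj ×ˢ (univ : Set F), _ = _ := fun y hy ↦
    pullbackMetric_connectionMetric g.inner D x₀ hy.1
  exact ⟨h.isOpen, h.contDiffOn.congr he, fun y hy ↦ by rw [he y hy]; exact h.symm y hy,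
    fun y hy ↦ by rw [he y hy]; exact h.pos y hy⟩

theorem isRiemannianMetric_connectionMetric
    (hD : CovariantDerivative.ContMDiffCovariantDerivative D ∞)
    (hDmetric : D.IsMetricCompatible) : IsRiemannianMetric (connectionMetric g.inner D) := by
  refine isRiemannianMetric_of_coord _ (fun x u v ↦ ?_) (fun x u hu ↦ ?_) fun x ↦ ?_
  · rw [connectionMetric_apply, connectionMetric_apply, g.symm, real_inner_comm]
  · rw [bilinearField_eq_pullbackMetric _ x (mem_extChartAt_source x)]
    refine (isMetricOn_connectionMetric g D hD hDmetric x).pos _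
      ⟨fst_extChartAt_mem_coordDomain x (mem_extChartAt_source x), mem_univ _⟩ _ fun h ↦ hu ?_
    exact (isInvertible_mfderiv_extChartAt (mem_extChartAt_source x)).injective
      (h.trans (map_zero _).symm)
  · have h := isMetricOn_connectionMetric g D hD hDmetric x
    exact h.contDiffAt ⟨fst_extChartAt_mem_coordDomain x (mem_extChartAt_source x), mem_univ _⟩

end

end

/-! ### Completeness from a proper function -/

noncomputable section

set_option linter.unusedSectionVars false

section

variable {E : Type*} [NormedAddCommGroup E] [NormedSpace ℝ E]
  {H : Type*} [TopologicalSpace H] {I : ModelWithCorners ℝ E H}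
  {N : Type*} [TopologicalSpace N] [ChartedSpace H N] [IsManifold I ∞ N]

theorem metricEDist_eq_riemannianEDist
    (g : ContMDiffRiemannianMetric I ∞ E (fun x : N ↦ TangentSpace I x)) (x y : N) :
    letI : RiemannianBundle (fun x : N ↦ TangentSpace I x) := ⟨g.toRiemannianMetric⟩
    metricEDist g.inner x y = riemannianEDist I x y := by
  let : RiemannianBundle (fun x : N ↦ TangentSpace I x) := ⟨g.toRiemannianMetric⟩
  have h : (fun z : N ↦ (⟨fun v ↦ ENNReal.ofReal (Real.sqrt (g.inner z v v))⟩ :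
      ENorm (TangentSpace I z))) = fun z ↦ (inferInstance : ENorm (TangentSpace I z)) := by
    funext z
    congr 1
    funext v
    change _ = ‖v‖ₑ
    rw [← ofReal_norm, norm_eq_sqrt_real_inner]
    rfl
  unfold metricEDist
  rw [h]

/-- Integrate the derivative of `h` along a C¹ path: a differential of norm at most one makes `h`
1-Lipschitz for the Riemannian distance. -/
theorem edist_le_metricEDist
    (g : ContMDiffRiemannianMetric I ∞ E (fun x : N ↦ TangentSpace I x)) {h : N → ℝ}
    (hh : ContMDiff I 𝓘(ℝ, ℝ) 1 h)
    (hd : ∀ x (u : TangentSpace I x), |mvfderiv I h x u| ≤ Real.sqrt (g.inner x u u)) (x y : N) :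
    ‖h y - h x‖ₑ ≤ metricEDist g.inner x y := by
  let : RiemannianBundle (fun x : N ↦ TangentSpace I x) := ⟨g.toRiemannianMetric⟩
  rw [metricEDist_eq_riemannianEDist]
  refine le_of_forall_gt fun r hr ↦ ?_
  obtain ⟨γ, rfl, rfl, hγ, hlen, -⟩ :=
    exists_lt_locally_constant_of_riemannianEDist_lt hr zero_lt_one
  refine lt_of_le_of_lt ?_ hlen
  have h1 : ContDiff ℝ 1 (h ∘ γ) := contMDiff_iff_contDiff.1 (hh.comp hγ)
  refine (enorm_sub_le_lintegral_deriv_of_contDiffOn_Icc h1.contDiffOn zero_le_one).trans ?_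
  rw [pathELength_eq_lintegral_mfderiv_Icc]
  refine MeasureTheory.lintegral_mono fun t ↦ ?_
  have h2 : deriv (h ∘ γ) t = mvfderiv I h (γ t) (mfderiv 𝓘(ℝ, ℝ) I γ t (1 : ℝ)) := by
    rw [← fderiv_apply_one_eq_deriv]
    exact (mvfderiv_paramDeriv (hh.mdifferentiable one_ne_zero _)
      (hγ.mdifferentiable one_ne_zero t) (1 : ℝ)).symm
  rw [h2, ← ofReal_norm, ← ofReal_norm, Real.norm_eq_abs]
  refine ENNReal.ofReal_le_ofReal ((hd _ _).trans_eq ?_)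
  rw [norm_eq_sqrt_real_inner]
  rfl

/-- A Riemannian metric is complete if there is a proper function whose gradient has norm at
most one. -/
theorem isCompleteMetric_of_proper (G : BilinearField I N) (hG : IsRiemannianMetric G) {h : N → ℝ}
    (hh : ContMDiff I 𝓘(ℝ, ℝ) 1 h)
    (hd : ∀ x (u : TangentSpace I x), |mvfderiv I h x u| ≤ Real.sqrt (G x u u))
    (hK : ∀ C : ℝ, IsCompact {x | h x ≤ C}) : IsCompleteMetric G := by
  obtain ⟨g, hg⟩ := hG
  obtain rfl : g.inner = G := funext hg
  let : RiemannianBundle (fun x : N ↦ TangentSpace I x) := ⟨g.toRiemannianMetric⟩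
  have : IsContinuousRiemannianBundle E (fun x : N ↦ TangentSpace I x) :=
    ⟨⟨g.inner, g.contMDiff.continuous, fun _ _ _ ↦ rfl⟩⟩
  have hcomm : ∀ x y, metricEDist g.inner x y = metricEDist g.inner y x := fun x y ↦ by
    rw [metricEDist_eq_riemannianEDist, metricEDist_eq_riemannianEDist, riemannianEDist_comm]
  intro x hx
  obtain ⟨k₁, hk₁⟩ := hx 1 one_pos
  -- A Cauchy sequence stays within distance 1 of one of its terms from some index on, so the
  -- Lipschitz function is bounded on the tail and the tail lies in a compact sublevel set.
  have hmem : ∀ k ≥ k₁, x k ∈ {z | h z ≤ h (x k₁) + 1} := fun k hk ↦ by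
    have h1 := (edist_le_metricEDist g hh hd (x k₁) (x k)).trans_lt (hk₁ k₁ le_rfl k hk)
    rw [← ofReal_norm, ENNReal.ofReal_lt_one, Real.norm_eq_abs, abs_lt] at h1
    simp only [Set.mem_ofPred_eq]
    linarith [h1.2]
  obtain ⟨z, -, hz⟩ := (hK (h (x k₁) + 1)).exists_mapClusterPt (f := atTop) (u := x)
    (by simpa using (eventually_ge_atTop k₁).mono hmem)
  refine ⟨z, ?_⟩
  rw [ENNReal.tendsto_nhds_zero]
  intro ε hε
  have hε2 : 0 < ε / 2 := ENNReal.half_pos hε.ne'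
  obtain ⟨k₀, hk₀⟩ := hx (ε / 2) hε2
  filter_upwards [eventually_ge_atTop k₀] with k hk
  have h2 : ∀ᶠ y in 𝓝 z, metricEDist g.inner z y < ε / 2 := by
    simp only [metricEDist_eq_riemannianEDist]
    exact eventually_riemannianEDist_lt I z hε2
  obtain ⟨l, hl, hlz⟩ := ((hz.frequently h2).and_eventually (eventually_ge_atTop k₀)).exists
  calc metricEDist g.inner (x k) z
      ≤ metricEDist g.inner (x k) (x l) + metricEDist g.inner (x l) z := by
        simp only [metricEDist_eq_riemannianEDist]
        exact riemannianEDist_triangle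
    _ ≤ ε / 2 + ε / 2 := by
        gcongr
        · exact (hk₀ k hk l hlz).le
        · rw [hcomm]; exact hl.le
    _ = ε := ENNReal.add_halves ε

end

end

/-! ### The fibre norm: properness, connectedness and completeness of the total space -/

noncomputable section

set_option maxSynthPendingDepth 3
set_option linter.unusedSectionVars false

section

variable {EM : Type*} [NormedAddCommGroup EM] [NormedSpace ℝ EM] [FiniteDimensional ℝ EM]
  {H : Type*} [TopologicalSpace H] {I : ModelWithCorners ℝ EM H}
  {M : Type*} [TopologicalSpace M] [ChartedSpace H M] [I.Boundaryless] [IsManifold I ∞ M]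
  {F : Type*} [NormedAddCommGroup F] [NormedSpace ℝ F] [FiniteDimensional ℝ F]
  {ξ : M → Type*} [TopologicalSpace (TotalSpace F ξ)]
  [∀ p, NormedAddCommGroup (ξ p)] [∀ p, InnerProductSpace ℝ (ξ p)]
  [FiberBundle F ξ] [VectorBundle ℝ F ξ] [ContMDiffVectorBundle ∞ F ξ I]
  [IsContMDiffRiemannianBundle I ∞ F ξ]

variable (I F ξ) in
theorem contMDiff_fiberNormSq : ContMDiff (I.prod 𝓘(ℝ, F)) 𝓘(ℝ, ℝ) ∞ (fiberNormSq F ξ) :=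
  ContMDiff.inner_bundle (IB := I) (F := F) (b := (TotalSpace.proj : TotalSpace F ξ → M))
    (v := fun z ↦ z.snd) (w := fun z ↦ z.snd) contMDiff_id contMDiff_id

theorem fiberNormSq_eq_norm_sq (x : TotalSpace F ξ) : fiberNormSq F ξ x = ‖x.snd‖ ^ 2 :=
  real_inner_self_eq_norm_sq _

theorem fiberNormSq_param (x₀ : TotalSpace F ξ) {y : EM × F}
    (hy : y.1 ∈ coordDomain I F ξ x₀.proj) :
    fiberNormSq F ξ ((extChartAt (I.prod 𝓘(ℝ, F)) x₀).symm y) =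
      fiberMetricCoord I F ξ x₀.proj y.1 y.2 y.2 := by
  rw [extChartAt_totalSpace_symm x₀ hy, fiberMetricCoord_eq _ hy]
  rfl

theorem fiberNormSq_comp_param_eventuallyEq (x₀ : TotalSpace F ξ) {y : EM × F}
    (hy : y.1 ∈ coordDomain I F ξ x₀.proj) :
    fiberNormSq F ξ ∘ (extChartAt (I.prod 𝓘(ℝ, F)) x₀).symm =ᶠ[𝓝 y]
      fun z ↦ fiberMetricCoord I F ξ x₀.proj z.1 z.2 z.2 := by
  filter_upwards [continuous_fst.continuousAt.eventually
      ((isOpen_coordDomain (I := I) (F := F) (ξ := ξ) x₀.proj).mem_nhds hy)] with y' hy'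
  exact fiberNormSq_param x₀ hy'

/-- Trivializations have locally bounded norm, so over a small compact set a disc bundle lies in the
image of a compact set times a closed ball. Finitely many such sets cover M. -/
theorem isCompact_fiberNormSq_le [CompactSpace M] [LocallyCompactSpace M]
    [IsContinuousRiemannianBundle F ξ] (hcont : Continuous (fiberNormSq F ξ)) (c : ℝ) :
    IsCompact {x : TotalSpace F ξ | fiberNormSq F ξ x ≤ c} := by
  have key : ∀ p : M, ∃ K ∈ 𝓝 p,
      ∃ T : Set (TotalSpace F ξ), IsCompact T ∧
        ∀ x, x.proj ∈ K → fiberNormSq F ξ x ≤ c → x ∈ T := by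
    intro p
    set e := trivializationAt F ξ p with he
    obtain ⟨C, hC, hev⟩ := eventually_norm_trivializationAt_lt F ξ p
    obtain ⟨K, hK, hKs, hKc⟩ := local_compact_nhds
      (inter_mem hev (e.open_baseSet.mem_nhds (mem_baseSet_trivializationAt F ξ p)))
    refine ⟨K, hK, e.toOpenPartialHomeomorph.symm '' (K ×ˢ Metric.closedBall 0 (C * √c)), ?_, ?_⟩
    · refine (hKc.prod (isCompact_closedBall _ _)).image_of_continuousOn
        (e.toOpenPartialHomeomorph.continuousOn_symm.mono ?_)
      intro y hy
      exact e.mem_target.2 (hKs hy.1).2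
    · intro x hx hfx
      have hxs : x ∈ e.source := e.mem_source.2 (hKs hx).2
      refine ⟨e x, ⟨by rwa [e.coe_fst hxs], ?_⟩, e.toOpenPartialHomeomorph.left_inv hxs⟩
      have h1 : (e x).2 = e.continuousLinearMapAt ℝ x.proj x.snd :=
        (continuousLinearMapAt_eq_of_mem e (hKs hx).2 x.snd).symm
      rw [mem_closedBall_zero_iff, h1]
      refine (ContinuousLinearMap.le_opNorm _ _).trans ?_
      have h2 : ‖x.snd‖ ≤ √c := by
        rw [fiberNormSq_eq_norm_sq] at hfx
        exact Real.le_sqrt_of_sq_le hfx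
      exact mul_le_mul (hKs hx).1.le h2 (norm_nonneg _) hC.le
  choose K hK T hT hsub using key
  obtain ⟨t, ht⟩ := CompactSpace.elim_nhds_subcover K hK
  refine (t.isCompact_biUnion fun p _ ↦ hT p).of_isClosed_subset
    (isClosed_le hcont continuous_const) fun x hx ↦ ?_
  have h1 : x.proj ∈ ⋃ p ∈ t, K p := by rw [ht]; trivial
  simp only [mem_iUnion] at h1 ⊢
  obtain ⟨p, hp, hxp⟩ := h1
  exact ⟨p, hp, hsub p x hxp hx⟩

/-- Every point is joined to the connected zero section by its fibre, which is itself connected. -/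
theorem connectedSpace_totalSpace [ConnectedSpace M] : ConnectedSpace (TotalSpace F ξ) := by
  have hz : Continuous (zeroSection F ξ) := Trivialization.continuous_zeroSection ℝ
  obtain ⟨p₀⟩ := (inferInstance : Nonempty M)
  have : Nonempty (TotalSpace F ξ) := ⟨zeroSection F ξ p₀⟩
  have hpre : IsPreconnected (univ : Set (TotalSpace F ξ)) := by
    refine isPreconnected_of_forall (zeroSection F ξ p₀) fun x _ ↦
      ⟨range (zeroSection F ξ) ∪ range (TotalSpace.mk x.proj), subset_univ _,
        Or.inl ⟨p₀, rfl⟩, Or.inr ⟨x.snd, rfl⟩, ?_⟩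
    refine IsPreconnected.union (zeroSection F ξ x.proj) ⟨x.proj, rfl⟩ ⟨0, rfl⟩
      (isPreconnected_range hz) (isPreconnected_range ?_)
    exact FiberBundle.continuous_totalSpaceMk F ξ x.proj
  exact { isPreconnected_univ := hpre, toNonempty := this }

variable [T2Space M]
  (g : ContMDiffRiemannianMetric I ∞ EM (fun p : M ↦ TangentSpace I p))
  (D : CovariantDerivative I F ξ)

/-- By Cauchy–Schwarz, k(v, Ku)² / (1 + k(v, v)) ≤ k(Ku, Ku). The 1 under the root keeps the
function differentiable on the zero section. -/
theorem abs_mvfderiv_sqrt_fiberNormSq_le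
    (hD : CovariantDerivative.ContMDiffCovariantDerivative D ∞)
    (hDmetric : D.IsMetricCompatible) (x : TotalSpace F ξ)
    (u : TangentSpace (I.prod 𝓘(ℝ, F)) x) :
    |mvfderiv (I.prod 𝓘(ℝ, F)) (fun z : TotalSpace F ξ ↦ √(1 + fiberNormSq F ξ z)) x u| ≤
      √(connectionMetric g.inner D x u u) := by
  have h := isConnectionData_coord g D hD hDmetric x.proj
  set y := extChartAt (I.prod 𝓘(ℝ, F)) x x with hy
  set w : EM × F := mfderiv (I.prod 𝓘(ℝ, F)) 𝓘(ℝ, EM × F) (extChartAt (I.prod 𝓘(ℝ, F)) x) x u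
    with hw
  set k := fiberMetricCoord I F ξ x.proj with hk
  have hyΩ : y.1 ∈ coordDomain I F ξ x.proj :=
    fst_extChartAt_mem_coordDomain x (mem_extChartAt_source x)
  have hnn : ∀ x b, 0 ≤ k x b b := fun x b ↦ real_inner_self_nonneg
  have hf := h.hasFDerivAt_fiberNorm hyΩ
  have hs : HasFDerivAt (fun z : EM × F ↦ √(1 + k z.1 z.2 z.2)) _ y :=
    (hf.const_add 1).sqrt (by have := hnn y.1 y.2; positivity)
  rw [mvfderiv_eq_fderiv_extChartAt hs.differentiableAt, hs.fderiv,
    bilinearField_eq_pullbackMetric _ x (mem_extChartAt_source x)]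
  · change |(1 / (2 * √(1 + k y.1 y.2 y.2))) * (2 * k y.1 y.2 (localConnector _ y w))| ≤
      √(pullbackMetric (connectionMetric g.inner D) (extChartAt (I.prod 𝓘(ℝ, F)) x).symm y w w)
    rw [pullbackMetric_connectionMetric _ _ _ hyΩ, localMetric_apply]
    set K := localConnector (connectionFormCoord D x.proj) y w with hK
    have hgn : 0 ≤ pullbackMetric g.inner (extChartAt I x.proj).symm y.1 w.1 w.1 := by
      rcases eq_or_ne w.1 0 with h0 | h0
      · simp [h0]
      · exact (h.base.pos y.1 hyΩ _ h0).le
    have hCS : k y.1 y.2 K * k y.1 y.2 K ≤ k y.1 y.2 y.2 * k y.1 K K :=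
      real_inner_mul_inner_self_le _ _
    refine Real.le_sqrt_of_sq_le ?_
    rw [sq_abs]
    have h1 : 0 < 1 + k y.1 y.2 y.2 := by linarith [hnn y.1 y.2]
    have h2 : (1 / (2 * √(1 + k y.1 y.2 y.2)) * (2 * k y.1 y.2 K)) ^ 2 =
        (k y.1 y.2 K * k y.1 y.2 K) / (1 + k y.1 y.2 y.2) := by
      rw [mul_pow, div_pow, mul_pow, Real.sq_sqrt h1.le]
      field_simp
    rw [h2, div_le_iff₀ h1]
    nlinarith [hnn y.1 K, hnn y.1 y.2, mul_nonneg hgn h1.le]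
  · filter_upwards [fiberNormSq_comp_param_eventuallyEq x hyΩ] with z hz
    simp only [Function.comp_apply] at hz ⊢
    rw [hz]

theorem isCompleteMetric_connectionMetric [CompactSpace M]
    (hD : CovariantDerivative.ContMDiffCovariantDerivative D ∞)
    (hDmetric : D.IsMetricCompatible) : IsCompleteMetric (connectionMetric g.inner D) := by
  have hnn : ∀ x, 0 ≤ fiberNormSq F ξ x := fun x ↦ real_inner_self_nonneg
  refine isCompleteMetric_of_proper _ (isRiemannianMetric_connectionMetric g D hD hDmetric)
    (h := fun z : TotalSpace F ξ ↦ √(1 + fiberNormSq F ξ z)) ?_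
    (abs_mvfderiv_sqrt_fiberNormSq_le g D hD hDmetric) fun C ↦ ?_
  · intro x
    have h1 : ContMDiffAt 𝓘(ℝ, ℝ) 𝓘(ℝ, ℝ) 1 (fun t ↦ √(1 + t)) (fiberNormSq F ξ x) := by
      rw [contMDiffAt_iff_contDiffAt]
      exact (contDiffAt_const.add contDiffAt_id).sqrt (by have := hnn x; simp only [id]; positivity)
    exact h1.comp x ((contMDiff_fiberNormSq I F ξ).of_le (by simp) x)
  · have hlc : LocallyCompactSpace M := Manifold.locallyCompact_of_finiteDimensional I
    have hcr : IsContinuousRiemannianBundle F ξ :=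
      let ⟨γ, hγ, hi⟩ := IsContMDiffRiemannianBundle.exists_contMDiff (IB := I) (n := ∞) (F := F)
        (E := ξ)
      ⟨⟨γ, hγ.continuous, hi⟩⟩
    refine (isCompact_fiberNormSq_le (contMDiff_fiberNormSq I F ξ).continuous (C ^ 2 - 1)).of_isClosed_subset ?_ ?_
    · exact isClosed_le ((continuous_const.add (contMDiff_fiberNormSq I F ξ).continuous).sqrt)
        continuous_const
    · intro x hx
      have hx' : √(1 + fiberNormSq F ξ x) ≤ C := hx
      have h2 : 1 + fiberNormSq F ξ x ≤ C ^ 2 := by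
        rw [← Real.sq_sqrt (by have := hnn x; positivity : 0 ≤ 1 + fiberNormSq F ξ x)]
        exact pow_le_pow_left₀ (Real.sqrt_nonneg _) hx' 2
      change fiberNormSq F ξ x ≤ C ^ 2 - 1
      linarith

end

end

/-! ### Positive Ricci curvature of small sphere bundles -/

noncomputable section

set_option maxSynthPendingDepth 3
set_option linter.unusedSectionVars false

section

/-- A left inverse continuous at the image points recovers the topology, so no openness of the image
is required. -/
theorem isEmbedding_domRestrict_of_leftInverse {X Y : Type*} [TopologicalSpace X]
    [TopologicalSpace Y] {f : X → Y} {g : Y → X} {U : Set X} (hf : ContinuousOn f U)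
    (hgf : ∀ x ∈ U, g (f x) = x) (hg : ∀ x ∈ U, ContinuousAt g (f x)) :
    IsEmbedding (U.domRestrict f) := by
  refine ⟨isInducing_iff_nhds.2 fun x ↦ le_antisymm ?_ ?_, fun x y hxy ↦ ?_⟩
  · exact (continuousOn_iff_continuous_domRestrict.1 hf).continuousAt.le_comap
  · rw [nhds_subtype, ← tendsto_iff_comap]
    have h1 : Tendsto g (𝓝 (f x)) (𝓝 (x : X)) := by
      have := hg x x.2
      rwa [ContinuousAt, hgf x x.2] at this
    refine (h1.comp (tendsto_comap (f := U.domRestrict f))).congr fun z ↦ ?_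
    exact hgf z z.2
  · have h1 : f x = f y := hxy
    exact Subtype.ext (by rw [← hgf x x.2, h1, hgf y y.2])

theorem isLocalParametrization_extChartAt_symm {d : ℕ} {N : Type*} [TopologicalSpace N]
    [ChartedSpace (EuclideanSpace ℝ (Fin d)) N] [IsManifold (𝓡 d) ∞ N] (p : N) :
    IsLocalParametrization (𝓡 d) d (univ : Set N) (extChartAt (𝓡 d) p).target
      (extChartAt (𝓡 d) p).symm where
  isOpen := isOpen_extChartAt_target p
  smooth := contMDiffOn_extChartAt_symm p
  immersion y hy := (isInvertible_paramDeriv_extChartAt_symm hy).injective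
  embedding := isEmbedding_domRestrict_of_leftInverse (continuousOn_extChartAt_symm p)
    (fun x hx ↦ (extChartAt (𝓡 d) p).right_inv hx)
    (fun x hx ↦ continuousAt_extChartAt' ((extChartAt (𝓡 d) p).map_target hx))
  image_open := ⟨(extChartAt (𝓡 d) p).source, isOpen_extChartAt_source p, by
    rw [inter_univ, (extChartAt (𝓡 d) p).symm_image_target_eq_source]⟩

end

section

variable {EM : Type*} [NormedAddCommGroup EM] [NormedSpace ℝ EM] [FiniteDimensional ℝ EM]
  {H : Type*} [TopologicalSpace H] {I : ModelWithCorners ℝ EM H}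
  {M : Type*} [TopologicalSpace M] [ChartedSpace H M] [I.Boundaryless] [IsManifold I ∞ M]
  [T2Space M]
  {F : Type*} [NormedAddCommGroup F] [NormedSpace ℝ F] [FiniteDimensional ℝ F]
  {ξ : M → Type*} [TopologicalSpace (TotalSpace F ξ)]
  [∀ p, NormedAddCommGroup (ξ p)] [∀ p, InnerProductSpace ℝ (ξ p)]
  [FiberBundle F ξ] [VectorBundle ℝ F ξ] [ContMDiffVectorBundle ∞ F ξ I]
  [IsContMDiffRiemannianBundle I ∞ F ξ]
  (g : ContMDiffRiemannianMetric I ∞ EM (fun p : M ↦ TangentSpace I p))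
  (D : CovariantDerivative I F ξ)

/-- Transfers `ricci_inducedMetric` to an arbitrary parametrization of the sphere bundle. The vector
`w` is the image of `u` under the differential of χ ∘ φ, nonzero because φ is an immersion. -/
theorem ricci_pullbackMetric_connectionMetric
    (hD : CovariantDerivative.ContMDiffCovariantDerivative D ∞) (hDmetric : D.IsMetricCompatible)
    (x₀ : TotalSpace F ξ) {d : ℕ} {U : Set (EuclideanSpace ℝ (Fin d))}
    {φ : EuclideanSpace ℝ (Fin d) → TotalSpace F ξ} {r : ℝ} (hr : 0 < r)
    (hφ : IsLocalParametrization (I.prod 𝓘(ℝ, F)) d (sphereBundle F ξ r) U φ)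
    (hdim : d + 1 = Module.finrank ℝ (EM × F)) {y : EuclideanSpace ℝ (Fin d)} (hy : y ∈ U)
    (hyx : φ y ∈ (extChartAt (I.prod 𝓘(ℝ, F)) x₀).source) {u : EuclideanSpace ℝ (Fin d)}
    (hu : u ≠ 0) :
    ∃ w ≠ 0, ricci (pullbackMetric (connectionMetric g.inner D) φ) y u u =
      ricci (localMetric (pullbackMetric g.inner (extChartAt I x₀.proj).symm)
        (fiberMetricCoord I F ξ x₀.proj) (connectionFormCoord D x₀.proj))
        (extChartAt (I.prod 𝓘(ℝ, F)) x₀ (φ y)) w w +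
      (Module.finrank ℝ F - 2) / r ^ 2 * fiberMetricCoord I F ξ x₀.proj
        (extChartAt (I.prod 𝓘(ℝ, F)) x₀ (φ y)).1
        (localConnector (connectionFormCoord D x₀.proj)
          (extChartAt (I.prod 𝓘(ℝ, F)) x₀ (φ y)) w)
        (localConnector (connectionFormCoord D x₀.proj)
          (extChartAt (I.prod 𝓘(ℝ, F)) x₀ (φ y)) w) := by
  have h := isConnectionData_coord g D hD hDmetric x₀.proj
  set χ := extChartAt (I.prod 𝓘(ℝ, F)) x₀ with hχ
  set φ' : EuclideanSpace ℝ (Fin d) → EM × F := χ ∘ φ with hφ'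
  set U' := U ∩ φ ⁻¹' χ.source with hU'
  have hU'o : IsOpen U' :=
    hφ.smooth.continuousOn.isOpen_inter_preimage hφ.isOpen (isOpen_extChartAt_source x₀)
  have hyU' : y ∈ U' := ⟨hy, hyx⟩
  have hmaps : ∀ z ∈ U', (φ' z).1 ∈ coordDomain I F ξ x₀.proj := fun z hz ↦
    fst_extChartAt_mem_coordDomain x₀ hz.2
  have hsrc : ∀ z ∈ U', φ z ∈ (chartAt (ModelProd H F) x₀).source := fun z hz ↦ by
    have := hz.2
    rwa [mem_preimage, hχ, extChartAt_source] at this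
  have hsm : ContDiffOn ℝ ∞ φ' U' := by
    rw [← contMDiffOn_iff_contDiffOn]
    exact (contMDiffOn_extChartAt (I := I.prod 𝓘(ℝ, F)) (x := x₀)).comp
      (hφ.smooth.mono inter_subset_left) hsrc
  have hinj : ∀ z ∈ U', Function.Injective (fderiv ℝ φ' z) := by
    intro z hz
    have h1 : fderiv ℝ φ' z = (mfderiv (I.prod 𝓘(ℝ, F)) 𝓘(ℝ, EM × F) χ (φ z) :
        EM × F →L[ℝ] EM × F) ∘L (paramDeriv (I.prod 𝓘(ℝ, F)) φ z :
          EuclideanSpace ℝ (Fin d) →L[ℝ] EM × F) := by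
      rw [← mfderiv_eq_fderiv, hφ']
      exact mfderiv_comp z (mdifferentiableAt_extChartAt (hsrc z hz))
        ((hφ.smooth.contMDiffAt (hφ.isOpen.mem_nhds hz.1)).mdifferentiableAt (by simp))
    rw [h1]
    exact (isInvertible_mfderiv_extChartAt hz.2).injective.comp (hφ.immersion z hz.1)
  have hsph : ∀ z ∈ U', fiberMetricCoord I F ξ x₀.proj (φ' z).1 (φ' z).2 (φ' z).2 = r ^ 2 := by
    intro z hz
    rw [← fiberNormSq_param x₀ (hmaps z hz), ← hχ, hφ', Function.comp_apply, χ.left_inv hz.2]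
    obtain ⟨O, -, hO⟩ := hφ.image_open
    exact (hO.subset (mem_image_of_mem φ hz.1)).2
  have hcongr : pullbackMetric (connectionMetric g.inner D) φ =ᶠ[𝓝 y] inducedMetric
      (localMetric (pullbackMetric g.inner (extChartAt I x₀.proj).symm)
        (fiberMetricCoord I F ξ x₀.proj) (connectionFormCoord D x₀.proj)) φ' := by
    refine (pullbackMetric_eventuallyEq_inducedMetric (connectionMetric g.inner D) (x := x₀)
      hφ.isOpen (hφ.smooth.of_le (by simp)) hy hyx).trans ?_
    filter_upwards [hU'o.mem_nhds hyU'] with z hz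
    simp only [inducedMetric]
    rw [← hχ, ← hφ', hχ, pullbackMetric_connectionMetric g.inner D x₀ (hmaps z hz)]
  refine ⟨fderiv ℝ φ' y u, fun h0 ↦ hu (hinj y hyU' (h0.trans (map_zero _).symm)), ?_⟩
  rw [ricci_congr hcongr, h.ricci_inducedMetric hU'o hsm hmaps hinj hr hsph (by simpa using hdim)
    hyU' u]
  rfl

/-- Near each p, a small radius brings the sphere bundle close to the zero section and at the same
time makes (n - 2)/r² large, because n ≥ 3. Compactness of M leaves finitely many conditions on r.
-/
theorem exists_forall_sphereBundle_pos [CompactSpace M]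
    (hD : CovariantDerivative.ContMDiffCovariantDerivative D ∞) (hDmetric : D.IsMetricCompatible)
    (hpos : ∀ p : M, ∀ a : EM, a ≠ 0 →
      0 < ricci (pullbackMetric g.inner (extChartAt I p).symm) (extChartAt I p p) a a)
    (hn : 3 ≤ Module.finrank ℝ F) :
    ∃ r₀ : ℝ, 0 < r₀ ∧ ∀ r : ℝ, 0 < r → r < r₀ → ∀ x ∈ sphereBundle F ξ r,
      ∃ x₀ : TotalSpace F ξ, x ∈ (extChartAt (I.prod 𝓘(ℝ, F)) x₀).source ∧ ∀ w ≠ 0,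
      0 < ricci (localMetric (pullbackMetric g.inner (extChartAt I x₀.proj).symm)
        (fiberMetricCoord I F ξ x₀.proj) (connectionFormCoord D x₀.proj))
        (extChartAt (I.prod 𝓘(ℝ, F)) x₀ x) w w +
      (Module.finrank ℝ F - 2) / r ^ 2 * fiberMetricCoord I F ξ x₀.proj
        (extChartAt (I.prod 𝓘(ℝ, F)) x₀ x).1
        (localConnector (connectionFormCoord D x₀.proj) (extChartAt (I.prod 𝓘(ℝ, F)) x₀ x) w)
        (localConnector (connectionFormCoord D x₀.proj)
          (extChartAt (I.prod 𝓘(ℝ, F)) x₀ x) w) := by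
  have hcr : IsContinuousRiemannianBundle F ξ :=
    let ⟨γ, hγ, hi⟩ := IsContMDiffRiemannianBundle.exists_contMDiff (IB := I) (n := ∞) (F := F)
      (E := ξ)
    ⟨⟨γ, hγ.continuous, hi⟩⟩
  have key : ∀ p : M, ∃ K ∈ 𝓝 p, ∀ᶠ r in 𝓝[>] (0 : ℝ), ∀ x ∈ sphereBundle F ξ r, x.proj ∈ K →
      x ∈ (extChartAt (I.prod 𝓘(ℝ, F)) (zeroSection F ξ p)).source ∧ ∀ w ≠ 0,
      0 < ricci (localMetric (pullbackMetric g.inner (extChartAt I p).symm)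
        (fiberMetricCoord I F ξ p) (connectionFormCoord D p))
        (extChartAt (I.prod 𝓘(ℝ, F)) (zeroSection F ξ p) x) w w +
      (Module.finrank ℝ F - 2) / r ^ 2 * fiberMetricCoord I F ξ p
        (extChartAt (I.prod 𝓘(ℝ, F)) (zeroSection F ξ p) x).1
        (localConnector (connectionFormCoord D p)
          (extChartAt (I.prod 𝓘(ℝ, F)) (zeroSection F ξ p) x) w)
        (localConnector (connectionFormCoord D p)
          (extChartAt (I.prod 𝓘(ℝ, F)) (zeroSection F ξ p) x) w) := by
    intro p
    have hpd : extChartAt I p p ∈ coordDomain I F ξ p :=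
      extChartAt_mem_coordDomain (mem_extChartAt_source p) (mem_baseSet_trivializationAt F ξ p)
    have hev := (isConnectionData_coord g D hD hDmetric p).eventually_ricci_add_pos hpd (hpos p)
    rw [eventually_prod_iff] at hev
    obtain ⟨P, hP, Q, hQ, hPQ⟩ := hev
    rw [nhds_prod_eq, eventually_prod_iff] at hP
    obtain ⟨P₁, hP₁, P₂, hP₂, hP₁₂⟩ := hP
    obtain ⟨δ, hδ, hball⟩ := Metric.eventually_nhds_iff.1 hP₂
    obtain ⟨C, hC, hnorm⟩ := eventually_norm_trivializationAt_lt F ξ p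
    refine ⟨{q | P₁ (extChartAt I p q)} ∩ ({q | ‖(trivializationAt F ξ p).continuousLinearMapAt ℝ q‖
      < C} ∩ ((trivializationAt F ξ p).baseSet ∩ (extChartAt I p).source)), ?_, ?_⟩
    · exact inter_mem ((continuousAt_extChartAt p).eventually hP₁) (inter_mem hnorm (inter_mem
        ((trivializationAt F ξ p).open_baseSet.mem_nhds (mem_baseSet_trivializationAt F ξ p))
        (extChartAt_source_mem_nhds p)))
    have hn' : (0 : ℝ) < Module.finrank ℝ F - 2 := by
      have : (3 : ℝ) ≤ Module.finrank ℝ F := by exact_mod_cast hn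
      linarith
    have hlim : Tendsto (fun r : ℝ ↦ ((Module.finrank ℝ F : ℝ) - 2) / r ^ 2) (𝓝[>] 0) atTop := by
      have h1 : Tendsto (fun r : ℝ ↦ (r ^ 2)⁻¹) (𝓝[>] 0) atTop := by
        simp_rw [← inv_pow]
        exact (tendsto_pow_atTop two_ne_zero).comp tendsto_inv_nhdsGT_zero
      simpa only [div_eq_mul_inv] using h1.const_mul_atTop hn'
    -- `C` bounds the trivialization over `K`, so a fibre vector of norm r has coordinates of norm
    -- at most C * r.
    have hsmall : ∀ᶠ r in 𝓝[>] (0 : ℝ), C * r < δ := by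
      have : Tendsto (fun r : ℝ ↦ C * r) (𝓝[>] 0) (𝓝 (C * 0)) :=
        (continuous_const_mul C).continuousAt.tendsto.mono_left nhdsWithin_le_nhds
      rw [mul_zero] at this
      exact this.eventually_lt_const hδ
    filter_upwards [hlim.eventually hQ, hsmall, self_mem_nhdsWithin] with r hQr hCr hr x hx hxK
    obtain ⟨hx1, hx2, hx3, hx4⟩ := hxK
    have hchart := extChartAt_totalSpace (I := I) (zeroSection F ξ p) x hx3
    refine ⟨?_, fun w hw ↦ hPQ ?_ hQr w hw⟩
    · rw [FiberBundle.extChartAt, PartialEquiv.trans_source]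
      refine ⟨(Trivialization.mem_source _).2 hx3, ?_⟩
      rw [mem_preimage, PartialEquiv.prod_source]
      refine ⟨?_, mem_univ _⟩
      change (trivializationAt F ξ p x).1 ∈ _
      rw [Trivialization.coe_fst _ ((Trivialization.mem_source _).2 hx3)]
      exact hx4
    · change P (extChartAt (I.prod 𝓘(ℝ, F)) (zeroSection F ξ p) x)
      rw [hchart]
      refine hP₁₂ hx1 (hball ?_)
      rw [dist_zero_right]
      change ‖(trivializationAt F ξ p x).2‖ < δ
      have h1 : (trivializationAt F ξ p x).2 =
          (trivializationAt F ξ p).continuousLinearMapAt ℝ x.proj x.snd :=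
        (continuousLinearMapAt_eq_of_mem _ hx3 x.snd).symm
      rw [h1]
      have h2 : ‖x.snd‖ = r := by
        have h3 : ‖x.snd‖ ^ 2 = r ^ 2 := by
          rw [← real_inner_self_eq_norm_sq]; exact hx
        exact (pow_left_inj₀ (norm_nonneg _) (le_of_lt hr) two_ne_zero).1 h3
      refine lt_of_le_of_lt (ContinuousLinearMap.le_opNorm _ _) (lt_of_le_of_lt ?_ hCr)
      rw [h2]
      exact mul_le_mul_of_nonneg_right (le_of_lt hx2) (le_of_lt hr)
  choose K hK hev using key
  obtain ⟨t, ht⟩ := CompactSpace.elim_nhds_subcover K hK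
  have hall := (t.eventually_all (l := 𝓝[>] (0 : ℝ))).2 fun p _ ↦ hev p
  obtain ⟨r₀, hr₀, hsub⟩ := mem_nhdsGT_iff_exists_Ioo_subset.1 hall
  refine ⟨r₀, hr₀, fun r hr hrr₀ x hx ↦ ?_⟩
  have h1 : x.proj ∈ ⋃ p ∈ t, K p := by rw [ht]; trivial
  simp only [mem_iUnion] at h1
  obtain ⟨p, hp, hxp⟩ := h1
  exact ⟨zeroSection F ξ p, hsub ⟨hr, hrr₀⟩ p hp x hx hxp⟩

end

theorem hasPositiveRicci_sphereBundle {m n : ℕ}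
    {M : Type*} [TopologicalSpace M] [ChartedSpace (EuclideanSpace ℝ (Fin m)) M]
    [IsManifold (𝓡 m) ∞ M] [T2Space M] [CompactSpace M] [Nonempty M]
    (g : ContMDiffRiemannianMetric (𝓡 m) ∞ (EuclideanSpace ℝ (Fin m))
      (fun p : M ↦ TangentSpace (𝓡 m) p))
    {ξ : M → Type*} [TopologicalSpace (TotalSpace (EuclideanSpace ℝ (Fin n)) ξ)]
    [∀ p, NormedAddCommGroup (ξ p)] [∀ p, InnerProductSpace ℝ (ξ p)]
    [FiberBundle (EuclideanSpace ℝ (Fin n)) ξ] [VectorBundle ℝ (EuclideanSpace ℝ (Fin n)) ξ]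
    [ContMDiffVectorBundle ∞ (EuclideanSpace ℝ (Fin n)) ξ (𝓡 m)]
    [IsContMDiffRiemannianBundle (𝓡 m) ∞ (EuclideanSpace ℝ (Fin n)) ξ]
    (D : CovariantDerivative (𝓡 m) (EuclideanSpace ℝ (Fin n)) ξ)
    (hD : CovariantDerivative.ContMDiffCovariantDerivative D ∞) (hDmetric : D.IsMetricCompatible)
    (hpos : HasPositiveRicci g.inner m (univ : Set M)) (hn : 3 ≤ n) :
    ∃ r₀ : ℝ, 0 < r₀ ∧ ∀ r : ℝ, 0 < r → r < r₀ →
      HasPositiveRicci (connectionMetric g.inner D) (m + n - 1)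
        (sphereBundle (EuclideanSpace ℝ (Fin n)) ξ r) := by
  obtain ⟨r₀, hr₀, h⟩ := exists_forall_sphereBundle_pos g D hD hDmetric
    (fun p a ha ↦ hpos _ _ (isLocalParametrization_extChartAt_symm p) _
      (mem_extChartAt_target p) a ha) (by simpa using hn)
  refine ⟨r₀, hr₀, fun r hr hrr₀ U φ hφ y hy u hu ↦ ?_⟩
  have hyS : φ y ∈ sphereBundle (EuclideanSpace ℝ (Fin n)) ξ r := by
    obtain ⟨O, -, hO⟩ := hφ.image_open
    exact (hO.subset (mem_image_of_mem φ hy)).2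
  obtain ⟨x₀, hx₀, hx₀'⟩ := h r hr hrr₀ (φ y) hyS
  obtain ⟨w, hw, hric⟩ := ricci_pullbackMetric_connectionMetric g D hD hDmetric x₀ hr hφ
    (by simp; omega) hy hx₀ hu
  rw [hric]
  exact hx₀' w hw

end

/-! ### The isoparametric function and the principal curvatures -/

noncomputable section

set_option maxSynthPendingDepth 3
set_option linter.unusedSectionVars false

section

variable {E : Type*} [NormedAddCommGroup E] [NormedSpace ℝ E] [FiniteDimensional ℝ E]
  {H : Type*} [TopologicalSpace H] {I : ModelWithCorners ℝ E H}
  {N : Type*} [TopologicalSpace N] [ChartedSpace H N]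

theorem riemGradient_eq_of_forall {G : BilinearField I N} {f : N → ℝ} {x : N}
    (hpos : ∀ u, u ≠ 0 → 0 < G x u u) {X : TangentSpace I x}
    (h : ∀ w, G x X w = mvfderiv I f x w) : riemGradient G f x = X := by
  have h1 : mvfderiv I f x = G x X := ContinuousLinearMap.ext fun w ↦ (h w).symm
  have h2 : (G x).IsInvertible := isInvertible_of_pos (W := E) hpos
  rw [riemGradient, h1, h2.inverse_apply_eq]

theorem IsRiemannianMetric.pos [IsManifold I 1 N] {G : BilinearField I N}
    (hG : IsRiemannianMetric G) (x : N) (u : TangentSpace I x) (hu : u ≠ 0) : 0 < G x u u := by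
  obtain ⟨g, hg⟩ := hG
  rw [← hg x]
  exact g.pos x u hu

end

section

variable {EM : Type*} [NormedAddCommGroup EM] [NormedSpace ℝ EM] [FiniteDimensional ℝ EM]
  {H : Type*} [TopologicalSpace H] {I : ModelWithCorners ℝ EM H}
  {M : Type*} [TopologicalSpace M] [ChartedSpace H M] [I.Boundaryless] [IsManifold I ∞ M]
  [T2Space M]
  {F : Type*} [NormedAddCommGroup F] [NormedSpace ℝ F] [FiniteDimensional ℝ F]
  {ξ : M → Type*} [TopologicalSpace (TotalSpace F ξ)]
  [∀ p, NormedAddCommGroup (ξ p)] [∀ p, InnerProductSpace ℝ (ξ p)]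
  [FiberBundle F ξ] [VectorBundle ℝ F ξ] [ContMDiffVectorBundle ∞ F ξ I]
  [IsContMDiffRiemannianBundle I ∞ F ξ]
  (g : ContMDiffRiemannianMetric I ∞ EM (fun p : M ↦ TangentSpace I p))
  (D : CovariantDerivative I F ξ)

/-- In a bundle chart, the gradient of `(p, v) ↦ ⟨v, v⟩` is twice the position vector field. -/
theorem riemGradient_fiberNormSq (hD : CovariantDerivative.ContMDiffCovariantDerivative D ∞)
    (hDmetric : D.IsMetricCompatible) (x₀ : TotalSpace F ξ) {y : EM × F}
    (hy : y.1 ∈ coordDomain I F ξ x₀.proj) :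
    riemGradient (connectionMetric g.inner D) (fiberNormSq F ξ)
      ((extChartAt (I.prod 𝓘(ℝ, F)) x₀).symm y) =
    paramDeriv (I.prod 𝓘(ℝ, F)) (extChartAt (I.prod 𝓘(ℝ, F)) x₀).symm y
      ((2 : ℝ) • (0, y.2)) := by
  have h := isConnectionData_coord g D hD hDmetric x₀.proj
  have hyt : y ∈ (extChartAt (I.prod 𝓘(ℝ, F)) x₀).target := by
    rw [extChartAt_totalSpace_target]; exact ⟨hy, mem_univ _⟩
  refine riemGradient_eq_of_forall
    ((isRiemannianMetric_connectionMetric g D hD hDmetric).pos _) fun w ↦ ?_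
  obtain ⟨u, rfl⟩ := (isInvertible_paramDeriv_extChartAt_symm hyt).surjective w
  rw [mvfderiv_paramDeriv ((contMDiff_fiberNormSq I F ξ).mdifferentiable (by simp) _)
    (mdifferentiableAt_extChartAt_symm hyt), ← pullbackMetric_apply,
    pullbackMetric_connectionMetric _ _ _ hy,
    (fiberNormSq_comp_param_eventuallyEq x₀ hy).fderiv_eq, (h.hasFDerivAt_fiberNorm hy).fderiv,
    map_smul, smul_apply, IsConnectionData.localMetric_position_apply]
  rfl

theorem readVectorField_riemGradient_fiberNormSq
    (hD : CovariantDerivative.ContMDiffCovariantDerivative D ∞)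
    (hDmetric : D.IsMetricCompatible) (x₀ : TotalSpace F ξ) {y : EM × F}
    (hy : y.1 ∈ coordDomain I F ξ x₀.proj) :
    readVectorField (extChartAt (I.prod 𝓘(ℝ, F)) x₀).symm
      (riemGradient (connectionMetric g.inner D) (fiberNormSq F ξ)) y =
    (2 : ℝ) • ((0, y.2) : EM × F) := by
  have hyt : y ∈ (extChartAt (I.prod 𝓘(ℝ, F)) x₀).target := by
    rw [extChartAt_totalSpace_target]; exact ⟨hy, mem_univ _⟩
  rw [readVectorField, riemGradient_fiberNormSq g D hD hDmetric x₀ hy,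
    (isInvertible_paramDeriv_extChartAt_symm hyt).inverse_apply_eq]

theorem connectionMetric_riemGradient_fiberNormSq
    (hD : CovariantDerivative.ContMDiffCovariantDerivative D ∞)
    (hDmetric : D.IsMetricCompatible) (x : TotalSpace F ξ) :
    connectionMetric g.inner D x
      (riemGradient (connectionMetric g.inner D) (fiberNormSq F ξ) x)
      (riemGradient (connectionMetric g.inner D) (fiberNormSq F ξ) x) =
    4 * fiberNormSq F ξ x := by
  have h := isConnectionData_coord g D hD hDmetric x.proj
  set y := extChartAt (I.prod 𝓘(ℝ, F)) x x with hydef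
  have hy : y.1 ∈ coordDomain I F ξ x.proj :=
    fst_extChartAt_mem_coordDomain x (mem_extChartAt_source x)
  have hx : (extChartAt (I.prod 𝓘(ℝ, F)) x).symm y = x :=
    (extChartAt (I.prod 𝓘(ℝ, F)) x).left_inv (mem_extChartAt_source x)
  -- The point is made variable because the tangent space depends on it and a direct rewrite is
  -- impossible.
  suffices key : ∀ z, (extChartAt (I.prod 𝓘(ℝ, F)) x).symm y = z → connectionMetric g.inner D z
      (riemGradient (connectionMetric g.inner D) (fiberNormSq F ξ) z)
      (riemGradient (connectionMetric g.inner D) (fiberNormSq F ξ) z) =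
    4 * fiberNormSq F ξ z from key x hx
  rintro z rfl
  rw [riemGradient_fiberNormSq g D hD hDmetric x hy, ← pullbackMetric_apply,
    pullbackMetric_connectionMetric _ _ _ hy, map_smul, map_smul, smul_apply,
    IsConnectionData.localMetric_position_apply, fiberNormSq_param x hy, localConnector_apply]
  simp only [map_zero, zero_apply, add_zero, smul_eq_mul]
  ring

/-- The covariant derivative, for the connection metric, of a vector field which in a bundle chart
is proportional to the position vector field. -/
theorem covDeriv_connectionMetric (hD : CovariantDerivative.ContMDiffCovariantDerivative D ∞)
    (hDmetric : D.IsMetricCompatible) (x : TotalSpace F ξ)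
    {X : ∀ z : TotalSpace F ξ, TangentSpace (I.prod 𝓘(ℝ, F)) z} {c : EM × F → ℝ}
    {c' : EM × F →L[ℝ] ℝ} (hc : HasFDerivAt c c' (extChartAt (I.prod 𝓘(ℝ, F)) x x))
    (hX : readVectorField (extChartAt (I.prod 𝓘(ℝ, F)) x).symm X
      =ᶠ[𝓝 (extChartAt (I.prod 𝓘(ℝ, F)) x x)] fun z ↦ c z • ((0, z.2) : EM × F)) :
    covDeriv (connectionMetric g.inner D) X x =
      (mfderiv (I.prod 𝓘(ℝ, F)) 𝓘(ℝ, EM × F) (extChartAt (I.prod 𝓘(ℝ, F)) x) x).inverse ∘L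
        (c'.smulRight ((0, (extChartAt (I.prod 𝓘(ℝ, F)) x x).2) : EM × F)
          + c (extChartAt (I.prod 𝓘(ℝ, F)) x x) • (ContinuousLinearMap.inr ℝ EM F ∘L
            localConnector (connectionFormCoord D x.proj) (extChartAt (I.prod 𝓘(ℝ, F)) x x))) ∘L
      mfderiv (I.prod 𝓘(ℝ, F)) 𝓘(ℝ, EM × F) (extChartAt (I.prod 𝓘(ℝ, F)) x) x := by
  have h := isConnectionData_coord g D hD hDmetric x.proj
  have hy : (extChartAt (I.prod 𝓘(ℝ, F)) x x).1 ∈ coordDomain I F ξ x.proj :=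
    fst_extChartAt_mem_coordDomain x (mem_extChartAt_source x)
  unfold covDeriv
  set y : EM × F := extChartAt (I.prod 𝓘(ℝ, F)) x x with hydef
  congr 2
  have hG : pullbackMetric (connectionMetric g.inner D) (extChartAt (I.prod 𝓘(ℝ, F)) x).symm
      =ᶠ[𝓝 y] localMetric (pullbackMetric g.inner (extChartAt I x.proj).symm)
        (fiberMetricCoord I F ξ x.proj) (connectionFormCoord D x.proj) := by
    filter_upwards [continuous_fst.continuousAt.eventually
      ((isOpen_coordDomain (I := I) (F := F) (ξ := ξ) x.proj).mem_nhds hy)] with y' hy'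
    exact pullbackMetric_connectionMetric _ _ _ hy'
  have hpos : HasFDerivAt (fun z : EM × F ↦ ((0, z.2) : EM × F))
      (ContinuousLinearMap.inr ℝ EM F ∘L ContinuousLinearMap.snd ℝ EM F) y :=
    (ContinuousLinearMap.inr ℝ EM F ∘L ContinuousLinearMap.snd ℝ EM F).hasFDerivAt
  rw [hX.fderiv_eq, (hc.fun_smul hpos).fderiv, hX.self_of_nhds, (christoffel_congr hG).self_of_nhds]
  refine ContinuousLinearMap.ext fun u ↦ ?_
  simp only [add_apply, ContinuousLinearMap.flip_apply, map_smul, h.christoffel_position hy,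
    smul_apply, ContinuousLinearMap.comp_apply, ContinuousLinearMap.smulRight_apply,
    localConnector_apply, ContinuousLinearMap.inr_apply, ContinuousLinearMap.coe_snd']
  ext <;> simp
  module

/-- The covariant derivative of the gradient is twice the vertical projection, conjugated by the
chart; its horizontal block is zero and its vertical block is 2 · id. -/
theorem laplaceBeltrami_fiberNormSq
    (hD : CovariantDerivative.ContMDiffCovariantDerivative D ∞)
    (hDmetric : D.IsMetricCompatible) (x : TotalSpace F ξ) :
    laplaceBeltrami (connectionMetric g.inner D) (fiberNormSq F ξ) x =
      2 * Module.finrank ℝ F := by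
  have hy : (extChartAt (I.prod 𝓘(ℝ, F)) x x).1 ∈ coordDomain I F ξ x.proj :=
    fst_extChartAt_mem_coordDomain x (mem_extChartAt_source x)
  have hX : readVectorField (extChartAt (I.prod 𝓘(ℝ, F)) x).symm
      (riemGradient (connectionMetric g.inner D) (fiberNormSq F ξ))
      =ᶠ[𝓝 (extChartAt (I.prod 𝓘(ℝ, F)) x x)] fun z ↦ (2 : ℝ) • ((0, z.2) : EM × F) := by
    filter_upwards [continuous_fst.continuousAt.eventually
      ((isOpen_coordDomain (I := I) (F := F) (ξ := ξ) x.proj).mem_nhds hy)] with y' hy'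
    exact readVectorField_riemGradient_fiberNormSq g D hD hDmetric x hy'
  rw [laplaceBeltrami, covDeriv_connectionMetric g D hD hDmetric x
    (hasFDerivAt_const (2 : ℝ) _) hX]
  obtain ⟨e, he⟩ := isInvertible_mfderiv_extChartAt (I := I.prod 𝓘(ℝ, F))
    (mem_extChartAt_source (I := I.prod 𝓘(ℝ, F)) x)
  rw [← he, ContinuousLinearMap.inverse_equiv]
  set T : EM × F →L[ℝ] EM × F := _ + _ with hT
  have h1 := LinearMap.trace_conj' (T : EM × F →ₗ[ℝ] EM × F) e.symm.toLinearEquiv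
  refine Eq.trans h1 ?_
  rw [trace_prod_eq]
  have h2 : LinearMap.fst ℝ EM F ∘ₗ (T : EM × F →ₗ[ℝ] EM × F) ∘ₗ LinearMap.inl ℝ EM F = 0 := by
    ext a; simp [hT]
  have h3 : LinearMap.snd ℝ EM F ∘ₗ (T : EM × F →ₗ[ℝ] EM × F) ∘ₗ LinearMap.inr ℝ EM F =
      (2 : ℝ) • LinearMap.id := by
    ext a; simp [hT, localConnector_apply]
  rw [h2, h3]
  simp

theorem mvfderiv_fiberNormSq {x : TotalSpace F ξ}
    (h : IsConnectionData (pullbackMetric g.inner (extChartAt I x.proj).symm)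
      (fiberMetricCoord I F ξ x.proj) (connectionFormCoord D x.proj) (coordDomain I F ξ x.proj))
    (u : TangentSpace (I.prod 𝓘(ℝ, F)) x) :
    mvfderiv (I.prod 𝓘(ℝ, F)) (fiberNormSq F ξ) x u =
      2 * fiberMetricCoord I F ξ x.proj (extChartAt (I.prod 𝓘(ℝ, F)) x x).1
        (extChartAt (I.prod 𝓘(ℝ, F)) x x).2
        (localConnector (connectionFormCoord D x.proj) (extChartAt (I.prod 𝓘(ℝ, F)) x x)
          (mfderiv (I.prod 𝓘(ℝ, F)) 𝓘(ℝ, EM × F) (extChartAt (I.prod 𝓘(ℝ, F)) x) x u)) := by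
  have hy : (extChartAt (I.prod 𝓘(ℝ, F)) x x).1 ∈ coordDomain I F ξ x.proj :=
    fst_extChartAt_mem_coordDomain x (mem_extChartAt_source x)
  have hf := h.hasFDerivAt_fiberNorm hy
  rw [mvfderiv_eq_fderiv_extChartAt hf.differentiableAt (fiberNormSq_comp_param_eventuallyEq x hy),
    hf.fderiv]
  rfl

/-- The unit normal is the position field divided by √k(v, v). For tangent `u` this factor has zero
derivative, so ∇_u η = (0, Ku)/r and the eigenvalue equation becomes linear algebra for the
connector. -/
theorem mem_principalSpace_fiberNormSq
    (hD : CovariantDerivative.ContMDiffCovariantDerivative D ∞)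
    (hDmetric : D.IsMetricCompatible) {r : ℝ} (hr : 0 < r) {x : TotalSpace F ξ}
    (hx : x ∈ sphereBundle F ξ r) (κ : ℝ) (u : TangentSpace (I.prod 𝓘(ℝ, F)) x) :
    u ∈ principalSpace (connectionMetric g.inner D) (fiberNormSq F ξ) x κ ↔
      fiberMetricCoord I F ξ x.proj (extChartAt (I.prod 𝓘(ℝ, F)) x x).1
        (extChartAt (I.prod 𝓘(ℝ, F)) x x).2
        (localConnector (connectionFormCoord D x.proj) (extChartAt (I.prod 𝓘(ℝ, F)) x x)
          (mfderiv (I.prod 𝓘(ℝ, F)) 𝓘(ℝ, EM × F) (extChartAt (I.prod 𝓘(ℝ, F)) x) x u)) = 0 ∧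
      ((0, localConnector (connectionFormCoord D x.proj) (extChartAt (I.prod 𝓘(ℝ, F)) x x)
          (mfderiv (I.prod 𝓘(ℝ, F)) 𝓘(ℝ, EM × F) (extChartAt (I.prod 𝓘(ℝ, F)) x) x u)) : EM × F) =
        (-(r * κ)) •
          (mfderiv (I.prod 𝓘(ℝ, F)) 𝓘(ℝ, EM × F) (extChartAt (I.prod 𝓘(ℝ, F)) x) x u :
            EM × F) := by
  have h := isConnectionData_coord g D hD hDmetric x.proj
  have hy : (extChartAt (I.prod 𝓘(ℝ, F)) x x).1 ∈ coordDomain I F ξ x.proj :=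
    fst_extChartAt_mem_coordDomain x (mem_extChartAt_source x)
  have hfx : fiberMetricCoord I F ξ x.proj (extChartAt (I.prod 𝓘(ℝ, F)) x x).1
      (extChartAt (I.prod 𝓘(ℝ, F)) x x).2 (extChartAt (I.prod 𝓘(ℝ, F)) x x).2 = r ^ 2 := by
    rw [← fiberNormSq_param x hy,
      (extChartAt (I.prod 𝓘(ℝ, F)) x).left_inv (mem_extChartAt_source x)]
    exact hx
  have hf := h.hasFDerivAt_fiberNorm hy
  set k := fiberMetricCoord I F ξ x.proj with hk
  have hc := ((Real.hasDerivAt_sqrt (by rw [hfx]; positivity)).fun_inv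
    (by rw [hfx]; positivity)).comp_hasFDerivAt _ hf
  set c : EM × F → ℝ := (fun t ↦ (√t)⁻¹) ∘ fun z : EM × F ↦ k z.1 z.2 z.2 with hcdef
  have hX : readVectorField (extChartAt (I.prod 𝓘(ℝ, F)) x).symm
      (levelUnitNormal (connectionMetric g.inner D) (fiberNormSq F ξ))
      =ᶠ[𝓝 (extChartAt (I.prod 𝓘(ℝ, F)) x x)] fun z ↦ c z • ((0, z.2) : EM × F) := by
    filter_upwards [continuous_fst.continuousAt.eventually
      ((isOpen_coordDomain (I := I) (F := F) (ξ := ξ) x.proj).mem_nhds hy)] with z hz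
    have h1 := readVectorField_riemGradient_fiberNormSq g D hD hDmetric x hz
    rw [readVectorField] at h1 ⊢
    rw [levelUnitNormal, map_smul, h1, connectionMetric_riemGradient_fiberNormSq g D hD hDmetric,
      fiberNormSq_param x hz, smul_smul, Real.sqrt_mul (by norm_num),
      show (4 : ℝ) = 2 ^ 2 by norm_num, Real.sqrt_sq (by norm_num), hcdef]
    congr 1
    rw [mul_inv, mul_right_comm, inv_mul_cancel₀ two_ne_zero, one_mul]
    rfl
  have hcx : c (extChartAt (I.prod 𝓘(ℝ, F)) x x) = r⁻¹ := by
    simp only [hcdef, Function.comp_apply, hfx, Real.sqrt_sq hr.le]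
  rw [principalSpace, Submodule.mem_inf, LinearMap.mem_ker, Module.End.mem_eigenspace_iff]
  simp only [ContinuousLinearMap.coe_coe, LinearMap.neg_apply]
  rw [mvfderiv_fiberNormSq g D h, mul_eq_zero, or_iff_right two_ne_zero]
  refine and_congr_right fun hu ↦ ?_
  rw [covDeriv_connectionMetric g D hD hDmetric x hc hX]
  obtain ⟨e, he⟩ : ∃ e : TangentSpace (I.prod 𝓘(ℝ, F)) x ≃L[ℝ] EM × F,
      (e : TangentSpace (I.prod 𝓘(ℝ, F)) x →L[ℝ] EM × F) =
        mfderiv (I.prod 𝓘(ℝ, F)) 𝓘(ℝ, EM × F) (extChartAt (I.prod 𝓘(ℝ, F)) x) x :=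
    isInvertible_mfderiv_extChartAt (mem_extChartAt_source x)
  rw [← he] at hu ⊢
  set K := localConnector (connectionFormCoord D x.proj) (extChartAt (I.prod 𝓘(ℝ, F)) x x) with hK
  have hu' : k (extChartAt (I.prod 𝓘(ℝ, F)) x x).1 (extChartAt (I.prod 𝓘(ℝ, F)) x x).2
      (K (e u)) = 0 := hu
  -- The scalar `a` stands for the derivative of t ↦ (√t)⁻¹; its value does not matter, as it
  -- multiplies k(v, Ku) = 0.
  have hval : ∀ (a : ℝ) (b : EM × F),
      -((e : TangentSpace (I.prod 𝓘(ℝ, F)) x →L[ℝ] EM × F).inverse ((a • (2 : ℝ) •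
      k (extChartAt (I.prod 𝓘(ℝ, F)) x x).1 (extChartAt (I.prod 𝓘(ℝ, F)) x x).2 (K (e u))) • b
        + r⁻¹ • ((0, K (e u)) : EM × F))) = κ • u ↔
      ((0, K (e u)) : EM × F) = (-(r * κ)) • e u := by
    intro a b
    rw [hu', smul_zero, smul_zero, zero_smul, zero_add, ← map_neg,
      ContinuousLinearMap.inverse_equiv, ContinuousLinearEquiv.coe_coe, e.symm_apply_eq, map_smul,
      neg_eq_iff_eq_neg, inv_smul_eq_iff₀ hr.ne', neg_smul, mul_smul, smul_neg]
  have := hval (-(1 / (2 * √(r ^ 2))) / √(r ^ 2) ^ 2) (0, (extChartAt (I.prod 𝓘(ℝ, F)) x x).2)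
  rw [hfx, hcx]
  exact this

/-- For κ = 0 the equation is Ku = 0, and tangency is automatic. The connector is onto F, so its
kernel has the dimension of the base. -/
theorem finrank_principalSpace_zero
    (hD : CovariantDerivative.ContMDiffCovariantDerivative D ∞)
    (hDmetric : D.IsMetricCompatible) {r : ℝ} (hr : 0 < r) {x : TotalSpace F ξ}
    (hx : x ∈ sphereBundle F ξ r) :
    Module.finrank ℝ (principalSpace (connectionMetric g.inner D) (fiberNormSq F ξ) x 0) =
      Module.finrank ℝ EM := by
  obtain ⟨e, he⟩ : ∃ e : TangentSpace (I.prod 𝓘(ℝ, F)) x ≃L[ℝ] EM × F,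
      (e : TangentSpace (I.prod 𝓘(ℝ, F)) x →L[ℝ] EM × F) =
        mfderiv (I.prod 𝓘(ℝ, F)) 𝓘(ℝ, EM × F) (extChartAt (I.prod 𝓘(ℝ, F)) x) x :=
    isInvertible_mfderiv_extChartAt (mem_extChartAt_source x)
  set K := localConnector (connectionFormCoord D x.proj) (extChartAt (I.prod 𝓘(ℝ, F)) x x) with hK
  have hs : principalSpace (connectionMetric g.inner D) (fiberNormSq F ξ) x 0 =
      (LinearMap.ker (K : EM × F →ₗ[ℝ] F)).comap
        (e.toLinearEquiv : TangentSpace (I.prod 𝓘(ℝ, F)) x →ₗ[ℝ] EM × F) := by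
    ext u
    rw [mem_principalSpace_fiberNormSq g D hD hDmetric hr hx, ← he, Submodule.mem_comap,
      LinearMap.mem_ker]
    constructor
    · rintro ⟨-, h⟩
      have h' : ((0, K (e u)) : EM × F) = (-(r * 0)) • e u := h
      rw [mul_zero, neg_zero, zero_smul] at h'
      exact congrArg Prod.snd h'
    · intro h
      have h' : K (e u) = 0 := h
      refine ⟨?_, ?_⟩
      · change fiberMetricCoord I F ξ x.proj _ _ (K (e u)) = 0
        rw [h', map_zero]
      · change ((0, K (e u)) : EM × F) = (-(r * 0)) • e u
        rw [h', mul_zero, neg_zero, zero_smul]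
        rfl
  rw [hs, Submodule.comap_equiv_eq_map_symm, LinearEquiv.finrank_map_eq]
  have hsurj : Function.Surjective (K : EM × F →ₗ[ℝ] F) := fun b ↦
    ⟨(0, b), by simp [hK, localConnector_apply]⟩
  have h1 := LinearMap.finrank_range_add_finrank_ker (K : EM × F →ₗ[ℝ] F)
  rw [LinearMap.range_eq_top.2 hsurj, finrank_top, Module.finrank_prod] at h1
  omega

/-- For κ = -1/r the equation says u = (0, Ku), that is, u is vertical; tangency leaves the
hyperplane of F orthogonal to v. -/
theorem finrank_principalSpace_neg_inv
    (hD : CovariantDerivative.ContMDiffCovariantDerivative D ∞)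
    (hDmetric : D.IsMetricCompatible) {r : ℝ} (hr : 0 < r) {x : TotalSpace F ξ}
    (hx : x ∈ sphereBundle F ξ r) :
    Module.finrank ℝ (principalSpace (connectionMetric g.inner D) (fiberNormSq F ξ) x (-1 / r)) =
      Module.finrank ℝ F - 1 := by
  obtain ⟨e, he⟩ : ∃ e : TangentSpace (I.prod 𝓘(ℝ, F)) x ≃L[ℝ] EM × F,
      (e : TangentSpace (I.prod 𝓘(ℝ, F)) x →L[ℝ] EM × F) =
        mfderiv (I.prod 𝓘(ℝ, F)) 𝓘(ℝ, EM × F) (extChartAt (I.prod 𝓘(ℝ, F)) x) x :=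
    isInvertible_mfderiv_extChartAt (mem_extChartAt_source x)
  have hy : (extChartAt (I.prod 𝓘(ℝ, F)) x x).1 ∈ coordDomain I F ξ x.proj :=
    fst_extChartAt_mem_coordDomain x (mem_extChartAt_source x)
  have hfx : fiberMetricCoord I F ξ x.proj (extChartAt (I.prod 𝓘(ℝ, F)) x x).1
      (extChartAt (I.prod 𝓘(ℝ, F)) x x).2 (extChartAt (I.prod 𝓘(ℝ, F)) x x).2 = r ^ 2 := by
    rw [← fiberNormSq_param x hy,
      (extChartAt (I.prod 𝓘(ℝ, F)) x).left_inv (mem_extChartAt_source x)]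
    exact hx
  set K := localConnector (connectionFormCoord D x.proj) (extChartAt (I.prod 𝓘(ℝ, F)) x x) with hK
  set κ : F →L[ℝ] ℝ := fiberMetricCoord I F ξ x.proj (extChartAt (I.prod 𝓘(ℝ, F)) x x).1
      (extChartAt (I.prod 𝓘(ℝ, F)) x x).2 with hκ
  have hs : principalSpace (connectionMetric g.inner D) (fiberNormSq F ξ) x (-1 / r) =
      ((LinearMap.ker (κ : F →ₗ[ℝ] ℝ)).map (LinearMap.inr ℝ EM F)).comap
        (e.toLinearEquiv : TangentSpace (I.prod 𝓘(ℝ, F)) x →ₗ[ℝ] EM × F) := by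
    ext u
    rw [mem_principalSpace_fiberNormSq g D hD hDmetric hr hx, ← he, Submodule.mem_comap,
      Submodule.mem_map, show -(r * (-1 / r)) = 1 by field_simp, one_smul]
    constructor
    · rintro ⟨h1, h2⟩
      exact ⟨K (e u), h1, h2⟩
    · rintro ⟨b, hb, hbu⟩
      have h' : e u = (0, b) := hbu.symm
      have h'' : K (e u) = b := by rw [h', hK, localConnector_apply]; simp
      refine ⟨?_, ?_⟩
      · change κ (K (e u)) = 0
        rw [h'']
        exact hb
      · change ((0, K (e u)) : EM × F) = e u
        rw [h'', h']
  rw [hs, Submodule.comap_equiv_eq_map_symm, LinearEquiv.finrank_map_eq,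
    ← (Submodule.equivMapOfInjective _ LinearMap.inr_injective _).finrank_eq]
  have hne : (κ : F →ₗ[ℝ] ℝ) ≠ 0 := fun h0 ↦ by
    have h1 : κ (extChartAt (I.prod 𝓘(ℝ, F)) x x).2 = 0 := DFunLike.congr_fun h0 _
    rw [hfx] at h1
    exact (pow_pos hr 2).ne' h1
  have := Module.Dual.finrank_ker_add_one_of_ne_zero hne
  omega

theorem isIsoparametricHypersurface_sphereBundle [Nonempty M] [Nontrivial F]
    (hD : CovariantDerivative.ContMDiffCovariantDerivative D ∞)
    (hDmetric : D.IsMetricCompatible) {r : ℝ} (hr : 0 < r) :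
    IsIsoparametricHypersurface (connectionMetric g.inner D) (sphereBundle F ξ r) := by
  obtain ⟨p⟩ := (inferInstance : Nonempty M)
  obtain ⟨b, hb⟩ := exists_ne (0 : F)
  have hex : ∃ v : ξ p, v ≠ 0 :=
    ⟨_, ((trivializationAt F ξ p).continuousLinearEquivAt ℝ p
      (mem_baseSet_trivializationAt F ξ p)).symm.map_ne_zero_iff.2 hb⟩
  obtain ⟨v, hv⟩ := hex
  have hv' : ‖v‖ ≠ 0 := norm_ne_zero_iff.2 hv
  have hmem : (⟨p, (r / ‖v‖) • v⟩ : TotalSpace F ξ) ∈ sphereBundle F ξ r := by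
    change inner ℝ ((r / ‖v‖) • v) ((r / ‖v‖) • v) = r ^ 2
    rw [real_inner_self_eq_norm_sq, norm_smul, Real.norm_of_nonneg (by positivity),
      div_mul_cancel₀ _ hv']
  refine ⟨fiberNormSq F ξ, r ^ 2, ⟨contMDiff_fiberNormSq I F ξ, ?_, ?_, ?_⟩, rfl, ⟨_, hmem⟩, ?_⟩
  · refine ⟨⟨p, (r / ‖v‖) • v⟩, ⟨p, 0⟩, ?_⟩
    have h1 : fiberNormSq F ξ ⟨p, (r / ‖v‖) • v⟩ = r ^ 2 := hmem
    have h2 : fiberNormSq F ξ ⟨p, 0⟩ = 0 := inner_zero_left _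
    rw [h1, h2]
    positivity
  · exact ⟨fun t ↦ 4 * t, by fun_prop,
      connectionMetric_riemGradient_fiberNormSq g D hD hDmetric⟩
  · exact ⟨fun _ ↦ 2 * Module.finrank ℝ F, continuous_const,
      laplaceBeltrami_fiberNormSq g D hD hDmetric⟩
  · intro x hx h0
    have h1 := connectionMetric_riemGradient_fiberNormSq g D hD hDmetric x
    have h2 : riemGradient (connectionMetric g.inner D) (fiberNormSq F ξ) x = 0 := by
      rw [riemGradient, h0, map_zero]
    have h3 : fiberNormSq F ξ x = r ^ 2 := hx
    rw [h2, map_zero, h3] at h1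
    have := pow_pos hr 2
    linarith

end

end

/-! ### Sphere bundles as embedded hypersurfaces -/

noncomputable section

set_option maxSynthPendingDepth 3
set_option linter.unusedSectionVars false

section

variable {X F : Type*} [NormedAddCommGroup X] [NormedSpace ℝ X]
  [NormedAddCommGroup F] [NormedSpace ℝ F]

/-- The projection of `F` onto the kernel of `ℓ` along the vector `v`, where `ℓ v = 1`. -/
def kerProj {ℓ : F →L[ℝ] ℝ} {v : F} (hv : ℓ v = 1) : F →L[ℝ] LinearMap.ker ℓ.toLinearMap :=
  (ContinuousLinearMap.id ℝ F - ℓ.smulRight v).codRestrict _ fun w ↦ by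
    simp [LinearMap.mem_ker, hv]

theorem coe_kerProj {ℓ : F →L[ℝ] ℝ} {v : F} (hv : ℓ v = 1) (w : F) :
    (kerProj hv w : F) = w - ℓ w • v := rfl

/-- The central projection of the affine hyperplane through `v` parallel to `ker ℓ` to the sphere
of radius `r`, in each fibre. -/
def sphereParam (k : X → F →L[ℝ] F →L[ℝ] ℝ) (r : ℝ) (ℓ : F →L[ℝ] ℝ) (v : F)
    (y : X × LinearMap.ker ℓ.toLinearMap) : X × F :=
  (y.1, (r / √(k y.1 (v + y.2) (v + y.2))) • (v + y.2))

/-- The inverse of `sphereParam`. -/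
def sphereChart {ℓ : F →L[ℝ] ℝ} {v : F} (hv : ℓ v = 1) (z : X × F) :
    X × LinearMap.ker ℓ.toLinearMap :=
  (z.1, (ℓ z.2)⁻¹ • kerProj hv z.2)

variable {k : X → F →L[ℝ] F →L[ℝ] ℝ} {r : ℝ} {ℓ : F →L[ℝ] ℝ} {v : F} {Ω : Set X}

theorem map_add_ker (hv : ℓ v = 1) (s : LinearMap.ker ℓ.toLinearMap) : ℓ (v + s) = 1 := by
  rw [map_add, hv, show ℓ s = 0 from s.2, add_zero]

theorem add_ker_ne_zero (hv : ℓ v = 1) (s : LinearMap.ker ℓ.toLinearMap) : v + (s : F) ≠ 0 :=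
  fun h ↦ by simpa [h] using map_add_ker hv s

theorem map_sphereParam_pos (hr : 0 < r) (hv : ℓ v = 1) (hk : ∀ a ∈ Ω, ∀ b, b ≠ 0 → 0 < k a b b)
    {y : X × LinearMap.ker ℓ.toLinearMap} (hy : y.1 ∈ Ω) : 0 < ℓ (sphereParam k r ℓ v y).2 := by
  have := hk y.1 hy _ (add_ker_ne_zero hv y.2)
  rw [sphereParam, map_smul, map_add_ker hv, smul_eq_mul, mul_one]
  positivity

theorem bilin_sphereParam (hv : ℓ v = 1) (hk : ∀ a ∈ Ω, ∀ b, b ≠ 0 → 0 < k a b b)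
    {y : X × LinearMap.ker ℓ.toLinearMap} (hy : y.1 ∈ Ω) :
    k y.1 (sphereParam k r ℓ v y).2 (sphereParam k r ℓ v y).2 = r ^ 2 := by
  have h := hk y.1 hy _ (add_ker_ne_zero hv y.2)
  simp only [sphereParam, map_smul, smul_apply, smul_eq_mul]
  have h1 := Real.sq_sqrt h.le
  have h2 := (Real.sqrt_pos.2 h).ne'
  field_simp
  rw [h1]

theorem sphereChart_sphereParam (hr : 0 < r) (hv : ℓ v = 1)
    (hk : ∀ a ∈ Ω, ∀ b, b ≠ 0 → 0 < k a b b)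
    {y : X × LinearMap.ker ℓ.toLinearMap} (hy : y.1 ∈ Ω) :
    sphereChart hv (sphereParam k r ℓ v y) = y := by
  have h := map_sphereParam_pos hr hv hk hy
  refine Prod.ext rfl (Subtype.ext ?_)
  simp only [sphereParam, map_smul, map_add_ker hv, smul_eq_mul, mul_one] at h
  simp only [sphereChart, sphereParam, coe_kerProj, map_smul, map_add_ker hv, smul_eq_mul, mul_one,
    smul_smul, inv_mul_cancel₀ h.ne', one_smul,
    add_sub_cancel_left]

theorem sphereParam_sphereChart (hr : 0 < r) (hv : ℓ v = 1) {z : X × F} (hz : 0 < ℓ z.2)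
    (hzr : k z.1 z.2 z.2 = r ^ 2) : sphereParam k r ℓ v (sphereChart hv z) = z := by
  have h1 : v + ((sphereChart hv z).2 : F) = (ℓ z.2)⁻¹ • z.2 := by
    simp only [sphereChart, Submodule.coe_smul, coe_kerProj, smul_sub, smul_smul,
      inv_mul_cancel₀ hz.ne', one_smul, add_sub_cancel]
  refine Prod.ext rfl ?_
  have h2 : k (sphereChart hv z).1 ((ℓ z.2)⁻¹ • z.2) ((ℓ z.2)⁻¹ • z.2) = (r / ℓ z.2) ^ 2 := by
    simp only [map_smul, smul_apply, smul_eq_mul]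
    change (ℓ z.2)⁻¹ * ((ℓ z.2)⁻¹ * k z.1 z.2 z.2) = _
    rw [hzr]
    field_simp
  rw [sphereParam, h1, h2, Real.sqrt_sq (by positivity), smul_smul]
  have h3 : r / (r / ℓ z.2) * (ℓ z.2)⁻¹ = 1 := by field_simp
  rw [h3, one_smul]

theorem contDiffOn_sphereParam (hv : ℓ v = 1) (hk : ∀ a ∈ Ω, ∀ b, b ≠ 0 → 0 < k a b b)
    (hks : ContDiffOn ℝ ∞ k Ω) :
    ContDiffOn ℝ ∞ (sphereParam k r ℓ v) (Ω ×ˢ univ) := by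
  have h1 : ContDiffOn ℝ ∞ (fun y : X × LinearMap.ker ℓ.toLinearMap ↦ k y.1) (Ω ×ˢ univ) :=
    hks.comp contDiff_fst.contDiffOn fun y hy ↦ hy.1
  have h2 : ContDiff ℝ ∞ (fun y : X × LinearMap.ker ℓ.toLinearMap ↦ v + (y.2 : F)) :=
    contDiff_const.add
      ((LinearMap.ker ℓ.toLinearMap).subtypeL.contDiff.comp contDiff_snd)
  have h3 : ContDiffOn ℝ ∞ (fun y : X × LinearMap.ker ℓ.toLinearMap ↦
      k y.1 (v + y.2) (v + y.2)) (Ω ×ˢ univ) :=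
    (h1.clm_apply h2.contDiffOn).clm_apply h2.contDiffOn
  have hpos : ∀ y ∈ Ω ×ˢ (univ : Set (LinearMap.ker ℓ.toLinearMap)),
      0 < k y.1 (v + y.2) (v + y.2) := fun y hy ↦ hk y.1 hy.1 _ (add_ker_ne_zero hv y.2)
  refine contDiffOn_fst.prodMk (ContDiffOn.smul ?_ h2.contDiffOn)
  exact contDiffOn_const.div (h3.sqrt fun y hy ↦ (hpos y hy).ne')
    fun y hy ↦ (Real.sqrt_pos.2 (hpos y hy)).ne'

theorem contDiffAt_sphereChart (hv : ℓ v = 1) {z : X × F} (hz : 0 < ℓ z.2) :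
    ContDiffAt ℝ ∞ (sphereChart hv) z := by
  have h1 : ContDiffAt ℝ ∞ (fun z : X × F ↦ ℓ z.2) z := ℓ.contDiff.contDiffAt.comp z contDiffAt_snd
  have h2 : ContDiffAt ℝ ∞ (fun z : X × F ↦ kerProj hv z.2) z :=
    (kerProj hv).contDiff.contDiffAt.comp z contDiffAt_snd
  exact contDiffAt_fst.prodMk ((h1.inv hz.ne').smul h2)

end

section

variable {EM : Type*} [NormedAddCommGroup EM] [NormedSpace ℝ EM] [FiniteDimensional ℝ EM]
  {H : Type*} [TopologicalSpace H] {I : ModelWithCorners ℝ EM H}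
  {M : Type*} [TopologicalSpace M] [ChartedSpace H M] [I.Boundaryless] [IsManifold I ∞ M]
  [T2Space M]
  {F : Type*} [NormedAddCommGroup F] [NormedSpace ℝ F] [FiniteDimensional ℝ F]
  {ξ : M → Type*} [TopologicalSpace (TotalSpace F ξ)]
  [∀ p, NormedAddCommGroup (ξ p)] [∀ p, InnerProductSpace ℝ (ξ p)]
  [FiberBundle F ξ] [VectorBundle ℝ F ξ] [ContMDiffVectorBundle ∞ F ξ I]
  [IsContMDiffRiemannianBundle I ∞ F ξ]
  (D : CovariantDerivative I F ξ)

/-- Central projection onto the hemisphere ℓ > 0 has an explicit inverse, smooth on an open subset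
of the ambient chart. This one left inverse yields injectivity of the differential and the embedding
property together. -/
theorem isLocalParametrization_sphereBundle
    (g : ContMDiffRiemannianMetric I ∞ EM (fun p : M ↦ TangentSpace I p))
    {x : TotalSpace F ξ}
    (h : IsConnectionData (pullbackMetric g.inner (extChartAt I x.proj).symm)
      (fiberMetricCoord I F ξ x.proj) (connectionFormCoord D x.proj) (coordDomain I F ξ x.proj))
    {r : ℝ} (hr : 0 < r) {ℓ : F →L[ℝ] ℝ} {v : F} (hv : ℓ v = 1) {d : ℕ}
    (L : EuclideanSpace ℝ (Fin d) ≃L[ℝ] EM × LinearMap.ker ℓ.toLinearMap) :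
    IsLocalParametrization (I.prod 𝓘(ℝ, F)) d (sphereBundle F ξ r)
      (L ⁻¹' (coordDomain I F ξ x.proj ×ˢ univ))
      ((extChartAt (I.prod 𝓘(ℝ, F)) x).symm ∘
        sphereParam (fiberMetricCoord I F ξ x.proj) r ℓ v ∘ L) ∧
    ∀ z ∈ (extChartAt (I.prod 𝓘(ℝ, F)) x).source ∩ sphereBundle F ξ r,
      0 < ℓ (extChartAt (I.prod 𝓘(ℝ, F)) x z).2 →
      z ∈ ((extChartAt (I.prod 𝓘(ℝ, F)) x).symm ∘
        sphereParam (fiberMetricCoord I F ξ x.proj) r ℓ v ∘ L) ''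
          (L ⁻¹' (coordDomain I F ξ x.proj ×ˢ univ)) := by
  set χ := extChartAt (I.prod 𝓘(ℝ, F)) x with hχ
  set Ω := coordDomain I F ξ x.proj with hΩ
  set k := fiberMetricCoord I F ξ x.proj with hk
  set ψ := sphereParam k r ℓ v with hψ
  set U := L ⁻¹' (Ω ×ˢ univ) with hU
  have hUo : IsOpen U := (h.isOpen.prod isOpen_univ).preimage L.continuous
  have htarget : χ.target = Ω ×ˢ univ := extChartAt_totalSpace_target x
  have hmaps : MapsTo (ψ ∘ L) U χ.target := fun y hy ↦ by
    rw [htarget]; exact ⟨hy.1, mem_univ _⟩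
  have hψs : ContDiffOn ℝ ∞ (ψ ∘ L) U :=
    (contDiffOn_sphereParam hv h.fiber_pos h.contDiffOn_fiber).comp L.contDiff.contDiffOn
      fun y hy ↦ hy
  have hφs : ContMDiffOn 𝓘(ℝ, EuclideanSpace ℝ (Fin d)) (I.prod 𝓘(ℝ, F)) ∞ (χ.symm ∘ ψ ∘ L) U :=
    (contMDiffOn_extChartAt_symm x).comp hψs.contMDiffOn hmaps
  have hleft : ∀ y ∈ U, L.symm (sphereChart hv (χ ((χ.symm ∘ ψ ∘ L) y))) = y := fun y hy ↦ by
    rw [Function.comp_apply, χ.right_inv (hmaps hy), Function.comp_apply,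
      sphereChart_sphereParam hr hv h.fiber_pos hy.1, L.symm_apply_apply]
  have hlefts : ∀ y ∈ U, ContMDiffAt (I.prod 𝓘(ℝ, F)) 𝓘(ℝ, EuclideanSpace ℝ (Fin d)) ∞
      (fun z ↦ L.symm (sphereChart hv (χ z))) ((χ.symm ∘ ψ ∘ L) y) := fun y hy ↦ by
    have h1 : ContMDiffAt (I.prod 𝓘(ℝ, F)) 𝓘(ℝ, EM × F) ∞ χ ((χ.symm ∘ ψ ∘ L) y) :=
      contMDiffAt_extChartAt' (by
        rw [← extChartAt_source (I.prod 𝓘(ℝ, F))]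
        exact χ.map_target (hmaps hy))
    have h2 : ContDiffAt ℝ ∞ (fun z ↦ L.symm (sphereChart hv z)) (χ ((χ.symm ∘ ψ ∘ L) y)) := by
      refine L.symm.contDiff.contDiffAt.comp _ (contDiffAt_sphereChart hv ?_)
      rw [Function.comp_apply, χ.right_inv (hmaps hy)]
      exact map_sphereParam_pos hr hv h.fiber_pos hy.1
    exact h2.contMDiffAt.comp _ h1
  have himage : ∀ z ∈ χ.source ∩ sphereBundle F ξ r, 0 < ℓ (χ z).2 →
      z ∈ (χ.symm ∘ ψ ∘ L) '' U := by
    rintro z ⟨hz, hzr⟩ hzℓ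
    have hzΩ : (χ z).1 ∈ Ω := fst_extChartAt_mem_coordDomain x hz
    refine ⟨L.symm (sphereChart hv (χ z)), ?_, ?_⟩
    · rw [hU, mem_preimage, L.apply_symm_apply]
      exact ⟨hzΩ, mem_univ _⟩
    · have hkz : k (χ z).1 (χ z).2 (χ z).2 = r ^ 2 := by
        rw [hk, ← fiberNormSq_param x hzΩ, ← hχ, χ.left_inv hz]
        exact hzr
      rw [Function.comp_apply, Function.comp_apply, L.apply_symm_apply, hψ,
        sphereParam_sphereChart hr hv hzℓ hkz, χ.left_inv hz]
  refine ⟨⟨hUo, hφs, fun y hy ↦ ?_, ?_, ?_⟩, himage⟩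
  · have hid : (fun z ↦ L.symm (sphereChart hv (χ z))) ∘ (χ.symm ∘ ψ ∘ L) =ᶠ[𝓝 y] id := by
      filter_upwards [hUo.mem_nhds hy] with y' hy'
      exact hleft y' hy'
    have key : ∀ u, mvfderiv (I.prod 𝓘(ℝ, F)) (fun z ↦ L.symm (sphereChart hv (χ z))) _
        (paramDeriv (I.prod 𝓘(ℝ, F)) (χ.symm ∘ ψ ∘ L) y u) = u := fun u ↦ by
      rw [mvfderiv_paramDeriv ((hlefts y hy).mdifferentiableAt (by simp))
        ((hφs.contMDiffAt (hUo.mem_nhds hy)).mdifferentiableAt (by simp)), hid.fderiv_eq, fderiv_id]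
      rfl
    intro u u' huu'
    rw [← key u, huu', key u']
  · exact isEmbedding_domRestrict_of_leftInverse
      (g := fun z ↦ L.symm (sphereChart hv (χ z))) hφs.continuousOn hleft
      fun y hy ↦ (hlefts y hy).continuousAt
  · refine ⟨χ.source ∩ χ ⁻¹' {z | 0 < ℓ z.2}, (continuousOn_extChartAt x).isOpen_inter_preimage
      (isOpen_extChartAt_source x) (isOpen_lt continuous_const (by fun_prop)), ?_⟩
    refine Subset.antisymm ?_ fun z hz ↦ himage z ⟨hz.1.1, hz.2⟩ hz.1.2
    rintro _ ⟨y, hy, rfl⟩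
    refine ⟨⟨χ.map_target (hmaps hy), ?_⟩, ?_⟩
    · rw [mem_preimage, Function.comp_apply, χ.right_inv (hmaps hy)]
      exact map_sphereParam_pos hr hv h.fiber_pos hy.1
    · change fiberNormSq F ξ (χ.symm (ψ (L y))) = r ^ 2
      rw [fiberNormSq_param x (y := ψ (L y)) hy.1]
      exact bilin_sphereParam hv h.fiber_pos hy.1

theorem isEmbeddedSubmanifold_sphereBundle
    (g : ContMDiffRiemannianMetric I ∞ EM (fun p : M ↦ TangentSpace I p))
    (hD : CovariantDerivative.ContMDiffCovariantDerivative D ∞)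
    (hDmetric : D.IsMetricCompatible) {r : ℝ} (hr : 0 < r) {d : ℕ}
    (hdim : d + 1 = Module.finrank ℝ (EM × F)) :
    IsEmbeddedSubmanifold (I.prod 𝓘(ℝ, F)) d (sphereBundle F ξ r) := by
  intro x hx
  have h := isConnectionData_coord g D hD hDmetric x.proj
  have hy : (extChartAt (I.prod 𝓘(ℝ, F)) x x).1 ∈ coordDomain I F ξ x.proj :=
    fst_extChartAt_mem_coordDomain x (mem_extChartAt_source x)
  set v := (extChartAt (I.prod 𝓘(ℝ, F)) x x).2 with hvdef
  have hfx : fiberMetricCoord I F ξ x.proj (extChartAt (I.prod 𝓘(ℝ, F)) x x).1 v v = r ^ 2 := by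
    rw [← fiberNormSq_param x hy,
      (extChartAt (I.prod 𝓘(ℝ, F)) x).left_inv (mem_extChartAt_source x)]
    exact hx
  have hr2 : r ^ 2 ≠ 0 := by positivity
  -- The functional is orthogonal projection to the line of `v` in the fibre through `x`, scaled so
  -- that ℓ v = 1. It stays fixed while the fibre metric varies, which is harmless since only ℓ > 0
  -- is used.
  set ℓ : F →L[ℝ] ℝ :=
    (r ^ 2)⁻¹ • fiberMetricCoord I F ξ x.proj (extChartAt (I.prod 𝓘(ℝ, F)) x x).1 v with hℓ
  have hv : ℓ v = 1 := by
    rw [hℓ, smul_apply, hfx, smul_eq_mul, inv_mul_cancel₀ hr2]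
  have hne : ℓ.toLinearMap ≠ 0 := fun h0 ↦ by
    have h1 : ℓ v = 0 := DFunLike.congr_fun h0 v
    rw [hv] at h1
    exact one_ne_zero h1
  have hker := Module.Dual.finrank_ker_add_one_of_ne_zero hne
  have hfr : Module.finrank ℝ (EuclideanSpace ℝ (Fin d)) =
      Module.finrank ℝ (EM × LinearMap.ker ℓ.toLinearMap) := by
    rw [Module.finrank_prod] at hdim ⊢
    rw [finrank_euclideanSpace_fin]
    omega
  obtain ⟨h1, h2⟩ := isLocalParametrization_sphereBundle D g h hr hv
    (ContinuousLinearEquiv.ofFinrankEq hfr)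
  exact ⟨_, _, h1, h2 x ⟨mem_extChartAt_source x, hx⟩ (by rw [← hvdef, hv]; exact one_pos)⟩

end

end

theorem theorem1p2 {m n : ℕ} (hn : 1 ≤ n)
    {M : Type*} [TopologicalSpace M] [ChartedSpace (EuclideanSpace ℝ (Fin m)) M]
    [IsManifold (𝓡 m) ∞ M] [T2Space M] [CompactSpace M] [Nonempty M]
    (g : ContMDiffRiemannianMetric (𝓡 m) ∞ (EuclideanSpace ℝ (Fin m))
      (fun p : M ↦ TangentSpace (𝓡 m) p))
    {ξ : M → Type*} [TopologicalSpace (TotalSpace (EuclideanSpace ℝ (Fin n)) ξ)]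
    [∀ p, NormedAddCommGroup (ξ p)] [∀ p, InnerProductSpace ℝ (ξ p)]
    [FiberBundle (EuclideanSpace ℝ (Fin n)) ξ] [VectorBundle ℝ (EuclideanSpace ℝ (Fin n)) ξ]
    [ContMDiffVectorBundle ∞ (EuclideanSpace ℝ (Fin n)) ξ (𝓡 m)]
    [IsContMDiffRiemannianBundle (𝓡 m) ∞ (EuclideanSpace ℝ (Fin n)) ξ]
    (D : CovariantDerivative (𝓡 m) (EuclideanSpace ℝ (Fin n)) ξ)
    (hDsmooth : CovariantDerivative.ContMDiffCovariantDerivative D ∞)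
    (hDmetric : D.IsMetricCompatible) :
    -- the connection metric is a complete smooth Riemannian metric on the total space `E`
    IsRiemannianMetric (connectionMetric g.inner D) ∧
    IsCompleteMetric (connectionMetric g.inner D) ∧
    (ConnectedSpace M → ConnectedSpace (TotalSpace (EuclideanSpace ℝ (Fin n)) ξ)) ∧
    -- every sphere bundle is an isoparametric hypersurface, with constant principal curvatures
    (∀ r : ℝ, 0 < r →
      IsEmbeddedSubmanifold ((𝓡 m).prod 𝓘(ℝ, EuclideanSpace ℝ (Fin n))) (m + n - 1)
        (sphereBundle (EuclideanSpace ℝ (Fin n)) ξ r) ∧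
      IsIsoparametricHypersurface (connectionMetric g.inner D)
        (sphereBundle (EuclideanSpace ℝ (Fin n)) ξ r) ∧
      ∀ x ∈ sphereBundle (EuclideanSpace ℝ (Fin n)) ξ r,
        Module.finrank ℝ (principalSpace (connectionMetric g.inner D)
          (fiberNormSq (EuclideanSpace ℝ (Fin n)) ξ) x 0) = m ∧
        Module.finrank ℝ (principalSpace (connectionMetric g.inner D)
          (fiberNormSq (EuclideanSpace ℝ (Fin n)) ξ) x (-1 / r)) = n - 1) ∧
    -- positive Ricci curvature of small sphere bundles
    (HasPositiveRicci g.inner m (univ : Set M) → 3 ≤ n →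
      ∃ r₀ : ℝ, 0 < r₀ ∧ ∀ r : ℝ, 0 < r → r < r₀ →
        HasPositiveRicci (connectionMetric g.inner D) (m + n - 1)
          (sphereBundle (EuclideanSpace ℝ (Fin n)) ξ r)) := by
  -- The condition n ≥ 1 makes the sphere bundles nonempty and the fibre norm nonconstant; it also
  -- makes the subtraction in m + n - 1 a genuine one.
  have : Nontrivial (EuclideanSpace ℝ (Fin n)) :=
    Module.nontrivial_of_finrank_pos (R := ℝ) (by rw [finrank_euclideanSpace_fin]; exact hn)
  refine ⟨isRiemannianMetric_connectionMetric g D hDsmooth hDmetric,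
    isCompleteMetric_connectionMetric g D hDsmooth hDmetric, fun _ ↦ connectedSpace_totalSpace,
    fun r hr ↦ ⟨?_, isIsoparametricHypersurface_sphereBundle g D hDsmooth hDmetric hr,
      fun x hx ↦ ⟨?_, ?_⟩⟩, fun hpos hn' ↦ ?_⟩
  · refine isEmbeddedSubmanifold_sphereBundle D g hDsmooth hDmetric hr ?_
    rw [Module.finrank_prod, finrank_euclideanSpace_fin, finrank_euclideanSpace_fin]
    omega
  · rw [finrank_principalSpace_zero g D hDsmooth hDmetric hr hx, finrank_euclideanSpace_fin]
  · rw [finrank_principalSpace_neg_inv g D hDsmooth hDmetric hr hx, finrank_euclideanSpace_fin]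
  · exact hasPositiveRicci_sphereBundle g D hDsmooth hDmetric hpos hn'
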